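/- Let $R$ and $V$ be compact manifolds of class $C^1$ embedded in $\mathbb{R}^d$, possibly with boundary and corners, with surface measures $d\sigma$ and $d\sigma'$; every connected component of $R$ has non-empty boundary. $H^1_0(R)$ is the closure in $H^1(R)$ of the $C^1$ functions with compact support in $R\setminus\partial R$, with norm $\|u\|=(\int_R|\nabla u|^2d\sigma)^{1/2}$ and the corresponding inner product; $L^2(V)$ has its usual norm. Gradients on $R$ and $V$ are tangential. Let $B\subset\mathbb{R}^p$ be compact and, for each $m$ in some open set $B'\supset B$, let $\mathbf{H}_m:V\times R\to\mathbb{R}$ and $$\mathcal{A}_m u(x)=\int_R \mathbf{H}_m(x,y)\,u(y)\,d\sigma(y),\qquad u\in H^1_0(R),\ x\in V .$$ Assume: (R1) $\mathbf{H}_m(x,y)$ and $\nabla_x\mathbf{H}_m(x,y)$ exist and are continuous in $(m,x,y)\in B\times V\times R$; (R2) the derivatives $\partial_{m_i}\mathbf{H}_m$, $\partial_{m_i}\nabla_x\mathbf{H}_m$, $\partial_{m_i}\partial_{m_j}\mathbf{H}_m$ exist and are continuous in $B'\times V\times R$ for $1\le i,j\le p$; (U1) for all $m_1,m_2\in B$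 and $u,v\in H^1_0(R)$, if $\mathcal{A}_{m_1}u=\mathcal{A}_{m_2}v$ in $L^2(V)$ and $u\ne0$ or $v\neq 0$, then $m_1=m_2$ and $u=v$; (U2) for all unit vectors $q\in\mathbb{R}^p$, all $m\in B$ and all $u,v\in H^1_0(R)$, if $\partial_q\mathcal{A}_m u=\mathcal{A}_m v$ in $L^2(V)$, where $\partial_q\mathcal{A}_m$ is the derivative of $\mathcal{A}_m$ with respect to $m$ in the direction $q$, then $u=v=0$; (Q1) $(M_n)$ is a strictly increasing sequence of natural numbers and, for each $n$, there are points $P_{j,n}\in V$ and coefficients $C'(j,n)\in\mathbb{R}$, $1\le j\le M_n$, such that for some constant $K$, all large $n$ and all $\phi\in C^1(V)$, $$\Big|\sum_{j=1}^{M_n}C'(j,n)\phi(P_{j,n})-\int_V\phi\,d\sigma'\Big|\le\frac{K}{M_n}\sup_V|\nabla\phi| .$$ Let $\beta>0$ and, for $m\in B$, let $E_m\subset H^1_0(R)$ be the span of the eigenvectors of $\mathcal{A}_m^*\mathcal{A}_m$ for eigenvalues strictly greater than $\beta^2$, where $\mathcal{A}_m^*:L^2(V)\to H^1_0(R)$ is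 the adjoint of $\mathcal{A}_m$ for the inner products above. Fix $m_0\in B$ and $v_0\in H^1_0(R)$ with $v_0\neq0$ ($v_0$ need not lie in $E_{m_0}$). Then there is a constant $C_{v_0}>0$ such that $$\|\mathcal{A}_m u-\mathcal{A}_{m_0}v_0\|_{L^2(V)}\ge C_{v_0}|m-m_0|\qquad\text{for all } m\in B,\ u\in E_m. \tag{1}$$ Moreover, for every constant $C_{v_0}>0$ for which (1) holds there is an integer $N$ such that for all $k>N$, all $m\in B$ and all $u\in E_m$, the sum $\sum_{j=1}^{M_k}C'(j,k)\,|(\mathcal{A}_m u-\mathcal{A}_{m_0}v_0)(P_{j,k})|^2$ is nonnegative and $$\Big(\sum_{j=1}^{M_k}C'(j,k)\,\big|(\mathcal{A}_m u-\mathcal{A}_{m_0}v_0)(P_{j,k})\big|^2\Big)^{1/2}\ \ge\ \frac{C_{v_0}}{2}\,|m-m_0| .$$ -/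

import Mathlib

open MeasureTheory Set Filter Topology
open scoped MeasureTheory

noncomputable section

/-- `ℝⁿ` with its Euclidean norm. -/
abbrev Euc (n : ℕ) : Type := EuclideanSpace ℝ (Fin n)

/-! ### Embedded manifolds, tangential gradients, surface measure -/

/-- `Φ` is a `C¹` diffeomorphism between open subsets of `ℝᵈ` which flattens `S`: in its domain,
`S` is the part where the first `r` coordinates of `Φ` are nonnegative and the others vanish. -/
structure IsFlatteningChart {d : ℕ} (r : ℕ) (S : Set (Euc d))
    (Φ : OpenPartialHomeomorph (Euc d) (Euc d)) : Prop where
  contDiffOn : ContDiffOn ℝ 1 Φ Φ.source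
  contDiffOn_symm : ContDiffOn ℝ 1 Φ.symm Φ.target
  mem_iff : ∀ y ∈ Φ.source, y ∈ S ↔
    ∀ i : Fin d, ((i : ℕ) < r → 0 ≤ Φ y i) ∧ (r ≤ (i : ℕ) → Φ y i = 0)

/-- `S` is a compact `r`-dimensional `C¹` manifold embedded in `ℝᵈ`, possibly with boundary and
corners. -/
structure IsCompactEmbeddedManifold {d : ℕ} (r : ℕ) (S : Set (Euc d)) : Prop where
  dim_le : r ≤ d
  isCompact : IsCompact S
  exists_chart : ∀ x ∈ S, ∃ Φ : OpenPartialHomeomorph (Euc d) (Euc d),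
    IsFlatteningChart r S Φ ∧ x ∈ Φ.source

/-- The manifold boundary of `S`: the points at which one of the first `r` coordinates of a
flattening chart vanishes. -/
def manifoldBoundary {d : ℕ} (r : ℕ) (S : Set (Euc d)) : Set (Euc d) :=
  {x | x ∈ S ∧ ∃ Φ : OpenPartialHomeomorph (Euc d) (Euc d),
    IsFlatteningChart r S Φ ∧ x ∈ Φ.source ∧ ∃ i : Fin d, (i : ℕ) < r ∧ Φ x i = 0}

/-- `g` is the tangential gradient at `x` of the function `f` on `S`: it lies in the tangent space
of `S` at `x`, and `f y = f x + ⟪g, y - x⟫ + o(|y - x|)` as `y → x` in `S`. Only the values of `f`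
on `S` matter. -/
def HasTangentialGradientAt {d : ℕ} (S : Set (Euc d)) (f : Euc d → ℝ) (g x : Euc d) : Prop :=
  HasGradientWithinAt f g S x ∧ g ∈ Submodule.span ℝ (tangentConeAt ℝ S x)

/-- `f` is of class `C¹` on `S`, with tangential gradient `g`. -/
def IsC1WithGradient {d : ℕ} (S : Set (Euc d)) (f : Euc d → ℝ) (g : Euc d → Euc d) : Prop :=
  (∀ x ∈ S, HasTangentialGradientAt S f (g x) x) ∧ ContinuousOn g S

/-- The surface measure of an `r`-dimensional set `S`: the `r`-dimensional Hausdorff measure on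
`S`, normalized so as to agree with Lebesgue measure on `ℝʳ`. -/
def surfaceMeasure {d : ℕ} (r : ℕ) (S : Set (Euc d)) : Measure (Euc d) :=
  (μHE[r] : Measure (Euc d)).restrict S

/-! ### The space `H¹₀` -/

/-- Pairs (function, gradient field) of square integrable objects on `S`, with the Hilbert norm
`(‖u‖² + ‖G‖²)^{1/2}`. -/
abbrev L2Pair {d : ℕ} (r : ℕ) (S : Set (Euc d)) : Type :=
  WithLp 2 (Lp ℝ 2 (surfaceMeasure r S) × Lp (Euc d) 2 (surfaceMeasure r S))

/-- `φ` is a `C¹` function on `S`, with tangential gradient `g`, whose support is a compact subset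
of `S` minus its boundary. -/
def IsTestFunction {d : ℕ} (r : ℕ) (S : Set (Euc d)) (φ : Euc d → ℝ) (g : Euc d → Euc d) : Prop :=
  IsC1WithGradient S φ g ∧
    ∃ K : Set (Euc d), IsCompact K ∧ K ⊆ S \ manifoldBoundary r S ∧ ∀ x ∈ S \ K, φ x = 0

theorem HasTangentialGradientAt.add {d : ℕ} {S : Set (Euc d)} {f f' : Euc d → ℝ} {g g' x : Euc d}
    (h : HasTangentialGradientAt S f g x) (h' : HasTangentialGradientAt S f' g' x) :
    HasTangentialGradientAt S (f + f') (g + g') x := by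
  refine ⟨?_, Submodule.add_mem _ h.2 h'.2⟩
  have h1 := h.1.hasFDerivWithinAt.add h'.1.hasFDerivWithinAt
  rw [hasGradientWithinAt_iff_hasFDerivWithinAt, map_add]
  exact h1

theorem HasTangentialGradientAt.const_smul {d : ℕ} {S : Set (Euc d)} {f : Euc d → ℝ}
    {g x : Euc d} (c : ℝ) (h : HasTangentialGradientAt S f g x) :
    HasTangentialGradientAt S (c • f) (c • g) x := by
  refine ⟨?_, Submodule.smul_mem _ _ h.2⟩
  have h1 := h.1.hasFDerivWithinAt.const_smul c
  rw [hasGradientWithinAt_iff_hasFDerivWithinAt]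
  simpa using h1

theorem IsTestFunction.zero {d : ℕ} (r : ℕ) (S : Set (Euc d)) : IsTestFunction r S 0 0 := by
  refine ⟨⟨fun x _ => ⟨?_, Submodule.zero_mem _⟩, continuousOn_const⟩, ∅, isCompact_empty,
    empty_subset _, fun _ _ => rfl⟩
  rw [hasGradientWithinAt_iff_hasFDerivWithinAt, Pi.zero_apply, map_zero]
  exact hasFDerivWithinAt_const (0 : ℝ) x S

theorem IsTestFunction.add {d r : ℕ} {S : Set (Euc d)} {φ φ' : Euc d → ℝ} {g g' : Euc d → Euc d}
    (h : IsTestFunction r S φ g) (h' : IsTestFunction r S φ' g') :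
    IsTestFunction r S (φ + φ') (g + g') := by
  obtain ⟨⟨h1, h2⟩, K, hK, hKS, hφ⟩ := h
  obtain ⟨⟨h1', h2'⟩, K', hK', hKS', hφ'⟩ := h'
  refine ⟨⟨fun x hx => (h1 x hx).add (h1' x hx), h2.add h2'⟩, K ∪ K', hK.union hK',
    union_subset hKS hKS', fun x hx => ?_⟩
  have hx1 : x ∈ S \ K := ⟨hx.1, fun hm => hx.2 (Or.inl hm)⟩
  have hx2 : x ∈ S \ K' := ⟨hx.1, fun hm => hx.2 (Or.inr hm)⟩
  simp [hφ x hx1, hφ' x hx2]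

theorem IsTestFunction.const_smul {d r : ℕ} {S : Set (Euc d)} {φ : Euc d → ℝ}
    {g : Euc d → Euc d} (c : ℝ) (h : IsTestFunction r S φ g) :
    IsTestFunction r S (c • φ) (c • g) := by
  obtain ⟨⟨h1, h2⟩, K, hK, hKS, hφ⟩ := h
  refine ⟨⟨fun x hx => (h1 x hx).const_smul c, h2.const_smul c⟩, K, hK, hKS, fun x hx => ?_⟩
  simp [hφ x hx]

/-- The pairs `(φ, ∇φ)`, `φ` a test function on `S`. -/
def testGraph {d : ℕ} (r : ℕ) (S : Set (Euc d)) : Submodule ℝ (L2Pair r S) where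
  carrier := {z | ∃ φ g, IsTestFunction r S φ g ∧
    z.fst =ᵐ[surfaceMeasure r S] φ ∧ z.snd =ᵐ[surfaceMeasure r S] g}
  zero_mem' := ⟨0, 0, IsTestFunction.zero r S, Lp.coeFn_zero _ _ _, Lp.coeFn_zero _ _ _⟩
  add_mem' := by
    rintro a b ⟨φ, g, h, h1, h2⟩ ⟨φ', g', h', h1', h2'⟩
    exact ⟨φ + φ', g + g', h.add h', (Lp.coeFn_add _ _).trans (h1.add h1'),
      (Lp.coeFn_add _ _).trans (h2.add h2')⟩
  smul_mem' := by
    rintro c a ⟨φ, g, h, h1, h2⟩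
    exact ⟨c • φ, c • g, h.const_smul c, (Lp.coeFn_smul _ _).trans (h1.const_smul c),
      (Lp.coeFn_smul _ _).trans (h2.const_smul c)⟩

/-- `H¹₀(S)`: the closure of the test functions in the `H¹` norm. An element is a pair `(u, ∇u)`
of a function and its (weak) tangential gradient. -/
def H10 {d : ℕ} (r : ℕ) (S : Set (Euc d)) : Submodule ℝ (L2Pair r S) :=
  (testGraph r S).topologicalClosure

/-- The underlying function of an element of `H¹₀(S)`. -/
def h10Fn {d r : ℕ} {S : Set (Euc d)} (u : H10 r S) : Euc d → ℝ := (u : L2Pair r S).fst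

/-- The inner product `∫ ∇u · ∇v` of `H¹₀(S)`. -/
def gradInner {d r : ℕ} {S : Set (Euc d)} (u v : H10 r S) : ℝ :=
  inner ℝ (u : L2Pair r S).snd (v : L2Pair r S).snd

/-! ### The integral operators -/

/-- `(A u)(x) = ∫_R h(x, y) u(y) dσ(y)`. -/
def intOp {d r : ℕ} {R : Set (Euc d)} (h : Euc d → Euc d → ℝ) (u : H10 r R) (x : Euc d) : ℝ :=
  ∫ y, h x y * h10Fn u y ∂(surfaceMeasure r R)

/-- The `L²` inner product. -/
def L2Inner {d : ℕ} (μ : Measure (Euc d)) (f g : Euc d → ℝ) : ℝ := ∫ x, f x * g x ∂μ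

/-- The `L²` norm. -/
def L2Norm {d : ℕ} (μ : Measure (Euc d)) (f : Euc d → ℝ) : ℝ := √(∫ x, f x ^ 2 ∂μ)

/-- `w = A* ψ`, where `A*` is the adjoint of the integral operator `A : H¹₀(R) → L²(V)` with
kernel `h`, for the inner product `∫ ∇u · ∇v` of `H¹₀(R)` and the usual one of `L²(V)`. -/
def IsAdjointImage {d r : ℕ} {R : Set (Euc d)} (s : ℕ) (V : Set (Euc d)) (h : Euc d → Euc d → ℝ)
    (ψ : Euc d → ℝ) (w : H10 r R) : Prop :=
  ∀ φ : H10 r R, gradInner w φ = L2Inner (surfaceMeasure s V) ψ (intOp h φ)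

/-- The span of the eigenvectors of `A* A` for the eigenvalues strictly greater than `β²`, where
`A : H¹₀(R) → L²(V)` is the integral operator with kernel `h`. -/
def eigenSpan {d : ℕ} (r s : ℕ) (R V : Set (Euc d)) (h : Euc d → Euc d → ℝ) (β : ℝ) :
    Submodule ℝ (H10 r R) :=
  Submodule.span ℝ {v | v ≠ 0 ∧ ∃ μ : ℝ, β ^ 2 < μ ∧
    IsAdjointImage s V h (intOp h v) (μ • v)}

/-! ### Assumptions on the kernel and on the quadrature -/

/-- `H` is continuous on `B × V × R`, and its gradient in `x` exists and is continuous there. -/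
def KernelC1 {d p : ℕ} (B : Set (Euc p)) (V R : Set (Euc d))
    (H : Euc p → Euc d → Euc d → ℝ) : Prop :=
  ContinuousOn (fun z : Euc p × Euc d × Euc d => H z.1 z.2.1 z.2.2) (B ×ˢ V ×ˢ R) ∧
  ∃ G : Euc p → Euc d → Euc d → Euc d,
    (∀ m ∈ B, ∀ x ∈ V, ∀ y ∈ R, HasTangentialGradientAt V (fun x' => H m x' y) (G m x y) x) ∧
    ContinuousOn (fun z : Euc p × Euc d × Euc d => G z.1 z.2.1 z.2.2) (B ×ˢ V ×ˢ R)

/-- `D` is the partial derivative in `m_i` of `F` on `B' × V × R`, and it is continuous there. -/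
def IsContPartial {d p : ℕ} {W : Type*} [NormedAddCommGroup W] [NormedSpace ℝ W]
    (B' : Set (Euc p)) (V R : Set (Euc d)) (i : Fin p) (F D : Euc p → Euc d → Euc d → W) : Prop :=
  (∀ m ∈ B', ∀ x ∈ V, ∀ y ∈ R,
    HasLineDerivAt ℝ (fun m' => F m' x y) (D m x y) m (EuclideanSpace.single i 1)) ∧
  ContinuousOn (fun z : Euc p × Euc d × Euc d => D z.1 z.2.1 z.2.2) (B' ×ˢ V ×ˢ R)

/-- On some open `B' ⊇ B`, the derivatives `∂_{m_i} H`, `∂_{m_i} ∇ₓ H` and `∂_{m_i} ∂_{m_j} H`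
exist and are continuous on `B' × V × R`. -/
def KernelParamRegular {d p : ℕ} (B : Set (Euc p)) (V R : Set (Euc d))
    (H : Euc p → Euc d → Euc d → ℝ) : Prop :=
  ∃ B' : Set (Euc p), IsOpen B' ∧ B ⊆ B' ∧
  ∃ (G : Euc p → Euc d → Euc d → Euc d)
    (D : Fin p → Euc p → Euc d → Euc d → ℝ)
    (DG : Fin p → Euc p → Euc d → Euc d → Euc d)
    (D2 : Fin p → Fin p → Euc p → Euc d → Euc d → ℝ),
    (∀ m ∈ B', ∀ x ∈ V, ∀ y ∈ R, HasTangentialGradientAt V (fun x' => H m x' y) (G m x y) x) ∧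
    (∀ i, IsContPartial B' V R i H (D i)) ∧
    (∀ i, IsContPartial B' V R i G (DG i)) ∧
    (∀ i j, IsContPartial B' V R i (D j) (D2 i j))

/-- `A_{m₁} u = A_{m₂} v` in `L²(V)` with `u ≠ 0` or `v ≠ 0` forces `m₁ = m₂` and `u = v`. -/
def UniqueIdentification {d p : ℕ} (r s : ℕ) (B : Set (Euc p)) (V R : Set (Euc d))
    (H : Euc p → Euc d → Euc d → ℝ) : Prop :=
  ∀ m₁ ∈ B, ∀ m₂ ∈ B, ∀ u v : H10 r R,
    intOp (H m₁) u =ᵐ[surfaceMeasure s V] intOp (H m₂) v → u ≠ 0 ∨ v ≠ 0 → m₁ = m₂ ∧ u = v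

/-- For every unit vector `q` and `m ∈ B`, `∂_q A_m u = A_m v` in `L²(V)` forces `u = v = 0`. -/
def InfinitesimalUniqueness {d p : ℕ} (r s : ℕ) (B : Set (Euc p)) (V R : Set (Euc d))
    (H : Euc p → Euc d → Euc d → ℝ) : Prop :=
  ∀ q : Euc p, ‖q‖ = 1 → ∀ m ∈ B, ∀ u v : H10 r R,
    (fun x => lineDeriv ℝ (fun m' => intOp (H m') u x) m q) =ᵐ[surfaceMeasure s V]
      intOp (H m) v → u = 0 ∧ v = 0

/-- The quadrature rules with `M n` points `P n j` and coefficients `c n j` approximate integrals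
over `V` to order one: the error on `φ ∈ C¹(V)` is `O(1 / M n) sup_V |∇φ|`, with a constant
that depends neither on `n` nor on `φ`. -/
def QuadratureOrderOne {d : ℕ} (s : ℕ) (V : Set (Euc d)) (M : ℕ → ℕ)
    (P : (n : ℕ) → Fin (M n) → Euc d) (c : (n : ℕ) → Fin (M n) → ℝ) : Prop :=
  ∃ K : ℝ, ∀ᶠ n in atTop, ∀ (φ : Euc d → ℝ) (g : Euc d → Euc d), IsC1WithGradient V φ g →
    |∑ j, c n j * φ (P n j) - ∫ x, φ x ∂(surfaceMeasure s V)| ≤ K / M n * ⨆ x : V, ‖g x‖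

end

/-! The core is a stronger estimate, c (‖u - v₀‖ + |m - m₀|) ≤ ‖A_m u - A_{m₀} v₀‖ for m in B and u
in E_m, proved by contradiction in `exists_pos_mul_le_norm_apply_sub`. Along a violating sequence
(m_n, u_n), the bound β‖u‖ ≤ ‖A_m u‖ on E_m keeps u_n bounded, so along an ultrafilter m_n converges
and u_n converges weakly. The operators are compact and norm continuous in m, hence the limit solves
the equation A_m u = A_{m₀} v₀, and (U1) identifies it with (m₀, v₀).

The delicate point is ‖u_n - v₀‖ = O(|m_n - m₀|), since v₀ need not lie in E_{m₀}. As a weak limit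
of vectors of E_{m_n}, however, v₀ has backward iterates under A_{m₀}* A_{m₀} of size O(β^(-2j))
(`exists_backward_iterates`). This forces its component on the eigenvalues of A_m* A_m at most β²/2
to be O(‖A_m - A_{m₀}‖) (`norm_lower_projection_le`), while on the complementary component A_m is
bounded below. Dividing by |m_n - m₀| then produces a unit direction q and a weak limit w with (∂_q
A_{m₀}) v₀ + A_{m₀} w = 0, against (U2).

The Hilbert space structure ∫ ∇u · ∇v on H¹₀(R) rests on a Poincaré inequality. It is proved near
the boundary by integrating from a face of a chart, carried from patch to patch by a path argument,
and made global by connectedness (`IsCompactEmbeddedManifold.poincareOn`). Uniform estimates on the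
kernel give compactness, continuity and differentiability of the operators.

For the quadrature, let w = A_m u - A_{m₀} v₀. Both sup |w| and sup |∇w| are O(‖u - v₀‖ + |m - m₀|),
hence O(‖w‖) in L² by the stronger estimate. So sup |∇(w²)| = O(‖w‖²), and for large k, uniformly in
m and u, the quadrature error is at most 3/4 of ‖w‖². -/

noncomputable section

open scoped NNReal ENNReal

/-! ### Spectral subspaces of symmetric operators and their perturbation. -/

section Spectral

variable {X Y : Type*} [NormedAddCommGroup X] [InnerProductSpace ℝ X]
  [NormedAddCommGroup Y] [InnerProductSpace ℝ Y]

/-- The span of the eigenvectors of `T` for the eigenvalues strictly greater than `c`. -/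
def upperEigenspan (T : X →L[ℝ] X) (c : ℝ) : Submodule ℝ X :=
  Submodule.span ℝ {x | ∃ μ : ℝ, c < μ ∧ T x = μ • x}

theorem upperEigenspan_anti (T : X →L[ℝ] X) {c c' : ℝ} (h : c ≤ c') :
    upperEigenspan T c' ≤ upperEigenspan T c :=
  Submodule.span_mono fun _ ⟨μ, hμ, hx⟩ => ⟨μ, h.trans_lt hμ, hx⟩

/-- On the span of the eigenvectors for eigenvalues above `c`, the quadratic form of a symmetric
operator is bounded below by `c`. -/
theorem mul_norm_sq_le_inner_of_mem_upperEigenspan {T : X →L[ℝ] X}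
    (hT : (T : X →ₗ[ℝ] X).IsSymmetric) {c : ℝ} {x : X} (hx : x ∈ upperEigenspan T c) :
    c * ‖x‖ ^ 2 ≤ inner ℝ (T x) x := by
  classical
  -- An element of the span is a finite sum of vectors from distinct, hence orthogonal, eigenspaces.
  -- Both sides become diagonal sums, compared term by term.
  have hle : upperEigenspan T c ≤
      ⨆ μ : {μ : ℝ // c < μ}, Module.End.eigenspace (T : X →ₗ[ℝ] X) (μ : ℝ) := by
    refine Submodule.span_le.2 ?_
    rintro y ⟨μ, hμ, hy⟩
    exact Submodule.mem_iSup_of_mem (⟨μ, hμ⟩ : {μ : ℝ // c < μ})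
      (Module.End.mem_eigenspace_iff.2 hy)
  obtain ⟨f, hf, rfl⟩ := (Submodule.mem_iSup_iff_exists_finsupp _ _).1 (hle hx)
  have horth : ∀ i j : {μ : ℝ // c < μ}, i ≠ j → inner ℝ (f i) (f j) = 0 := by
    intro i j hij
    exact (hT.orthogonalFamily_eigenspaces.comp Subtype.val_injective) hij ⟨f i, hf i⟩ ⟨f j, hf j⟩
  have hTf : ∀ i, T (f i) = (i : ℝ) • f i := fun i => Module.End.mem_eigenspace_iff.1 (hf i)
  rw [← real_inner_self_eq_norm_sq, Finsupp.sum, map_sum]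
  simp_rw [sum_inner, inner_sum, hTf, inner_smul_left]
  rw [Finset.mul_sum]
  refine Finset.sum_le_sum fun i hi => ?_
  rw [Finset.sum_eq_single i (fun j _ hj => horth i j (Ne.symm hj)) (fun h => absurd hi h),
    Finset.sum_eq_single i (fun j _ hj => by rw [horth i j (Ne.symm hj), mul_zero])
      (fun h => absurd hi h)]
  exact mul_le_mul_of_nonneg_right i.2.le real_inner_self_nonneg

/-- A symmetric operator is invertible, with inverse bounded by `c⁻¹`, on the span of its
eigenvectors for eigenvalues above `c > 0`. -/
theorem exists_apply_eq_of_mem_upperEigenspan {T : X →L[ℝ] X}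
    (hT : (T : X →ₗ[ℝ] X).IsSymmetric) {c : ℝ} (hc : 0 < c) {x : X}
    (hx : x ∈ upperEigenspan T c) :
    ∃ y ∈ upperEigenspan T c, T y = x ∧ ‖y‖ ≤ c⁻¹ * ‖x‖ := by
  obtain ⟨y, hy, hyx⟩ : ∃ y ∈ upperEigenspan T c, T y = x := by
    refine Submodule.span_induction ?_ ⟨0, zero_mem _, map_zero _⟩ ?_ ?_ hx
    · rintro z ⟨μ, hμ, hz⟩
      refine ⟨μ⁻¹ • z, Submodule.smul_mem _ _ (Submodule.subset_span ⟨μ, hμ, hz⟩), ?_⟩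
      rw [map_smul, hz, smul_smul, inv_mul_cancel₀ (hc.trans hμ).ne', one_smul]
    · rintro z z' - - ⟨y, hy, rfl⟩ ⟨y', hy', rfl⟩
      exact ⟨y + y', add_mem hy hy', map_add _ _ _⟩
    · rintro a z - ⟨y, hy, rfl⟩
      exact ⟨a • y, Submodule.smul_mem _ _ hy, map_smul _ _ _⟩
  refine ⟨y, hy, hyx, ?_⟩
  have h1 := mul_norm_sq_le_inner_of_mem_upperEigenspan hT hy
  have h2 := real_inner_le_norm (T y) y
  rw [hyx] at h1 h2
  rcases (norm_nonneg y).eq_or_lt with h0 | h0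
  · rw [← h0]; positivity
  · rw [le_inv_mul_iff₀ hc]
    refine le_of_mul_le_mul_right ?_ h0
    calc c * ‖y‖ * ‖y‖ = c * ‖y‖ ^ 2 := by ring
      _ ≤ _ := h1.trans h2

variable [CompleteSpace X]

/-- A compact positive symmetric operator all of whose eigenvalues are at most `γ` has norm at
most `γ`. -/
theorem norm_le_of_forall_eigenvalue_le {T : X →L[ℝ] X} (hc : IsCompactOperator T)
    (hT : (T : X →ₗ[ℝ] X).IsSymmetric) {γ : ℝ} (hγ : 0 ≤ γ)
    (h : ∀ μ, Module.End.HasEigenvalue (T : Module.End ℝ X) μ → |μ| ≤ γ) : ‖T‖ ≤ γ := by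
  -- The norm of a self-adjoint operator is its spectral radius, and the nonzero spectrum of a
  -- compact operator consists of eigenvalues.
  have h1 : spectralRadius ℝ T ≤ ENNReal.ofReal γ := by
    refine iSup₂_le fun k hk => ?_
    rcases eq_or_ne k 0 with rfl | hk0
    · simp
    · rw [← hc.hasEigenvalue_iff_mem_spectrum hk0] at hk
      rw [← enorm_eq_nnnorm, ← ofReal_norm]
      exact ENNReal.ofReal_le_ofReal (h k hk)
  rw [T.spectralRadius_eq_nnnorm hT.isSelfAdjoint, ← enorm_eq_nnnorm, ← ofReal_norm] at h1
  exact (ENNReal.ofReal_le_ofReal_iff hγ).1 h1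

/-- The spectral projection of the compact operator `A* A` for the eigenvalues at most `γ`. -/
theorem exists_lower_spectral_projection [CompleteSpace Y] {A : X →L[ℝ] Y}
    (hA : IsCompactOperator A) {γ : ℝ} (hγ : 0 < γ) :
    ∃ Q : X →L[ℝ] X, (∀ x, ‖Q x‖ ≤ ‖x‖) ∧
      (∀ x, ‖Q ((A.adjoint ∘L A) x)‖ ≤ γ * ‖Q x‖) ∧
      (∀ x ∈ upperEigenspan (A.adjoint ∘L A) γ, Q x = 0) ∧
      ∀ x, γ * ‖x - Q x‖ ^ 2 ≤ ‖A x‖ ^ 2 := by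
  set T : X →L[ℝ] X := A.adjoint ∘L A with hTdef
  have hTA : ∀ x y, inner ℝ (T x) y = inner ℝ (A x) (A y) := fun x y => by
    rw [hTdef, ContinuousLinearMap.comp_apply, ContinuousLinearMap.adjoint_inner_left]
  have hT : (T : X →ₗ[ℝ] X).IsSymmetric := fun x y => by
    change inner ℝ (T x) y = inner ℝ x (T y)
    rw [hTA, real_inner_comm (T y) x, hTA, real_inner_comm]
  have hTc : IsCompactOperator T := IsCompactOperator.clm_comp hA A.adjoint
  set F := upperEigenspan T γ with hF
  have hFinv : ∀ x ∈ F, T x ∈ F := by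
    intro x hx
    refine Submodule.span_induction ?_ (by rw [map_zero]; exact zero_mem _) ?_ ?_ hx
    · rintro z ⟨μ, hμ, hz⟩
      rw [hz]
      exact Submodule.smul_mem _ _ (Submodule.subset_span ⟨μ, hμ, hz⟩)
    · intro z z' _ _ h h'
      rw [map_add]; exact add_mem h h'
    · intro a z _ h
      rw [map_smul]; exact Submodule.smul_mem _ _ h
  have hKinv : ∀ x ∈ Fᗮ, T x ∈ Fᗮ := by
    intro x hx
    rw [Submodule.mem_orthogonal] at hx ⊢
    intro u hu
    rw [← hx (T u) (hFinv u hu)]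
    exact (hT u x).symm
  have hKKinv : ∀ x ∈ Fᗮᗮ, T x ∈ Fᗮᗮ := by
    intro x hx
    rw [Submodule.mem_orthogonal] at hx ⊢
    intro u hu
    rw [← hx (T u) (hKinv u hu)]
    exact (hT u x).symm
  -- Projecting on `Fᗮ`, which is always closed, makes it unnecessary to know that `F` is closed;
  -- the complementary component lies in `Fᗮᗮ`, the closure of `F`.
  set Q : X →L[ℝ] X := Fᗮ.starProjection with hQ
  have hQmem : ∀ x, Q x ∈ Fᗮ := fun x => Submodule.starProjection_apply_mem _ x
  have hQsub : ∀ x, x - Q x ∈ Fᗮᗮ := fun x => Submodule.sub_starProjection_mem_orthogonal x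
  have hQid : ∀ x ∈ Fᗮ, Q x = x := fun x hx => Submodule.starProjection_eq_self_iff.2 hx
  have hQzero : ∀ x ∈ Fᗮᗮ, Q x = 0 := fun x hx =>
    (Submodule.starProjection_apply_eq_zero_iff _).2 hx
  have hcomm : ∀ x, Q (T x) = T (Q x) := by
    intro x
    have h1 : T x = T (Q x) + T (x - Q x) := by rw [← map_add, add_sub_cancel]
    rw [h1, map_add, hQid _ (hKinv _ (hQmem x)), hQzero _ (hKKinv _ (hQsub x)), add_zero]
  -- An eigenvector of the restriction to `Fᗮ` for an eigenvalue above `γ` would lie in both `F` and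
  -- `Fᗮ`.
  have hnorm : ∀ x ∈ Fᗮ, ‖T x‖ ≤ γ * ‖x‖ := by
    intro x hx
    let S : Fᗮ →L[ℝ] Fᗮ := T.restrict hKinv
    have hSc : IsCompactOperator S := hTc.restrict' hKinv
    have hSs : (S : Fᗮ →ₗ[ℝ] Fᗮ).IsSymmetric := hT.restrict_invariant hKinv
    have hS : ‖S‖ ≤ γ := by
      refine norm_le_of_forall_eigenvalue_le hSc hSs hγ.le fun μ hμ => ?_
      obtain ⟨v, hv⟩ := hμ.exists_hasEigenvector
      have hv1 : T v = μ • (v : X) := congrArg Subtype.val hv.apply_eq_smul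
      have hv2 : (v : X) ≠ 0 := fun h => hv.2 (Subtype.ext h)
      have hpos : 0 < ‖(v : X)‖ ^ 2 := by positivity
      have h0 : 0 ≤ μ := by
        have h3 : inner ℝ (T v) (v : X) = μ * ‖(v : X)‖ ^ 2 := by
          rw [hv1, inner_smul_left, real_inner_self_eq_norm_sq]; rfl
        rw [hTA, real_inner_self_eq_norm_sq] at h3
        by_contra hneg
        nlinarith [sq_nonneg ‖A v‖]
      rw [abs_of_nonneg h0]
      by_contra hlt
      have hvF : (v : X) ∈ F := Submodule.subset_span ⟨μ, not_le.1 hlt, hv1⟩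
      exact hv2 (inner_self_eq_zero.1 ((Submodule.mem_orthogonal _ _).1 v.2 v hvF))
    exact (S.le_opNorm ⟨x, hx⟩).trans (mul_le_mul_of_nonneg_right hS (norm_nonneg _))
  refine ⟨Q, fun x => Submodule.norm_starProjection_apply_le _ x, fun x => ?_, fun x hx => ?_,
    fun x => ?_⟩
  · rw [hcomm]; exact hnorm _ (hQmem x)
  · exact hQzero x (Submodule.le_orthogonal_orthogonal _ hx)
  · have h1 : γ * ‖x - Q x‖ ^ 2 ≤ inner ℝ (T (x - Q x)) (x - Q x) := by
      have hcl : IsClosed {y : X | γ * ‖y‖ ^ 2 ≤ inner ℝ (T y) y} :=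
        isClosed_le (by fun_prop) (by fun_prop)
      have hsub : (F : Set X) ⊆ {y : X | γ * ‖y‖ ^ 2 ≤ inner ℝ (T y) y} :=
        fun y hy => mul_norm_sq_le_inner_of_mem_upperEigenspan hT hy
      have := hQsub x
      rw [Submodule.orthogonal_orthogonal_eq_closure] at this
      exact closure_minimal hsub hcl this
    have h2 : inner ℝ (A (x - Q x)) (A (Q x)) = 0 := by
      rw [← hTA]
      exact Submodule.inner_left_of_mem_orthogonal (hQmem x) (hKKinv _ (hQsub x))
    -- Pythagoras: `T` preserves `Fᗮᗮ`, so the images under `A` of the two components are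
    -- orthogonal.
    have h3 : ‖A x‖ ^ 2 = ‖A (x - Q x)‖ ^ 2 + ‖A (Q x)‖ ^ 2 := by
      have : A x = A (x - Q x) + A (Q x) := by rw [← map_add, sub_add_cancel]
      rw [this, norm_add_sq_real, h2]; ring
    rw [hTA, real_inner_self_eq_norm_sq] at h1
    nlinarith [sq_nonneg ‖A (Q x)‖]

omit [CompleteSpace X] in
/-- If `a 0` has backward iterates `a j` under `T₀` of size `O((2γ)⁻ʲ)`, then the spectral part of
`a 0` for the eigenvalues of a nearby operator `T` at most `γ` is small. -/
theorem norm_lower_projection_le {T T₀ Q : X →L[ℝ] X} {γ K : ℝ} (hγ : 0 < γ)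
    (hQ : ∀ x, ‖Q x‖ ≤ ‖x‖) (hQT : ∀ x, ‖Q (T x)‖ ≤ γ * ‖Q x‖) {a : ℕ → X}
    (ha : ∀ j, T₀ (a (j + 1)) = a j) (hK : ∀ j, ‖a j‖ * (2 * γ) ^ j ≤ K) :
    ‖Q (a 0)‖ ≤ ‖T - T₀‖ * K / γ := by
  -- Induction on `k` for all `j` at once. Passing from `a j` to `a (j + 1)` gains a factor `γ`
  -- against the weight ratio `2 * γ`, hence one half, and `‖T - T₀‖ * K / γ` is the fixed point of
  -- the resulting recursion. Letting `k` tend to infinity leaves only the perturbation term.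
  have key : ∀ k j, ‖Q (a j)‖ * (2 * γ) ^ j ≤ (1 / 2) ^ k * K + ‖T - T₀‖ * K / γ := by
    have hK0 : 0 ≤ K := le_trans (by positivity) (hK 0)
    have hpos : 0 ≤ ‖T - T₀‖ * K / γ := by positivity
    intro k
    induction k with
    | zero =>
      intro j
      have : ‖Q (a j)‖ * (2 * γ) ^ j ≤ ‖a j‖ * (2 * γ) ^ j := by gcongr; exact hQ _
      linarith [hK j, this]
    | succ k ih =>
      intro j
      have h1 : a j = T (a (j + 1)) - (T - T₀) (a (j + 1)) := by
        rw [_root_.sub_apply, sub_sub_cancel, ha]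
      have h2 : ‖Q (a j)‖ ≤ γ * ‖Q (a (j + 1))‖ + ‖T - T₀‖ * ‖a (j + 1)‖ := by
        rw [h1, map_sub]
        refine (norm_sub_le _ _).trans (add_le_add (by simpa [← h1] using hQT (a (j + 1))) ?_)
        exact (hQ _).trans ((T - T₀).le_opNorm _)
      have h3 : ‖Q (a j)‖ * (2 * γ) ^ j ≤
          (γ * ‖Q (a (j + 1))‖ + ‖T - T₀‖ * ‖a (j + 1)‖) * (2 * γ) ^ j := by gcongr
      have h4 : (γ * ‖Q (a (j + 1))‖ + ‖T - T₀‖ * ‖a (j + 1)‖) * (2 * γ) ^ j =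
          (1 / 2) * (‖Q (a (j + 1))‖ * (2 * γ) ^ (j + 1)) +
            ‖T - T₀‖ * (‖a (j + 1)‖ * (2 * γ) ^ (j + 1)) / (2 * γ) := by
        field_simp
        ring
      have h5 : ‖T - T₀‖ * (‖a (j + 1)‖ * (2 * γ) ^ (j + 1)) / (2 * γ) ≤
          ‖T - T₀‖ * K / (2 * γ) := by gcongr; exact hK _
      have h6 : ‖T - T₀‖ * K / (2 * γ) = (1 / 2) * (‖T - T₀‖ * K / γ) := by field_simp
      have h7 := ih (j + 1)
      rw [pow_succ]
      linarith
  have hlim : Tendsto (fun k : ℕ => (1 / 2 : ℝ) ^ k * K + ‖T - T₀‖ * K / γ) atTop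
      (𝓝 (0 * K + ‖T - T₀‖ * K / γ)) :=
    ((tendsto_pow_atTop_nhds_zero_of_lt_one (by norm_num) (by norm_num)).mul_const _).add_const _
  rw [zero_mul, zero_add] at hlim
  exact ge_of_tendsto' hlim fun k => by simpa using key k 0

end Spectral

/-! ### Weak limits along ultrafilters. -/

section Weak

variable {X Y ι : Type*} [NormedAddCommGroup X] [InnerProductSpace ℝ X] [CompleteSpace X]
  [NormedAddCommGroup Y] [InnerProductSpace ℝ Y] [CompleteSpace Y]

/-- Bounded families in a Hilbert space converge weakly along ultrafilters. -/
theorem exists_weak_limit (l : Ultrafilter ι) {x : ι → X} {K : ℝ} (hx : ∀ᶠ i in l, ‖x i‖ ≤ K) :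
    ∃ y : X, ‖y‖ ≤ K ∧ ∀ z, Tendsto (fun i => inner ℝ z (x i)) l (𝓝 (inner ℝ z y)) := by
  have hK : 0 ≤ K := hx.exists.elim fun _ h => (norm_nonneg _).trans h
  -- Each scalar family lies in a compact interval, so the ultrafilter gives a limit without
  -- separability or subsequences. The limits form a bounded functional of `z`, represented by a
  -- vector.
  have h1 : ∀ z, ∃ c : ℝ, |c| ≤ ‖z‖ * K ∧ Tendsto (fun i => inner ℝ z (x i)) l (𝓝 c) := by
    intro z
    obtain ⟨c, hc, hlim⟩ := (isCompact_Icc (a := -(‖z‖ * K)) (b := ‖z‖ * K)).ultrafilter_le_nhds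
      (l.map fun i => inner ℝ z (x i)) (by
        rw [le_principal_iff, Ultrafilter.mem_coe, Ultrafilter.mem_map]
        filter_upwards [hx] with i hi
        exact abs_le.1 ((abs_real_inner_le_norm z (x i)).trans (by gcongr)))
    exact ⟨c, abs_le.2 hc, hlim⟩
  choose f hfb hf using h1
  let g : X →ₗ[ℝ] ℝ :=
    { toFun := f
      map_add' := fun z z' => tendsto_nhds_unique (hf (z + z'))
        (by simpa only [inner_add_left] using (hf z).add (hf z'))
      map_smul' := fun a z => tendsto_nhds_unique (hf (a • z))
        (by simp only [real_inner_smul_left]; exact (hf z).const_mul a) }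
  let G : X →L[ℝ] ℝ := g.mkContinuous K fun z => by rw [mul_comm]; exact hfb z
  refine ⟨(InnerProductSpace.toDual ℝ X).symm G, ?_, fun z => ?_⟩
  · rw [LinearIsometryEquiv.norm_map]
    exact g.mkContinuous_norm_le hK _
  · rw [real_inner_comm, InnerProductSpace.toDual_symm_apply]
    exact hf z

/-- Compact operators map weak convergence along an ultrafilter to norm convergence, also when the
operator varies norm continuously. -/
theorem tendsto_of_weak_limit (l : Ultrafilter ι) {A : ι → X →L[ℝ] Y} {A₀ : X →L[ℝ] Y}
    (hA₀ : IsCompactOperator A₀) (hA : Tendsto A l (𝓝 A₀)) {x : ι → X} {K : ℝ}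
    (hx : ∀ᶠ i in l, ‖x i‖ ≤ K) {y : X}
    (hy : ∀ z, Tendsto (fun i => inner ℝ z (x i)) l (𝓝 (inner ℝ z y))) :
    Tendsto (fun i => A i (x i)) l (𝓝 (A₀ y)) := by
  have h1 : Tendsto (fun i => A₀ (x i)) l (𝓝 (A₀ y)) := by
    -- Compactness provides some norm limit, which the weak limit then identifies through the
    -- adjoint.
    obtain ⟨C, hC, hsub⟩ := hA₀.image_closedBall_subset_compact (f := (A₀ : X →ₗ[ℝ] Y)) K
    obtain ⟨w, -, hw⟩ := hC.ultrafilter_le_nhds (l.map fun i => A₀ (x i)) (by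
        rw [le_principal_iff, Ultrafilter.mem_coe, Ultrafilter.mem_map]
        filter_upwards [hx] with i hi
        exact hsub (mem_image_of_mem _ (by simpa using hi)))
    have hw' : Tendsto (fun i => A₀ (x i)) l (𝓝 w) := hw
    have : w = A₀ y := by
      refine ext_inner_left ℝ fun z => ?_
      refine tendsto_nhds_unique ((tendsto_const_nhds (x := z)).inner hw') ?_
      have := hy (A₀.adjoint z)
      simpa only [ContinuousLinearMap.adjoint_inner_left] using this
    rwa [← this]
  have h2 : Tendsto (fun i => (A i - A₀) (x i)) l (𝓝 0) := by
    have h3 : Tendsto (fun i => ‖A i - A₀‖ * K) l (𝓝 0) := by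
      have := (tendsto_iff_norm_sub_tendsto_zero.1 hA).mul_const K
      rwa [zero_mul] at this
    refine squeeze_zero_norm' (hx.mono fun i hi => ?_) h3
    exact ((A i - A₀).le_opNorm _).trans (by gcongr)
  have := h2.add h1
  simpa using this

end Weak

/-! ### The stability estimate in Hilbert space. -/

section Abstract

variable {X Y : Type*} [NormedAddCommGroup X] [InnerProductSpace ℝ X] [CompleteSpace X]
  [NormedAddCommGroup Y] [InnerProductSpace ℝ Y] [CompleteSpace Y]

omit [CompleteSpace X] [CompleteSpace Y] in
theorem tendsto_clm_comp {ι : Type*} {l : Filter ι} {F : ι → Y →L[ℝ] X} {F₀ : Y →L[ℝ] X}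
    {G : ι → X →L[ℝ] Y} {G₀ : X →L[ℝ] Y} (hF : Tendsto F l (𝓝 F₀)) (hG : Tendsto G l (𝓝 G₀)) :
    Tendsto (fun i => F i ∘L G i) l (𝓝 (F₀ ∘L G₀)) := by
  have hc : Continuous fun z : (Y →L[ℝ] X) × (X →L[ℝ] Y) => z.1 ∘L z.2 :=
    continuous_fst.clm_comp continuous_snd
  have h := hF.prodMk_nhds hG
  exact (hc.tendsto (F₀, G₀)).comp h

theorem inner_adjoint_comp_self (A : X →L[ℝ] Y) (x y : X) :
    inner ℝ ((A.adjoint ∘L A) x) y = inner ℝ (A x) (A y) := by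
  rw [ContinuousLinearMap.comp_apply, ContinuousLinearMap.adjoint_inner_left]

theorem isSymmetric_adjoint_comp_self (A : X →L[ℝ] Y) :
    ((A.adjoint ∘L A : X →L[ℝ] X) : X →ₗ[ℝ] X).IsSymmetric := fun x y => by
  change inner ℝ ((A.adjoint ∘L A) x) y = inner ℝ x ((A.adjoint ∘L A) y)
  rw [inner_adjoint_comp_self, real_inner_comm _ x, inner_adjoint_comp_self, real_inner_comm]

/-- The a priori bound on `u` that starts the compactness argument. -/
theorem mul_norm_le_of_mem_upperEigenspan (A : X →L[ℝ] Y) {β : ℝ} (hβ : 0 ≤ β) {u : X}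
    (hu : u ∈ upperEigenspan (A.adjoint ∘L A) (β ^ 2)) : β * ‖u‖ ≤ ‖A u‖ := by
  have h := mul_norm_sq_le_inner_of_mem_upperEigenspan (isSymmetric_adjoint_comp_self A) hu
  rw [inner_adjoint_comp_self, real_inner_self_eq_norm_sq, ← mul_pow] at h
  exact (pow_le_pow_iff_left₀ (by positivity) (norm_nonneg _) two_ne_zero).1 h

/-- Product rule for differences. What matters is that the bound is linear in `‖A - A₀‖`, hence of
first order in the parameter. -/
theorem norm_adjoint_comp_self_sub_le (A A₀ : X →L[ℝ] Y) :
    ‖(A.adjoint ∘L A : X →L[ℝ] X) - A₀.adjoint ∘L A₀‖ ≤ (‖A‖ + ‖A₀‖) * ‖A - A₀‖ := by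
  have h : (A.adjoint ∘L A : X →L[ℝ] X) - A₀.adjoint ∘L A₀ =
      A.adjoint ∘L (A - A₀) + (A - A₀).adjoint ∘L A₀ := by
    rw [map_sub, ContinuousLinearMap.comp_sub, ContinuousLinearMap.sub_comp]; abel
  rw [h, add_mul]
  refine (norm_add_le _ _).trans (add_le_add ?_ ?_)
  · refine (ContinuousLinearMap.opNorm_comp_le _ _).trans_eq ?_
    rw [LinearIsometryEquiv.norm_map]
  · refine (ContinuousLinearMap.opNorm_comp_le _ _).trans_eq ?_
    rw [LinearIsometryEquiv.norm_map, mul_comm]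

/-- Stability of the inversion of `A` on the span of the singular vectors for singular values above
`√(2γ)`, when the comparison vector is in a similar space of a nearby operator `A₀`. -/
theorem norm_sub_le_of_backward_iterates {A A₀ : X →L[ℝ] Y} (hA : IsCompactOperator A) {γ K : ℝ}
    (hγ : 0 < γ) {u : X} (hu : u ∈ upperEigenspan (A.adjoint ∘L A) γ) {a : ℕ → X}
    (ha : ∀ j, (A₀.adjoint ∘L A₀) (a (j + 1)) = a j) (hK : ∀ j, ‖a j‖ * (2 * γ) ^ j ≤ K) :
    ‖u - a 0‖ ≤ (√γ)⁻¹ * ‖A (u - a 0)‖ + (‖A‖ + ‖A₀‖) * ‖A - A₀‖ * K / γ := by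
  -- `Q` kills `u`, so the lower component of `u - a 0` is that of `-a 0`, controlled by the
  -- backward iterates; the upper component is controlled by `A`.
  obtain ⟨Q, hQ, hQT, hQu, hQA⟩ := exists_lower_spectral_projection hA hγ
  have hK0 : 0 ≤ K := le_trans (by positivity) (hK 0)
  have h1 : ‖Q (a 0)‖ ≤ (‖A‖ + ‖A₀‖) * ‖A - A₀‖ * K / γ := by
    refine (norm_lower_projection_le hγ hQ hQT ha hK).trans ?_
    gcongr
    exact norm_adjoint_comp_self_sub_le A A₀
  have h2 : Q (u - a 0) = -Q (a 0) := by rw [map_sub, hQu u hu, zero_sub]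
  have h3 : ‖(u - a 0) - Q (u - a 0)‖ ≤ (√γ)⁻¹ * ‖A (u - a 0)‖ := by
    rw [le_inv_mul_iff₀ (Real.sqrt_pos.2 hγ)]
    have := hQA (u - a 0)
    rw [← Real.sq_sqrt hγ.le, ← mul_pow] at this
    exact (pow_le_pow_iff_left₀ (by positivity) (norm_nonneg _) two_ne_zero).1 this
  calc ‖u - a 0‖ = ‖((u - a 0) - Q (u - a 0)) + Q (u - a 0)‖ := by rw [sub_add_cancel]
    _ ≤ ‖(u - a 0) - Q (u - a 0)‖ + ‖Q (u - a 0)‖ := norm_add_le _ _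
    _ ≤ _ := by rw [h2, norm_neg]; exact add_le_add (by rw [← h2]; exact h3) h1

/-- Weak limits of elements of the upper eigenspans of `A i`, where `A i` converges to the compact
operator `A₀`, have backward iterates under `A₀* A₀` of controlled size. -/
theorem exists_backward_iterates {ι : Type*} (l : Ultrafilter ι) {A : ι → X →L[ℝ] Y}
    {A₀ : X →L[ℝ] Y} (hA₀ : IsCompactOperator A₀) (hA : Tendsto A l (𝓝 A₀)) {c : ℝ} (hc : 0 < c)
    {u : ι → X} (hu : ∀ i, u i ∈ upperEigenspan ((A i).adjoint ∘L A i) c) {K : ℝ}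
    (hK : ∀ i, ‖u i‖ ≤ K) {v : X}
    (hv : ∀ z, Tendsto (fun i => inner ℝ z (u i)) l (𝓝 (inner ℝ z v))) :
    ∃ a : ℕ → X, a 0 = v ∧ (∀ j, (A₀.adjoint ∘L A₀) (a (j + 1)) = a j) ∧
      ∀ j, ‖a j‖ * c ^ j ≤ K := by
  have h1 : ∀ i, ∀ x : upperEigenspan ((A i).adjoint ∘L A i) c,
      ∃ y : upperEigenspan ((A i).adjoint ∘L A i) c,
        ((A i).adjoint ∘L A i) y = x ∧ ‖(y : X)‖ ≤ c⁻¹ * ‖(x : X)‖ := by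
    intro i x
    obtain ⟨y, hy, h⟩ :=
      exists_apply_eq_of_mem_upperEigenspan (isSymmetric_adjoint_comp_self (A i)) hc x.2
    exact ⟨⟨y, hy⟩, h⟩
  -- `g i` inverts `A i* A i` on its upper eigenspan, and `b j i` is the `j`-th backward iterate of
  -- `u i`, of size at most `c⁻ʲ K`.
  choose g hg hgn using h1
  let b : ℕ → ι → X := fun j i => ((g i)^[j] ⟨u i, hu i⟩ : upperEigenspan _ c)
  have hb : ∀ j i, ((A i).adjoint ∘L A i) (b (j + 1) i) = b j i := by
    intro j i
    simp only [b, Function.iterate_succ_apply']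
    exact hg i _
  have hbn : ∀ j i, ‖b j i‖ ≤ (c ^ j)⁻¹ * K := by
    intro j i
    induction j with
    | zero => simpa [b] using hK i
    | succ j ih =>
      have : ‖b (j + 1) i‖ ≤ c⁻¹ * ‖b j i‖ := by
        simp only [b, Function.iterate_succ_apply']
        exact hgn i _
      refine this.trans ?_
      rw [pow_succ, mul_inv, mul_comm (c ^ j)⁻¹, mul_assoc]
      gcongr
  -- The weak limits in `i` are taken for each `j` separately. The relation between consecutive
  -- iterates survives because `A i* A i` converges in norm to a compact operator.
  choose a ha hlim using fun j => exists_weak_limit l (Eventually.of_forall (hbn j))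
  have hT : Tendsto (fun i => ((A i).adjoint ∘L A i : X →L[ℝ] X)) l (𝓝 (A₀.adjoint ∘L A₀)) := by
    have hadj : Tendsto (fun i => (A i).adjoint) l (𝓝 A₀.adjoint) :=
      by
      have hc := (ContinuousLinearMap.adjoint (𝕜 := ℝ) (E := X) (F := Y)).continuous
      exact (hc.tendsto A₀).comp hA
    exact tendsto_clm_comp hadj hA
  refine ⟨a, ?_, fun j => ?_, fun j => ?_⟩
  · exact ext_inner_left ℝ fun z => tendsto_nhds_unique (hlim 0 z) (hv z)
  · refine ext_inner_left ℝ fun z => ?_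
    have h2 := tendsto_of_weak_limit l (IsCompactOperator.clm_comp hA₀ A₀.adjoint) hT
      (Eventually.of_forall (hbn (j + 1))) (hlim (j + 1))
    refine tendsto_nhds_unique ((tendsto_const_nhds (x := z)).inner h2) ?_
    simp_rw [hb]
    exact hlim j z
  · have := ha j
    rwa [inv_mul_eq_div, le_div_iff₀ (by positivity)] at this

/-- The stability estimate for the determination of the parameter `m` and of the unknown `u` in the
span of the singular vectors of `A m` for singular values above `β`. -/
theorem exists_pos_mul_le_norm_apply_sub {E : Type*} [NormedAddCommGroup E] [NormedSpace ℝ E]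
    [FiniteDimensional ℝ E] {B : Set E} (hB : IsCompact B) {A : E → X →L[ℝ] Y}
    (hcont : ContinuousOn A B) (hcomp : ∀ m ∈ B, IsCompactOperator (A m)) {m₀ : E} (hm₀ : m₀ ∈ B)
    {DA : E →L[ℝ] X →L[ℝ] Y} (hDA : HasFDerivWithinAt A DA B m₀) {v₀ : X}
    (hU1 : ∀ m ∈ B, ∀ u, A m u = A m₀ v₀ → m = m₀ ∧ u = v₀)
    (hU2 : ∀ q, ‖q‖ = 1 → ∀ w, DA q v₀ ≠ A m₀ w) {β : ℝ} (hβ : 0 < β) :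
    ∃ c > 0, ∀ m ∈ B, ∀ u ∈ upperEigenspan ((A m).adjoint ∘L A m) (β ^ 2),
      c * (‖u - v₀‖ + ‖m - m₀‖) ≤ ‖A m u - A m₀ v₀‖ := by
  by_contra! hcon
  obtain ⟨D, hD⟩ : ∃ D, ∀ m ∈ B, ‖m - m₀‖ ≤ D := by
    obtain ⟨D, hD⟩ := hB.isBounded.subset_closedBall m₀
    exact ⟨D, fun m hm => by simpa [dist_eq_norm] using hD hm⟩
  have hD0 : 0 ≤ D := (norm_nonneg _).trans (hD m₀ hm₀)
  -- A null sequence bounded by `β / 2`, so that the term `c n * ‖u n‖` is absorbed by `β * ‖u n‖ ≤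
  -- ‖A (m n) (u n)‖`; solving for `‖u n‖` gives the value of `K` below.
  let c : ℕ → ℝ := fun n => β / 2 * (1 / ((n : ℝ) + 1))
  have hc0 : ∀ n, 0 < c n := fun n => by positivity
  have hcle : ∀ n, c n ≤ β / 2 := fun n => by
    refine mul_le_of_le_one_right (by positivity) ?_
    rw [div_le_one (by positivity)]
    linarith [(Nat.cast_nonneg n : (0 : ℝ) ≤ n)]
  have hclim : Tendsto c atTop (𝓝 0) := by
    simpa [c] using (tendsto_one_div_add_atTop_nhds_zero_nat (𝕜 := ℝ)).const_mul (β / 2)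
  choose m hmB u hu hlt using fun n => hcon (c n) (hc0 n)
  set K : ℝ := 2 / β * ‖A m₀ v₀‖ + ‖v₀‖ + D with hKdef
  have hK : ∀ n, ‖u n‖ ≤ K := by
    intro n
    have h1 := mul_norm_le_of_mem_upperEigenspan (A (m n)) hβ.le (hu n)
    have h2 : ‖A (m n) (u n)‖ ≤ ‖A (m n) (u n) - A m₀ v₀‖ + ‖A m₀ v₀‖ := norm_le_norm_sub_add _ _
    have h3 : c n * (‖u n - v₀‖ + ‖m n - m₀‖) ≤ β / 2 * (‖u n‖ + ‖v₀‖ + D) := by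
      gcongr
      · exact hcle n
      · exact norm_sub_le _ _
      · exact hD _ (hmB n)
    have h4 : β / 2 * ‖u n‖ ≤ ‖A m₀ v₀‖ + β / 2 * (‖v₀‖ + D) := by linarith [hlt n]
    have h5 : ‖u n‖ = 2 / β * (β / 2 * ‖u n‖) := by field_simp
    rw [h5, hKdef]
    refine (mul_le_mul_of_nonneg_left h4 (by positivity)).trans_eq ?_
    field_simp
    ring
  let l : Ultrafilter ℕ := Ultrafilter.of atTop
  have hl : (l : Filter ℕ) ≤ atTop := Ultrafilter.of_le _
  have hcl : Tendsto c l (𝓝 0) := hclim.mono_left hl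
  have helim : Tendsto (fun n => A (m n) (u n)) l (𝓝 (A m₀ v₀)) := by
    rw [tendsto_iff_norm_sub_tendsto_zero]
    have : Tendsto (fun n => c n * (K + ‖v₀‖ + D)) l (𝓝 0) := by
      simpa using hcl.mul_const (K + ‖v₀‖ + D)
    refine squeeze_zero (fun _ => norm_nonneg _) (fun n => (hlt n).le.trans ?_) this
    have := hc0 n
    gcongr
    · exact (norm_sub_le _ _).trans (by gcongr; exact hK n)
    · exact hD _ (hmB n)
  obtain ⟨m₁, hm₁, hmlim⟩ := hB.ultrafilter_le_nhds (l.map m) (by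
    rw [le_principal_iff, Ultrafilter.mem_coe, Ultrafilter.mem_map]
    exact Filter.univ_mem' hmB)
  have hmlim' : Tendsto m l (𝓝[B] m₁) :=
    tendsto_nhdsWithin_iff.2 ⟨hmlim, Eventually.of_forall hmB⟩
  obtain ⟨u₁, -, hu₁⟩ := exists_weak_limit l (Eventually.of_forall hK)
  -- From here on `m₁` stands for `m₀` and `u₁` for `v₀`; once the backward iterates are introduced,
  -- `v₀` is written `a 0`.
  obtain ⟨rfl, rfl⟩ := hU1 m₁ hm₁ u₁ (tendsto_nhds_unique
    (tendsto_of_weak_limit l (hcomp m₁ hm₁) ((hcont m₁ hm₁).tendsto.comp hmlim')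
      (Eventually.of_forall hK) hu₁) helim)
  have hAlim : Tendsto (fun n => A (m n)) l (𝓝 (A m₁)) := (hcont m₁ hm₁).tendsto.comp hmlim'
  obtain ⟨a, rfl, ha, haK⟩ := exists_backward_iterates l (hcomp m₁ hm₁) hAlim
    (pow_pos hβ 2) hu hK hu₁
  -- The threshold is lowered to `γ = β ^ 2 / 2`, so that the iterates decay at the rate `2 * γ`
  -- which the perturbation lemma requires.
  have haK' : ∀ j, ‖a j‖ * (2 * (β ^ 2 / 2)) ^ j ≤ K := by
    simpa only [mul_div_cancel₀ (β ^ 2) (two_ne_zero' ℝ)] using haK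
  have hK0 : 0 ≤ K := (norm_nonneg _).trans (hK 0)
  have htlim : Tendsto (fun n => ‖m n - m₁‖) l (𝓝 0) := tendsto_iff_norm_sub_tendsto_zero.1 hmlim
  obtain ⟨L, hL0, hL⟩ := hDA.isBigO_sub.exists_pos
  have hLl : ∀ᶠ n in (l : Filter ℕ), ‖A (m n) - A m₁‖ ≤ L * ‖m n - m₁‖ := hmlim'.eventually hL.bound
  have hA1 : ∀ᶠ n in (l : Filter ℕ), ‖A (m n)‖ ≤ ‖A m₁‖ + 1 :=
    (hAlim.norm.eventually (gt_mem_nhds (lt_add_one _))).mono fun _ h => le_of_lt h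
  set s : ℝ := (√(β ^ 2 / 2))⁻¹ with hs
  have hs0 : 0 < s := by positivity
  set C₁ : ℝ := s * L * ‖a 0‖ + (‖A m₁‖ + 1 + ‖A m₁‖) * L * K / (β ^ 2 / 2) with hC₁
  have hC₁0 : 0 ≤ C₁ := by positivity
  have hz1 : ∀ᶠ n in (l : Filter ℕ), ‖u n - a 0‖ ≤
      s * ‖A (m n) (u n) - A m₁ (a 0)‖ + C₁ * ‖m n - m₁‖ := by
    filter_upwards [hLl, hA1] with n hn hn'
    have h1 := norm_sub_le_of_backward_iterates (hcomp _ (hmB n)) (by positivity : 0 < β ^ 2 / 2)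
      (upperEigenspan_anti _ (by nlinarith [sq_nonneg β]) (hu n)) ha haK'
    have h2 : ‖A (m n) (u n - a 0)‖ ≤
        ‖A (m n) (u n) - A m₁ (a 0)‖ + L * ‖m n - m₁‖ * ‖a 0‖ := by
      have : A (m n) (u n - a 0) =
          (A (m n) (u n) - A m₁ (a 0)) - (A (m n) - A m₁) (a 0) := by
        rw [map_sub, _root_.sub_apply]; abel
      rw [this]
      refine (norm_sub_le _ _).trans (add_le_add le_rfl ?_)
      exact ((A (m n) - A m₁).le_opNorm _).trans (by gcongr)
    have h3 : (‖A (m n)‖ + ‖A m₁‖) * ‖A (m n) - A m₁‖ * K / (β ^ 2 / 2) ≤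
        (‖A m₁‖ + 1 + ‖A m₁‖) * (L * ‖m n - m₁‖) * K / (β ^ 2 / 2) := by gcongr
    calc ‖u n - a 0‖ ≤ s * (‖A (m n) (u n) - A m₁ (a 0)‖ + L * ‖m n - m₁‖ * ‖a 0‖) +
          (‖A m₁‖ + 1 + ‖A m₁‖) * (L * ‖m n - m₁‖) * K / (β ^ 2 / 2) :=
          h1.trans (add_le_add (by gcongr) h3)
      _ = _ := by rw [hC₁]; ring
  -- With x = ‖u n - a 0‖ and t = ‖m n - m₁‖, the residual term is eventually at most (x + t)/2, and
  -- x ≤ (x + t)/2 + C₁ t gives this constant.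
  set C₂ : ℝ := 1 + 2 * C₁ with hC₂
  have hz : ∀ᶠ n in (l : Filter ℕ), ‖u n - a 0‖ ≤ C₂ * ‖m n - m₁‖ := by
    have hsmall : ∀ᶠ n in (l : Filter ℕ), s * c n < 1 / 2 := by
      have : Tendsto (fun n => s * c n) l (𝓝 0) := by simpa using hcl.const_mul s
      exact this.eventually (gt_mem_nhds (by norm_num))
    filter_upwards [hz1, hsmall] with n hn hn'
    have h1 : s * ‖A (m n) (u n) - A m₁ (a 0)‖ ≤ 1 / 2 * (‖u n - a 0‖ + ‖m n - m₁‖) := by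
      calc s * ‖A (m n) (u n) - A m₁ (a 0)‖ ≤ s * (c n * (‖u n - a 0‖ + ‖m n - m₁‖)) := by
            gcongr; exact (hlt n).le
        _ = s * c n * (‖u n - a 0‖ + ‖m n - m₁‖) := by ring
        _ ≤ _ := by gcongr
    rw [hC₂]
    linarith
  -- If `m n = m₁`, the previous bound gives `u n = a 0`, and the strict inequality `hlt` would put
  -- a norm below `0`.
  have htpos : ∀ᶠ n in (l : Filter ℕ), 0 < ‖m n - m₁‖ := by
    filter_upwards [hz] with n hn
    by_contra hneg
    have h0 : ‖m n - m₁‖ = 0 := le_antisymm (not_lt.1 hneg) (norm_nonneg _)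
    have h1 := hlt n
    rw [h0, mul_zero] at hn
    rw [h0, le_antisymm hn (norm_nonneg _), add_zero, mul_zero] at h1
    exact (norm_nonneg _).not_gt h1
  let t : ℕ → ℝ := fun n => ‖m n - m₁‖
  obtain ⟨q, -, hq⟩ := (isCompact_closedBall (0 : E) 1).ultrafilter_le_nhds
    (l.map fun n => (t n)⁻¹ • (m n - m₁)) (by
      rw [le_principal_iff, Ultrafilter.mem_coe, Ultrafilter.mem_map]
      refine Filter.univ_mem' fun n => ?_
      rw [mem_preimage, mem_closedBall_zero_iff, norm_smul, norm_inv, norm_norm]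
      exact inv_mul_le_one)
  have hq' : Tendsto (fun n => (t n)⁻¹ • (m n - m₁)) l (𝓝 q) := hq
  have hq1 : ‖q‖ = 1 := by
    refine tendsto_nhds_unique hq'.norm ((tendsto_const_nhds (x := (1 : ℝ))).congr' ?_)
    filter_upwards [htpos] with n hn
    rw [norm_smul, norm_inv, norm_norm, inv_mul_cancel₀ hn.ne']
  have hwb : ∀ᶠ n in (l : Filter ℕ), ‖(t n)⁻¹ • (u n - a 0)‖ ≤ C₂ := by
    filter_upwards [hz, htpos] with n hn hn'
    rw [norm_smul, norm_inv, norm_norm, inv_mul_le_iff₀ hn', mul_comm]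
    exact hn
  obtain ⟨w, -, hw⟩ := exists_weak_limit l hwb
  have hAw := tendsto_of_weak_limit l (hcomp m₁ hm₁)
    (tendsto_const_nhds (x := A m₁)) hwb hw
  have hdiff : Tendsto (fun n => (t n)⁻¹ • (A (m n) - A m₁)) l (𝓝 (DA q)) := by
    have h1 : Tendsto (fun n => (t n)⁻¹ • (A (m n) - A m₁ - DA (m n - m₁))) l (𝓝 0) := by
      rw [tendsto_zero_iff_norm_tendsto_zero]
      refine ((hasFDerivWithinAt_iff_tendsto.1 hDA).comp hmlim').congr fun n => ?_
      rw [norm_smul, norm_inv, norm_norm]; rfl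
    have h2 := h1.add ((DA.continuous.tendsto q).comp hq')
    rw [zero_add] at h2
    refine h2.congr fun n => ?_
    rw [Function.comp_apply, map_smul, ← smul_add, sub_add_cancel]
  -- The convergence is in norm, so the difference quotients of `A` can be applied to `u n` in the
  -- limit without compactness of `DA q`.
  have hustrong : Tendsto u l (𝓝 (a 0)) := by
    rw [tendsto_iff_norm_sub_tendsto_zero]
    refine squeeze_zero' (Eventually.of_forall fun _ => norm_nonneg _) hz ?_
    simpa using htlim.const_mul C₂
  have happ : Continuous fun z : (X →L[ℝ] Y) × X => z.1 z.2 :=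
    continuous_fst.clm_apply continuous_snd
  have hsum := ((happ.tendsto (DA q, a 0)).comp (hdiff.prodMk_nhds hustrong)).add hAw
  have hzero : Tendsto (fun n => (t n)⁻¹ • (A (m n) (u n) - A m₁ (a 0))) l (𝓝 0) := by
    have : Tendsto (fun n => c n * (C₂ + 1)) l (𝓝 0) := by simpa using hcl.mul_const (C₂ + 1)
    refine squeeze_zero_norm' ?_ this
    filter_upwards [hz, htpos] with n hn hn'
    rw [norm_smul, norm_inv, norm_norm, inv_mul_le_iff₀ hn']
    refine (hlt n).le.trans ?_
    have := hc0 n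
    calc c n * (‖u n - a 0‖ + ‖m n - m₁‖) ≤ c n * (C₂ * ‖m n - m₁‖ + ‖m n - m₁‖) := by gcongr
      _ = _ := by ring
  -- The rescaled residual equals the difference quotient of `A` applied to `u n`, plus `A m₁`
  -- applied to `(t n)⁻¹ • (u n - a 0)`.
  have hlim0 : DA q (a 0) + A m₁ w = 0 := by
    refine tendsto_nhds_unique hsum (hzero.congr fun n => ?_)
    simp only [Function.comp_apply]
    rw [_root_.smul_apply, map_smul, ← smul_add, _root_.sub_apply, map_sub]
    congr 1
    abel
  refine hU2 q hq1 (-w) ?_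
  rw [map_neg]
  exact eq_neg_of_add_eq_zero_left hlim0

end Abstract

/-! ### Hausdorff measure under Lipschitz and non-contracting maps. -/

section HausdorffMeasure

variable {X : Type*} [MetricSpace X] [MeasurableSpace X] [BorelSpace X]
  {Y : Type*} [MetricSpace Y] [MeasurableSpace Y] [BorelSpace Y]

theorem LipschitzOnWith.euclideanHausdorffMeasure_image_le {K : ℝ≥0} {f : X → Y} {s : Set X}
    (h : LipschitzOnWith K f s) (r : ℕ) : (μHE[r] : Measure Y) (f '' s) ≤ K ^ r * μHE[r] s := by
  simp only [Measure.euclideanHausdorffMeasure_def, Measure.smul_apply]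
  rw [mul_smul_comm]
  have h1 := h.hausdorffMeasure_image_le (d := r) (Nat.cast_nonneg r)
  rw [ENNReal.rpow_natCast] at h1
  gcongr

/-- Change of variables inequality for maps which do not contract distances too much. -/
theorem setLIntegral_comp_le_of_antilipschitzOn {r : ℕ} {U' : Set X} {U : Set Y} {h : X → Y}
    (hh : Measurable h) (hmaps : MapsTo h U' U) {c : ℝ≥0}
    (hc : ∀ z ∈ U', ∀ z' ∈ U', dist z z' ≤ c * dist (h z) (h z')) {F : Y → ℝ≥0∞}
    (hF : Measurable F) :
    ∫⁻ z in U', F (h z) ∂(μHE[r] : Measure X) ≤ c ^ r * ∫⁻ z in U, F z ∂(μHE[r] : Measure Y) := by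
  -- A comparison of measures replaces the area formula: `h` is injective on `U'` and its inverse
  -- there is `c`-Lipschitz, so preimages have measure at most `c ^ r` times that of the image.
  have hle : ((μHE[r] : Measure X).restrict U').map h ≤
      ((c : ℝ≥0∞) ^ r) • (μHE[r] : Measure Y).restrict U := by
    refine Measure.le_iff.2 fun A hA => ?_
    rw [Measure.map_apply hh hA, Measure.restrict_apply (hh hA), Measure.smul_apply, smul_eq_mul,
      Measure.restrict_apply hA]
    set s := h ⁻¹' A ∩ U' with hs
    rcases s.eq_empty_or_nonempty with h0 | ⟨x0, hx0⟩
    · rw [h0]; simp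
    have hne : Nonempty X := ⟨x0⟩
    have hinj : InjOn h s := by
      intro z hz z' hz' heq
      have := hc z hz.2 z' hz'.2
      rw [heq, dist_self, mul_zero] at this
      exact dist_le_zero.1 this
    have hlip : LipschitzOnWith c (Function.invFunOn h s) (h '' s) := by
      refine LipschitzOnWith.of_dist_le_mul ?_
      rintro _ ⟨z, hz, rfl⟩ _ ⟨z', hz', rfl⟩
      rw [hinj.leftInvOn_invFunOn hz, hinj.leftInvOn_invFunOn hz']
      exact hc z hz.2 z' hz'.2
    have himg : Function.invFunOn h s '' (h '' s) = s := hinj.leftInvOn_invFunOn.image_image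
    calc (μHE[r] : Measure X) s = μHE[r] (Function.invFunOn h s '' (h '' s)) := by rw [himg]
      _ ≤ c ^ r * μHE[r] (h '' s) := hlip.euclideanHausdorffMeasure_image_le r
      _ ≤ c ^ r * μHE[r] (A ∩ U) := by
        gcongr
        rintro _ ⟨z, hz, rfl⟩
        exact ⟨hz.1, hmaps hz.2⟩
  calc ∫⁻ z in U', F (h z) ∂(μHE[r] : Measure X)
      = ∫⁻ y, F y ∂((μHE[r] : Measure X).restrict U').map h := (lintegral_map hF hh).symm
    _ ≤ ∫⁻ y, F y ∂(((c : ℝ≥0∞) ^ r) • (μHE[r] : Measure Y).restrict U) := lintegral_mono' hle le_rfl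
    _ = _ := lintegral_smul_measure _ _

end HausdorffMeasure

/-! ### Surface measure of the model corner. -/

section Corner

/-- The model corner: the first `r` coordinates are nonnegative and the others vanish. -/
def cornerModel (d r : ℕ) : Set (Euc d) :=
  {z | ∀ i : Fin d, ((i : ℕ) < r → 0 ≤ z i) ∧ (r ≤ (i : ℕ) → z i = 0)}

theorem convex_cornerModel (d r : ℕ) : Convex ℝ (cornerModel d r) := by
  intro x hx y hy a b ha hb _ i
  simp only [PiLp.add_apply, PiLp.smul_apply, smul_eq_mul]
  refine ⟨fun hi => ?_, fun hi => ?_⟩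
  · have := (hx i).1 hi
    have := (hy i).1 hi
    positivity
  · rw [(hx i).2 hi, (hy i).2 hi, mul_zero, mul_zero, add_zero]

/-- The inclusion of `ℝʳ` in `ℝʳ⁺ᵏ`. -/
def eucInclusion (r k : ℕ) (w : Euc r) : Euc (r + k) :=
  WithLp.toLp 2 (Fin.append w.ofLp 0)

@[simp] theorem eucInclusion_castAdd {r k : ℕ} (w : Euc r) (i : Fin r) :
    eucInclusion r k w (Fin.castAdd k i) = w i := by
  simp [eucInclusion]

@[simp] theorem eucInclusion_natAdd {r k : ℕ} (w : Euc r) (i : Fin k) :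
    eucInclusion r k w (Fin.natAdd r i) = 0 := by
  simp [eucInclusion]

theorem isometry_eucInclusion (r k : ℕ) : Isometry (eucInclusion r k) := by
  refine Isometry.of_dist_eq fun x y => ?_
  rw [EuclideanSpace.dist_eq, EuclideanSpace.dist_eq, Fin.sum_univ_add]
  simp

theorem exists_eucInclusion_eq {r k : ℕ} {z : Euc (r + k)} (hz : z ∈ cornerModel (r + k) r) :
    ∃ w : Euc r, eucInclusion r k w = z ∧ ∀ i, 0 ≤ w i := by
  refine ⟨WithLp.toLp 2 fun i => z (Fin.castAdd k i), ?_, fun i => (hz (Fin.castAdd k i)).1 i.2⟩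
  ext i
  refine Fin.addCases (fun i => ?_) (fun i => ?_) i
  · simp
  · rw [eucInclusion_natAdd, (hz (Fin.natAdd r i)).2 (by simp)]

theorem eucInclusion_mem_cornerModel {r k : ℕ} {w : Euc r} (hw : ∀ i, 0 ≤ w i) :
    eucInclusion r k w ∈ cornerModel (r + k) r := by
  intro i
  refine Fin.addCases (fun i => ⟨fun _ => ?_, fun h => ?_⟩) (fun i => ⟨fun h => ?_, fun _ => ?_⟩) i
  · rw [eucInclusion_castAdd]; exact hw i
  · exact absurd i.2 (not_lt.2 (by simpa using h))
  · exact absurd h (by simp)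
  · rw [eucInclusion_natAdd]

/-- The corner lies in an isometric copy of `ℝʳ`, where the normalized `r`-dimensional Hausdorff
measure is Lebesgue measure. -/
theorem euclideanHausdorffMeasure_ball_inter_cornerModel_lt_top {d r : ℕ} (hr : r ≤ d) (z : Euc d)
    (ε : ℝ) : (μHE[r] : Measure (Euc d)) (Metric.ball z ε ∩ cornerModel d r) < ∞ := by
  obtain ⟨k, rfl⟩ := Nat.exists_eq_add_of_le hr
  have hsub : Metric.ball z ε ∩ cornerModel (r + k) r ⊆
      eucInclusion r k '' (eucInclusion r k ⁻¹' Metric.ball z ε) := by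
    rintro y ⟨hy, hyc⟩
    obtain ⟨w, rfl, -⟩ := exists_eucInclusion_eq hyc
    exact ⟨w, hy, rfl⟩
  refine (measure_mono hsub).trans_lt ?_
  rw [(isometry_eucInclusion r k).euclideanHausdorffMeasure_image,
    EuclideanSpace.euclideanHausdorffMeasure_eq_volume]
  refine Bornology.IsBounded.measure_lt_top ?_
  exact (isometry_eucInclusion r k).antilipschitz.isBounded_preimage Metric.isBounded_ball

theorem euclideanHausdorffMeasure_ball_inter_cornerModel_pos {d r : ℕ} (hr : r ≤ d) {z : Euc d}
    (hz : z ∈ cornerModel d r) {ε : ℝ} (hε : 0 < ε) :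
    0 < (μHE[r] : Measure (Euc d)) (Metric.ball z ε ∩ cornerModel d r) := by
  obtain ⟨k, rfl⟩ := Nat.exists_eq_add_of_le hr
  obtain ⟨w, rfl, hw⟩ := exists_eucInclusion_eq hz
  set P : Set (Euc r) := Metric.ball w ε ∩ ⋂ i, {v : Euc r | 0 < v i}
  have hsub : eucInclusion r k '' P ⊆
      Metric.ball (eucInclusion r k w) ε ∩ cornerModel (r + k) r := by
    rintro _ ⟨v, ⟨hv, hv'⟩, rfl⟩
    refine ⟨?_, eucInclusion_mem_cornerModel fun i => (mem_iInter.1 hv' i).le⟩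
    rw [Metric.mem_ball, (isometry_eucInclusion r k).dist_eq]
    exact hv
  refine lt_of_lt_of_le ?_ (measure_mono hsub)
  rw [(isometry_eucInclusion r k).euclideanHausdorffMeasure_image,
    EuclideanSpace.euclideanHausdorffMeasure_eq_volume]
  have hopen : IsOpen P := Metric.isOpen_ball.inter
    (isOpen_iInter_of_finite fun i => isOpen_lt continuous_const (by fun_prop))
  refine hopen.measure_pos _ ?_
  -- A small push in the diagonal direction moves any corner point into the open orthant, so the
  -- open set `P` is nonempty.
  set one : Euc r := WithLp.toLp 2 fun _ => (1 : ℝ)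
  have hcont : Tendsto (fun t : ℝ => w + t • one) (𝓝[>] 0) (𝓝 w) := by
    have h1 : Continuous fun t : ℝ => w + t • one := by fun_prop
    simpa using (h1.tendsto 0).mono_left nhdsWithin_le_nhds
  obtain ⟨t, ht, ht0⟩ :=
    ((hcont.eventually (Metric.ball_mem_nhds w hε)).and self_mem_nhdsWithin).exists
  refine ⟨w + t • one, ht, mem_iInter.2 fun i => ?_⟩
  have ht0' : (0 : ℝ) < t := ht0
  simpa [one] using add_pos_of_nonneg_of_pos (hw i) ht0'

end Corner

/-! ### Bi-Lipschitz convex patches of a manifold. -/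

section Patch

variable {d r : ℕ} {S : Set (Euc d)}

/-- A bi-Lipschitz parametrization `ψ`, with inverse `κ`, of the part `U` of `S` by a convex
set `D`. -/
structure IsPatch (S U D : Set (Euc d)) (κ ψ : Euc d → Euc d) (L : ℝ≥0) : Prop where
  convex : Convex ℝ D
  subset : U ⊆ S
  measurableSet : MeasurableSet U
  measurable_coord : Measurable κ
  measurable_param : Measurable ψ
  mapsTo_coord : MapsTo κ U D
  mapsTo_param : MapsTo ψ D U
  left_inv : ∀ x ∈ U, ψ (κ x) = x
  right_inv : ∀ z ∈ D, κ (ψ z) = z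
  lipschitz_coord : LipschitzOnWith L κ U
  lipschitz_param : LipschitzOnWith L ψ D
  exists_fderiv : ∀ z ∈ D, ∃ ψ' : Euc d →L[ℝ] Euc d, HasFDerivAt ψ ψ' z ∧ ‖ψ'‖ ≤ L

/-- A `C¹` chart and its inverse are Lipschitz near a point, and a ball meets the convex corner in a
convex set. Segments of the patch thus become controlled paths in `S`, also at boundary and corner
points. -/
theorem IsFlatteningChart.exists_isPatch {Φ : OpenPartialHomeomorph (Euc d) (Euc d)}
    (hΦ : IsFlatteningChart r S Φ) (hS : IsClosed S) {x : Euc d} (hx : x ∈ Φ.source) :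
    ∃ (ε : ℝ) (L : ℝ≥0) (κ ψ : Euc d → Euc d) (O : Set (Euc d)), 0 < ε ∧ IsOpen O ∧ x ∈ O ∧
      O ⊆ Φ.source ∧ κ x = Φ x ∧ Metric.ball (Φ x) ε ⊆ Φ.target ∧
      (∀ z ∈ Metric.ball (Φ x) ε, ψ z = Φ.symm z) ∧
      IsPatch S (S ∩ O) (Metric.ball (Φ x) ε ∩ cornerModel d r) κ ψ L := by
  classical
  have hx' : Φ x ∈ Φ.target := Φ.map_source hx
  obtain ⟨K₁, t₁, ht₁, hK₁⟩ := (hΦ.contDiffOn_symm.contDiffAt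
    (Φ.open_target.mem_nhds hx')).exists_lipschitzOnWith
  obtain ⟨K₂, t₂, ht₂, hK₂⟩ := (hΦ.contDiffOn.contDiffAt
    (Φ.open_source.mem_nhds hx)).exists_lipschitzOnWith
  have ht₂' : Φ.symm ⁻¹' t₂ ∈ 𝓝 (Φ x) := by
    refine (Φ.continuousAt_symm hx').preimage_mem_nhds ?_
    rwa [Φ.left_inv hx]
  obtain ⟨ε, hε, hball⟩ := Metric.mem_nhds_iff.1
    (inter_mem (inter_mem (Φ.open_target.mem_nhds hx') ht₁) ht₂')
  set b := Metric.ball (Φ x) ε with hb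
  have hbt : b ⊆ Φ.target := fun z hz => (hball hz).1.1
  set O : Set (Euc d) := Φ.source ∩ Φ ⁻¹' b with hO
  have hOopen : IsOpen O := Φ.isOpen_inter_preimage Metric.isOpen_ball
  have hxb : Φ x ∈ b := Metric.mem_ball_self hε
  have hxO : x ∈ O := ⟨hx, mem_preimage.2 hxb⟩
  -- Extension by zero off an open set makes both maps Borel on the whole space.
  let κ : Euc d → Euc d := Φ.source.piecewise Φ 0
  let ψ : Euc d → Euc d := b.piecewise Φ.symm 0
  have hκ : ∀ y ∈ Φ.source, κ y = Φ y := fun y hy => piecewise_eq_of_mem _ _ _ hy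
  have hψ : ∀ z ∈ b, ψ z = Φ.symm z := fun z hz => piecewise_eq_of_mem _ _ _ hz
  have hmem : ∀ y ∈ Φ.source, y ∈ S ↔ Φ y ∈ cornerModel d r := fun y hy => hΦ.mem_iff y hy
  have hsO : ∀ z ∈ b, Φ.symm z ∈ O := fun z hz =>
    ⟨Φ.map_target (hbt hz), by rw [mem_preimage, Φ.right_inv (hbt hz)]; exact hz⟩
  refine ⟨ε, max K₁ K₂, κ, ψ, O, hε, hOopen, hxO, inter_subset_left, hκ x hx, hbt, hψ, ?_⟩
  refine ⟨(convex_ball _ _).inter (convex_cornerModel d r),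
    inter_subset_left,
    hS.measurableSet.inter hOopen.measurableSet,
    Φ.continuousOn.measurable_piecewise continuousOn_const Φ.open_source.measurableSet,
    (Φ.continuousOn_symm.mono hbt).measurable_piecewise continuousOn_const measurableSet_ball,
    ?_, ?_, ?_, ?_, ?_, ?_, ?_⟩
  · rintro y ⟨hyS, hy, hyb⟩
    rw [hκ y hy]
    exact ⟨hyb, (hmem y hy).1 hyS⟩
  · rintro z ⟨hz, hzc⟩
    rw [hψ z hz]
    refine ⟨(hmem _ (hsO z hz).1).2 ?_, hsO z hz⟩
    rwa [Φ.right_inv (hbt hz)]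
  · rintro y ⟨hyS, hy, hyb⟩
    rw [hκ y hy, hψ _ hyb, Φ.left_inv hy]
  · rintro z ⟨hz, hzc⟩
    rw [hψ z hz, hκ _ (hsO z hz).1, Φ.right_inv (hbt hz)]
  · have h1 : LipschitzOnWith K₂ Φ O := hK₂.mono fun y hy => by
      have : Φ.symm (Φ y) ∈ t₂ := (hball hy.2).2
      rwa [Φ.left_inv hy.1] at this
    refine LipschitzOnWith.weaken (K := K₂) ?_ (le_max_right _ _)
    intro y hy y' hy'
    rw [hκ y hy.2.1, hκ y' hy'.2.1]
    exact h1 hy.2 hy'.2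
  · refine LipschitzOnWith.weaken (K := K₁) ?_ (le_max_left _ _)
    intro z hz z' hz'
    rw [hψ z hz.1, hψ z' hz'.1]
    exact hK₁ (hball hz.1).1.2 (hball hz'.1).1.2
  · rintro z ⟨hz, -⟩
    have hbz : b ∈ 𝓝 z := Metric.isOpen_ball.mem_nhds hz
    have hdiff : DifferentiableAt ℝ Φ.symm z :=
      (hΦ.contDiffOn_symm.contDiffAt (Φ.open_target.mem_nhds (hbt hz))).differentiableAt one_ne_zero
    refine ⟨fderiv ℝ Φ.symm z, hdiff.hasFDerivAt.congr_of_eventuallyEq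
      (Filter.eventuallyEq_of_mem hbz hψ), ?_⟩
    refine (norm_fderiv_le_of_lipschitzOn ℝ hbz (hK₁.mono fun y hy => (hball hy).1.2)).trans ?_
    exact_mod_cast le_max_left K₁ K₂

theorem IsPatch.exists_hasDerivAt {U D : Set (Euc d)} {κ ψ : Euc d → Euc d} {L : ℝ≥0}
    (h : IsPatch S U D κ ψ L) {a b : Euc d} (ha : a ∈ D) (hb : b ∈ D) {t : ℝ}
    (ht : t ∈ Icc (0 : ℝ) 1) : ∃ v, HasDerivAt (fun t => ψ (AffineMap.lineMap a b t)) v t ∧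
      ‖v‖ ≤ L * ‖b - a‖ := by
  obtain ⟨ψ', hψ', hn⟩ := h.exists_fderiv _ (h.convex.lineMap_mem ha hb ht)
  refine ⟨ψ' (b - a), hψ'.comp_hasDerivAt t AffineMap.hasDerivAt_lineMap, ?_⟩
  exact (ψ'.le_opNorm _).trans (by gcongr)

theorem IsPatch.continuousOn_param {U D : Set (Euc d)} {κ ψ : Euc d → Euc d} {L : ℝ≥0}
    (h : IsPatch S U D κ ψ L) : ContinuousOn ψ D := h.lipschitz_param.continuousOn

theorem IsCompactEmbeddedManifold.exists_isPatch (hS : IsCompactEmbeddedManifold r S) {x : Euc d}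
    (hx : x ∈ S) :
    ∃ (ε : ℝ) (L : ℝ≥0) (κ ψ : Euc d → Euc d) (O : Set (Euc d)), 0 < ε ∧ IsOpen O ∧ x ∈ O ∧
      κ x ∈ cornerModel d r ∧
      IsPatch S (S ∩ O) (Metric.ball (κ x) ε ∩ cornerModel d r) κ ψ L := by
  obtain ⟨Φ, hΦ, hxΦ⟩ := hS.exists_chart x hx
  obtain ⟨ε, L, κ, ψ, O, hε, hO, hxO, -, hκx, -, -, h⟩ :=
    hΦ.exists_isPatch hS.isCompact.isClosed hxΦ
  rw [← hκx] at h
  exact ⟨ε, L, κ, ψ, O, hε, hO, hxO, (h.mapsTo_coord ⟨hx, hxO⟩).2, h⟩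

theorem IsPatch.measure_lt_top (hr : r ≤ d) {U : Set (Euc d)} {z : Euc d} {ε : ℝ}
    {κ ψ : Euc d → Euc d} {L : ℝ≥0}
    (h : IsPatch S U (Metric.ball z ε ∩ cornerModel d r) κ ψ L) :
    (μHE[r] : Measure (Euc d)) U < ∞ := by
  have hU : U ⊆ ψ '' (Metric.ball z ε ∩ cornerModel d r) := fun x hx =>
    ⟨κ x, h.mapsTo_coord hx, h.left_inv x hx⟩
  refine (measure_mono hU).trans_lt ?_
  refine (h.lipschitz_param.euclideanHausdorffMeasure_image_le r).trans_lt ?_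
  exact ENNReal.mul_lt_top (by simp)
    (euclideanHausdorffMeasure_ball_inter_cornerModel_lt_top hr z ε)

theorem IsCompactEmbeddedManifold.measure_lt_top (hS : IsCompactEmbeddedManifold r S) :
    (μHE[r] : Measure (Euc d)) S < ∞ := by
  refine hS.isCompact.induction_on (p := fun s => (μHE[r] : Measure (Euc d)) s < ∞) (by simp)
    (fun s t hst ht => (measure_mono hst).trans_lt ht)
    (fun s t hs ht => (measure_union_le s t).trans_lt (ENNReal.add_lt_top.2 ⟨hs, ht⟩)) ?_
  intro x hx
  obtain ⟨ε, L, κ, ψ, O, -, hO, hxO, -, h⟩ := hS.exists_isPatch hx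
  exact ⟨S ∩ O, inter_mem_nhdsWithin S (hO.mem_nhds hxO), h.measure_lt_top hS.dim_le⟩

theorem IsCompactEmbeddedManifold.isFiniteMeasure_surfaceMeasure
    (hS : IsCompactEmbeddedManifold r S) : IsFiniteMeasure (surfaceMeasure r S) :=
  ⟨by rw [surfaceMeasure, Measure.restrict_apply_univ]; exact hS.measure_lt_top⟩

/-- Nonempty relatively open subsets of a manifold have positive surface measure. -/
theorem IsCompactEmbeddedManifold.measure_inter_pos (hS : IsCompactEmbeddedManifold r S)
    {x : Euc d} (hx : x ∈ S) {W : Set (Euc d)} (hW : IsOpen W) (hxW : x ∈ W) :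
    0 < (μHE[r] : Measure (Euc d)) (S ∩ W) := by
  obtain ⟨ε, L, κ, ψ, O, hε, hO, hxO, hκx, h⟩ := hS.exists_isPatch hx
  have hmem : κ x ∈ Metric.ball (κ x) ε ∩ cornerModel d r := ⟨Metric.mem_ball_self hε, hκx⟩
  have hcont := h.continuousOn_param (κ x) hmem
  have hW' : W ∈ 𝓝 (ψ (κ x)) := by
    rw [h.left_inv x ⟨hx, hxO⟩]; exact hW.mem_nhds hxW
  obtain ⟨δ, hδ, hsub⟩ := Metric.mem_nhdsWithin_iff.1 (hcont hW')
  set D' := Metric.ball (κ x) (min δ ε) ∩ cornerModel d r with hD'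
  have hD'D : D' ⊆ Metric.ball (κ x) ε ∩ cornerModel d r := fun z hz =>
    ⟨Metric.ball_subset_ball (min_le_right _ _) hz.1, hz.2⟩
  have hψW : ψ '' D' ⊆ S ∩ W := by
    rintro _ ⟨z, hz, rfl⟩
    exact ⟨(h.mapsTo_param (hD'D hz)).1,
      hsub ⟨Metric.ball_subset_ball (min_le_left _ _) hz.1, hD'D hz⟩⟩
  have hκψ : D' ⊆ κ '' (ψ '' D') := fun z hz =>
    ⟨ψ z, ⟨z, hz, rfl⟩, h.right_inv z (hD'D hz)⟩
  have hpos := euclideanHausdorffMeasure_ball_inter_cornerModel_pos hS.dim_le hκx (lt_min hδ hε)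
  have hlip : LipschitzOnWith L κ (ψ '' D') := h.lipschitz_coord.mono (by
    rintro _ ⟨z, hz, rfl⟩
    exact h.mapsTo_param (hD'D hz))
  have h1 : 0 < (L : ℝ≥0∞) ^ r * μHE[r] (S ∩ W) :=
    calc 0 < (μHE[r] : Measure (Euc d)) D' := hpos
      _ ≤ μHE[r] (κ '' (ψ '' D')) := measure_mono hκψ
      _ ≤ L ^ r * μHE[r] (ψ '' D') := hlip.euclideanHausdorffMeasure_image_le r
      _ ≤ L ^ r * μHE[r] (S ∩ W) := by gcongr
  exact pos_iff_ne_zero.2 fun h0 => by rw [h0, mul_zero] at h1; exact lt_irrefl _ h1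

end Patch

/-! ### Energy estimates along a path. -/

section OneDimensional

/-- Cauchy–Schwarz against `1`, from expanding ∫ (h - c)² ≥ 0 with `c` the mean of `h`. -/
theorem sq_integral_le_mul_integral_sq {a b : ℝ} (hab : a ≤ b) {h : ℝ → ℝ} (hh : Continuous h) :
    (∫ t in a..b, h t) ^ 2 ≤ (b - a) * ∫ t in a..b, h t ^ 2 := by
  rcases hab.eq_or_lt with rfl | hlt
  · simp
  set I := ∫ t in a..b, h t with hI
  set c := I / (b - a) with hc
  have hpos : 0 < b - a := sub_pos.2 hlt
  have h0 : 0 ≤ ∫ t in a..b, (h t - c) ^ 2 :=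
    intervalIntegral.integral_nonneg hab fun t _ => sq_nonneg _
  have h1 : ∫ t in a..b, (h t - c) ^ 2 = (∫ t in a..b, h t ^ 2) - 2 * c * I + c ^ 2 * (b - a) := by
    have : ∀ t, (h t - c) ^ 2 = h t ^ 2 - 2 * c * h t + c ^ 2 := fun t => by ring
    simp_rw [this]
    rw [intervalIntegral.integral_add, intervalIntegral.integral_sub,
      intervalIntegral.integral_const_mul, intervalIntegral.integral_const, smul_eq_mul]
    · ring
    all_goals exact Continuous.intervalIntegrable (by fun_prop) _ _
  have h2 : c * (b - a) = I := by rw [hc]; field_simp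
  rw [h1] at h0
  nlinarith

/-- Energy estimate for a function whose derivative is dominated by a continuous function. -/
theorem enorm_sub_sq_le_lintegral {a b : ℝ} (hab : a ≤ b) {u u' h : ℝ → ℝ}
    (hu : ∀ t ∈ Icc a b, HasDerivWithinAt u (u' t) (Icc a b) t) (hh : ContinuousOn h (Icc a b))
    (hle : ∀ t ∈ Icc a b, |u' t| ≤ h t) :
    ‖u b - u a‖ₑ ^ 2 ≤ ENNReal.ofReal (b - a) * ∫⁻ t in Icc a b, ‖h t‖ₑ ^ 2 := by
  -- A continuous extension to the line has a primitive differentiable everywhere. The mean value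
  -- inequality against this primitive requires no integrability of `u'`.
  set H : ℝ → ℝ := IccExtend hab ((Icc a b).domRestrict h) with hH
  have hHc : Continuous H := (continuousOn_iff_continuous_domRestrict.1 hh).Icc_extend'
  have hHh : ∀ t ∈ Icc a b, H t = h t := fun t ht => IccExtend_of_mem hab _ ht
  have h1 : ‖u b - u a‖ ≤ ∫ t in a..b, H t := by
    have := image_norm_le_of_norm_deriv_right_le_deriv_boundary (a := a) (b := b)
      (f := fun t => u t - u a) (f' := u') (B := fun t => ∫ τ in a..t, H τ) (B' := H)
      (fun t ht => ((hu t ht).continuousWithinAt).sub continuousWithinAt_const)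
      (fun t ht => ((hu t (Ico_subset_Icc_self ht)).sub_const _).mono_of_mem_nhdsWithin
        (Icc_mem_nhdsGE_of_mem ht))
      (by simp)
      (fun t => intervalIntegral.integral_hasDerivAt_right (hHc.intervalIntegrable _ _)
        (hHc.stronglyMeasurableAtFilter _ _) hHc.continuousAt)
      (fun t ht => by
        rw [hHh t (Ico_subset_Icc_self ht)]
        exact hle t (Ico_subset_Icc_self ht))
    exact this ⟨hab, le_rfl⟩
  have h2 : ‖u b - u a‖ ^ 2 ≤ (b - a) * ∫ t in a..b, H t ^ 2 :=
    (pow_le_pow_left₀ (norm_nonneg _) h1 2).trans (sq_integral_le_mul_integral_sq hab hHc)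
  calc ‖u b - u a‖ₑ ^ 2 = ENNReal.ofReal (‖u b - u a‖ ^ 2) := by
        rw [ENNReal.ofReal_pow (norm_nonneg _), ofReal_norm]
    _ ≤ ENNReal.ofReal ((b - a) * ∫ t in a..b, H t ^ 2) := ENNReal.ofReal_le_ofReal h2
    _ = ENNReal.ofReal (b - a) * ENNReal.ofReal (∫ t in Icc a b, H t ^ 2) := by
        rw [ENNReal.ofReal_mul (sub_nonneg.2 hab), intervalIntegral.integral_of_le hab,
          integral_Icc_eq_integral_Ioc]
    _ = ENNReal.ofReal (b - a) * ∫⁻ t in Icc a b, ‖h t‖ₑ ^ 2 := by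
        have hint : IntegrableOn (fun t => H t ^ 2) (Icc a b) :=
          (hHc.pow 2).continuousOn.integrableOn_Icc
        rw [ofReal_integral_eq_lintegral_ofReal hint
          (Eventually.of_forall fun t => sq_nonneg _)]
        congr 1
        refine setLIntegral_congr_fun measurableSet_Icc fun t ht => ?_
        rw [hHh t ht, ← sq_abs, ENNReal.ofReal_pow (abs_nonneg _), ← Real.norm_eq_abs, ofReal_norm]

end OneDimensional

/-! ### Poincaré inequality on an interior or boundary patch. -/

section LocalPoincare

variable {d r : ℕ} {S U D : Set (Euc d)} {κ ψ : Euc d → Euc d} {L : ℝ≥0}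

theorem ContinuousOn.measurable_indicator_enorm_sq {E : Type*} [NormedAddCommGroup E]
    {g : Euc d → E} (hg : ContinuousOn g S) (hS : MeasurableSet S) :
    Measurable (S.indicator fun x => ‖g x‖ₑ ^ 2) := by
  classical
  have h1 : ContinuousOn (fun x => ‖g x‖ₑ ^ 2) S :=
    (ENNReal.continuous_pow 2).comp_continuousOn hg.enorm
  have h2 := h1.measurable_piecewise (continuousOn_const (c := (0 : ℝ≥0∞))) hS
  rwa [← Set.piecewise_eq_indicator]

theorem IsC1WithGradient.continuousOn {φ : Euc d → ℝ} {g : Euc d → Euc d}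
    (h : IsC1WithGradient S φ g) : ContinuousOn φ S := fun x hx =>
  (h.1 x hx).1.hasFDerivWithinAt.continuousWithinAt

/-- Derivative of a `C¹` function on `S` along a path in `S`. -/
theorem HasTangentialGradientAt.comp_hasDerivWithinAt {f : Euc d → ℝ} {γ : ℝ → Euc d}
    {g v : Euc d} {t : ℝ} {T : Set ℝ} (h : HasTangentialGradientAt S f g (γ t))
    (hγ : HasDerivWithinAt γ v T t) (hm : MapsTo γ T S) :
    HasDerivWithinAt (fun t => f (γ t)) (inner ℝ g v) T t := by
  have h1 := h.1.hasFDerivWithinAt.comp_hasDerivWithinAt t hγ hm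
  rwa [InnerProductSpace.toDual_apply_apply] at h1

/-- The variation of a `C¹` function between two points of a patch is controlled by its gradient on
a path. -/
theorem IsPatch.enorm_sub_sq_le (h : IsPatch S U D κ ψ L) {Δ : ℝ} (hΔ : ∀ a ∈ D, ∀ b ∈ D, ‖b - a‖ ≤ Δ)
    {φ : Euc d → ℝ} {g : Euc d → Euc d} (hφ : IsC1WithGradient S φ g) {y z : Euc d} (hy : y ∈ U)
    (hz : z ∈ U) :
    ‖φ z - φ y‖ₑ ^ 2 ≤ ‖L * Δ‖ₑ ^ 2 * ∫⁻ t in Icc (0 : ℝ) 1,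
      S.indicator (fun x => ‖g x‖ₑ ^ 2) (ψ (AffineMap.lineMap (κ y) (κ z) t)) := by
  have hκy := h.mapsTo_coord hy
  have hκz := h.mapsTo_coord hz
  have hmem : ∀ t ∈ Icc (0 : ℝ) 1, AffineMap.lineMap (κ y) (κ z) t ∈ D := fun t ht =>
    h.convex.lineMap_mem hκy hκz ht
  have hmS : MapsTo (fun t : ℝ => ψ (AffineMap.lineMap (κ y) (κ z) t)) (Icc 0 1) S :=
    fun t ht => h.subset (h.mapsTo_param (hmem t ht))
  choose! v hv hvn using fun (t : ℝ) (ht : t ∈ Icc (0 : ℝ) 1) => h.exists_hasDerivAt hκy hκz ht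
  set γ : ℝ → Euc d := fun t => ψ (AffineMap.lineMap (κ y) (κ z) t) with hγ
  have hγc : ContinuousOn γ (Icc 0 1) := fun t ht => (hv t ht).continuousAt.continuousWithinAt
  have h1 := enorm_sub_sq_le_lintegral (zero_le_one' ℝ) (u := fun t => φ (γ t))
    (u' := fun t => inner ℝ (g (γ t)) (v t)) (h := fun t => (L * Δ) * ‖g (γ t)‖)
    (fun t ht => (hφ.1 _ (hmS ht)).comp_hasDerivWithinAt (hv t ht).hasDerivWithinAt hmS)
    (continuousOn_const.mul (hφ.2.comp hγc hmS).norm)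
    (fun t ht => by
      refine (abs_real_inner_le_norm _ _).trans ?_
      rw [mul_comm]
      gcongr
      exact (hvn t ht).trans (by gcongr; exact hΔ _ hκy _ hκz))
  have e0 : γ 0 = y := by simp [hγ, h.left_inv y hy]
  have e1 : γ 1 = z := by simp [hγ, h.left_inv z hz]
  simp only [e0, e1, sub_zero, ENNReal.ofReal_one, one_mul] at h1
  refine h1.trans_eq ?_
  rw [← lintegral_const_mul' _ _ (ENNReal.pow_ne_top enorm_ne_top)]
  refine setLIntegral_congr_fun measurableSet_Icc fun t ht => ?_
  rw [indicator_of_mem (hmS ht), enorm_mul, mul_pow, enorm_norm]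

/-- The segment maps of a patch distort measures boundedly. -/
theorem IsPatch.setLIntegral_lineMap_le (h : IsPatch S U D κ ψ L) {F : Euc d → ℝ≥0∞}
    (hF : Measurable F) {y : Euc d} (hy : y ∈ U) {t : ℝ} (ht : t ∈ Icc (1 / 2 : ℝ) 1) :
    ∫⁻ z in U, F (ψ (AffineMap.lineMap (κ y) (κ z) t)) ∂(μHE[r] : Measure (Euc d)) ≤
      ((2 * L ^ 2 : ℝ≥0) : ℝ≥0∞) ^ r * ∫⁻ z in U, F z ∂(μHE[r] : Measure (Euc d)) := by
  have ht0 : (0 : ℝ) < t := lt_of_lt_of_le (by norm_num) ht.1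
  have htI : t ∈ Icc (0 : ℝ) 1 := ⟨ht0.le, ht.2⟩
  have hκm := h.measurable_coord
  refine setLIntegral_comp_le_of_antilipschitzOn
    (h := fun z => ψ (AffineMap.lineMap (κ y) (κ z) t)) ?_ ?_ ?_ hF
  · refine h.measurable_param.comp ?_
    simp only [AffineMap.lineMap_apply_module]
    fun_prop
  · exact fun z hz => h.mapsTo_param (h.convex.lineMap_mem (h.mapsTo_coord hy)
      (h.mapsTo_coord hz) htI)
  · intro z hz z' hz'
    have hp := h.convex.lineMap_mem (h.mapsTo_coord hy) (h.mapsTo_coord hz) htI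
    have hp' := h.convex.lineMap_mem (h.mapsTo_coord hy) (h.mapsTo_coord hz') htI
    set p := AffineMap.lineMap (κ y) (κ z) t with hpdef
    set p' := AffineMap.lineMap (κ y) (κ z') t with hp'def
    have h1 : dist z z' ≤ L * dist (κ z) (κ z') := by
      have := h.lipschitz_param.dist_le_mul _ (h.mapsTo_coord hz) _ (h.mapsTo_coord hz')
      rwa [h.left_inv z hz, h.left_inv z' hz'] at this
    have h2 : dist p p' ≤ L * dist (ψ p) (ψ p') := by
      have := h.lipschitz_coord.dist_le_mul _ (h.mapsTo_param hp) _ (h.mapsTo_param hp')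
      rwa [h.right_inv p hp, h.right_inv p' hp'] at this
    have h3 : dist p p' = t * dist (κ z) (κ z') := by
      rw [hpdef, hp'def, AffineMap.lineMap_apply_module, AffineMap.lineMap_apply_module,
        dist_add_left, dist_smul₀, Real.norm_of_nonneg ht0.le]
    -- The bound `1 / 2 ≤ t` prevents the segment map from collapsing towards `y`; it produces the
    -- factor `2` in `2 * L ^ 2`.
    have h4 : dist (κ z) (κ z') ≤ 2 * (L * dist (ψ p) (ψ p')) := by
      have : 1 / 2 * dist (κ z) (κ z') ≤ t * dist (κ z) (κ z') := by gcongr; exact ht.1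
      linarith
    calc dist z z' ≤ L * dist (κ z) (κ z') := h1
      _ ≤ L * (2 * (L * dist (ψ p) (ψ p'))) := by gcongr
      _ = _ := by push_cast; ring

theorem IsPatch.measurable_comp_lineMap (h : IsPatch S U D κ ψ L) {F : Euc d → ℝ≥0∞}
    (hF : Measurable F) : Measurable fun q : (Euc d × Euc d) × ℝ =>
      F (ψ (AffineMap.lineMap (κ q.1.1) (κ q.1.2) q.2)) := by
  refine hF.comp (h.measurable_param.comp ?_)
  simp only [AffineMap.lineMap_apply_module]
  have h1 : Measurable fun q : (Euc d × Euc d) × ℝ => κ q.1.1 :=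
    h.measurable_coord.comp (measurable_fst.comp measurable_fst)
  have h2 : Measurable fun q : (Euc d × Euc d) × ℝ => κ q.1.2 :=
    h.measurable_coord.comp (measurable_snd.comp measurable_fst)
  exact ((measurable_const.sub measurable_snd).smul h1).add (measurable_snd.smul h2)

-- On a segment from `y` to `z`, the point at time `t` depends nondegenerately on `z` when t ≥ 1/2
-- and on `y` when t ≤ 1/2. The inner integration variable is chosen accordingly for each `t`.
omit S U D κ ψ L in
theorem lintegral_lintegral_Icc_le {α : Type*} [MeasurableSpace α] {ν : Measure α}
    [IsFiniteMeasure ν] {N : (α × α) × ℝ → ℝ≥0∞} (hN : Measurable N) {Q : ℝ≥0∞}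
    (h1 : ∀ t ∈ Icc (1 / 2 : ℝ) 1, ∀ᵐ y ∂ν, ∫⁻ z, N ((y, z), t) ∂ν ≤ Q)
    (h2 : ∀ t ∈ Icc (0 : ℝ) (1 / 2), ∀ᵐ z ∂ν, ∫⁻ y, N ((y, z), t) ∂ν ≤ Q) :
    ∫⁻ y, ∫⁻ z, (∫⁻ t in Icc (0 : ℝ) 1, N ((y, z), t)) ∂ν ∂ν ≤ Q * ν univ := by
  have hIt : ∀ t ∈ Icc (0 : ℝ) 1, ∫⁻ p, N (p, t) ∂(ν.prod ν) ≤ Q * ν univ := by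
    intro t ht
    have hmt : Measurable fun p : α × α => N (p, t) := hN.comp measurable_prodMk_right
    rw [← lintegral_const]
    rcases le_total (1 / 2) t with h | h
    · rw [lintegral_prod _ hmt.aemeasurable]
      exact lintegral_mono_ae (h1 t ⟨h, ht.2⟩)
    · rw [lintegral_prod_symm _ hmt.aemeasurable]
      exact lintegral_mono_ae (h2 t ⟨ht.1, h⟩)
  rw [← lintegral_prod (fun p : α × α => ∫⁻ t in Icc (0 : ℝ) 1, N (p, t))
    hN.lintegral_prod_right'.aemeasurable,
    lintegral_lintegral_swap (f := fun p t => N (p, t)) hN.aemeasurable]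
  refine (setLIntegral_mono measurable_const hIt).trans_eq ?_
  rw [lintegral_const, Measure.restrict_apply_univ, Real.volume_Icc]
  simp

/-- The double integral over a patch of the path integrals of a function along the segments of the
patch is controlled by the integral of the function. -/
theorem IsPatch.lintegral_prod_lineMap_le (h : IsPatch S U D κ ψ L)
    [IsFiniteMeasure ((μHE[r] : Measure (Euc d)).restrict U)] {F : Euc d → ℝ≥0∞}
    (hF : Measurable F) :
    ∫⁻ y in U, ∫⁻ z in U, (∫⁻ t in Icc (0 : ℝ) 1, F (ψ (AffineMap.lineMap (κ y) (κ z) t)))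
        ∂(μHE[r] : Measure (Euc d)) ∂(μHE[r] : Measure (Euc d)) ≤
      ((2 * L ^ 2 : ℝ≥0) : ℝ≥0∞) ^ r * (∫⁻ z in U, F z ∂(μHE[r] : Measure (Euc d))) *
        (μHE[r] : Measure (Euc d)) U := by
  have hUae : ∀ᵐ y ∂((μHE[r] : Measure (Euc d)).restrict U), y ∈ U :=
    ae_restrict_mem h.measurableSet
  have key := lintegral_lintegral_Icc_le (h.measurable_comp_lineMap hF)
    (fun t ht => hUae.mono fun y hy => h.setLIntegral_lineMap_le (r := r) hF hy ht)
    (fun t ht => hUae.mono fun y hy => by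
      have h3 := h.setLIntegral_lineMap_le (r := r) hF hy (t := 1 - t)
        ⟨by linarith [ht.2], by linarith [ht.1]⟩
      simp only [AffineMap.lineMap_apply_one_sub] at h3
      exact h3)
  rwa [Measure.restrict_apply_univ] at key

/-- Poincaré inequality on a patch: the `L²` norm on the patch is controlled by that on a subset of
positive measure and by the gradient. -/
theorem IsPatch.poincare (h : IsPatch S U D κ ψ L) (hS : MeasurableSet S)
    (hD : Bornology.IsBounded D) (hU : (μHE[r] : Measure (Euc d)) U < ∞) {W : Set (Euc d)}
    (hWU : W ⊆ U) (hWm : MeasurableSet W) (hW : 0 < (μHE[r] : Measure (Euc d)) W) :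
    ∃ C : ℝ≥0∞, C ≠ ∞ ∧ ∀ φ g, IsC1WithGradient S φ g →
      ∫⁻ x in U, ‖φ x‖ₑ ^ 2 ∂(μHE[r] : Measure (Euc d)) ≤
        C * (∫⁻ x in W, ‖φ x‖ₑ ^ 2 ∂(μHE[r] : Measure (Euc d)) +
          ∫⁻ x in S, ‖g x‖ₑ ^ 2 ∂(μHE[r] : Measure (Euc d))) := by
  obtain ⟨Δ, hΔ⟩ : ∃ Δ : ℝ, ∀ a ∈ D, ∀ b ∈ D, ‖b - a‖ ≤ Δ := by
    obtain ⟨Δ, hΔ⟩ := Metric.isBounded_iff.1 hD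
    exact ⟨Δ, fun a ha b hb => by rw [← dist_eq_norm]; exact hΔ hb ha⟩
  set μ : Measure (Euc d) := μHE[r] with hμ
  have : IsFiniteMeasure (μ.restrict U) := ⟨by rwa [Measure.restrict_apply_univ]⟩
  set c : ℝ≥0∞ := ‖L * Δ‖ₑ ^ 2 with hc
  set Q : ℝ≥0∞ := ((2 * L ^ 2 : ℝ≥0) : ℝ≥0∞) ^ r with hQ
  have hWfin : μ W ≠ ∞ := ((measure_mono hWU).trans_lt hU).ne
  refine ⟨(μ W)⁻¹ * (2 * μ U + 2 * c * Q * μ U), ?_, fun φ g hφ => ?_⟩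
  · refine ENNReal.mul_ne_top (ENNReal.inv_ne_top.2 hW.ne') (ENNReal.add_ne_top.2 ⟨?_, ?_⟩)
    · exact ENNReal.mul_ne_top (by simp) hU.ne
    · exact ENNReal.mul_ne_top (ENNReal.mul_ne_top (ENNReal.mul_ne_top (by simp)
        (by rw [hc]; finiteness)) (by rw [hQ]; finiteness)) hU.ne
  -- Only the values on `S` are controlled; the indicator gives a function measurable on the whole
  -- space.
  set F : Euc d → ℝ≥0∞ := S.indicator fun x => ‖g x‖ₑ ^ 2 with hFdef
  set f : Euc d → ℝ≥0∞ := S.indicator fun x => ‖φ x‖ₑ ^ 2 with hfdef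
  have hFm : Measurable F := hφ.2.measurable_indicator_enorm_sq hS
  have hfm : Measurable f := hφ.continuousOn.measurable_indicator_enorm_sq hS
  have hfU : ∀ x ∈ U, f x = ‖φ x‖ₑ ^ 2 := fun x hx => indicator_of_mem (h.subset hx) _
  set G := ∫⁻ x in U, F x ∂μ with hG
  have hGle : G ≤ ∫⁻ x in S, ‖g x‖ₑ ^ 2 ∂μ := by
    rw [hG, hFdef, setLIntegral_indicator hS]
    exact lintegral_mono_set inter_subset_left
  let N : (Euc d × Euc d) → ℝ → ℝ≥0∞ := fun p t => F (ψ (AffineMap.lineMap (κ p.1) (κ p.2) t))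
  have hII := h.lintegral_prod_lineMap_le (r := r) hFm
  have hIm : Measurable fun p => ∫⁻ t in Icc (0 : ℝ) 1, N p t :=
    (h.measurable_comp_lineMap hFm).lintegral_prod_right'
  have hpt : ∀ y ∈ U, ∀ z ∈ U, f z ≤ 2 * f y + 2 * c * ∫⁻ t in Icc (0 : ℝ) 1, N (y, z) t := by
    intro y hy z hz
    have h1 := h.enorm_sub_sq_le hΔ hφ hy hz
    rw [hfU z hz, hfU y hy, mul_assoc, ← mul_add]
    have h2 : ‖φ z‖ₑ ≤ ‖φ y‖ₑ + ‖φ z - φ y‖ₑ := by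
      simpa using enorm_add_le (φ y) (φ z - φ y)
    have h3 : (‖φ y‖ₑ + ‖φ z - φ y‖ₑ) ^ 2 ≤ 2 * (‖φ y‖ₑ ^ 2 + ‖φ z - φ y‖ₑ ^ 2) := by
      have := ENNReal.rpow_add_le_mul_rpow_add_rpow ‖φ y‖ₑ ‖φ z - φ y‖ₑ (p := 2) (by norm_num)
      norm_num at this
      exact this
    refine (pow_le_pow_left' h2 2).trans (h3.trans ?_)
    gcongr
  -- Integrate `hpt` over `y` in `W` and `z` in `U`, enlarging `W` to `U` in the path term only; the
  -- positive measure of `W` is then divided out.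
  have hmain : μ W * ∫⁻ z in U, f z ∂μ ≤
      2 * μ U * ∫⁻ y in W, f y ∂μ + 2 * c * (Q * G * μ U) := by
    calc μ W * ∫⁻ z in U, f z ∂μ = ∫⁻ y in W, ∫⁻ z in U, f z ∂μ ∂μ := by
          rw [lintegral_const, Measure.restrict_apply_univ, mul_comm]
      _ ≤ ∫⁻ y in W, (2 * μ U * f y +
            2 * c * ∫⁻ z in U, (∫⁻ t in Icc (0 : ℝ) 1, N (y, z) t) ∂μ) ∂μ := by
          refine setLIntegral_mono' hWm fun y hy => ?_
          refine (setLIntegral_mono' h.measurableSet fun z hz => hpt y (hWU hy) z hz).trans_eq ?_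
          have hIy : Measurable fun z => ∫⁻ t in Icc (0 : ℝ) 1, N (y, z) t :=
            hIm.comp measurable_prodMk_left
          rw [lintegral_add_left measurable_const, lintegral_const, Measure.restrict_apply_univ,
            lintegral_const_mul _ hIy]
          congr 1
          ring
      _ = 2 * μ U * ∫⁻ y in W, f y ∂μ +
            2 * c * ∫⁻ y in W, ∫⁻ z in U, (∫⁻ t in Icc (0 : ℝ) 1, N (y, z) t) ∂μ ∂μ := by
          rw [lintegral_add_left (hfm.const_mul _), lintegral_const_mul _ hfm,
            lintegral_const_mul _ hIm.lintegral_prod_right']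
      _ ≤ 2 * μ U * ∫⁻ y in W, f y ∂μ +
            2 * c * ∫⁻ y in U, ∫⁻ z in U, (∫⁻ t in Icc (0 : ℝ) 1, N (y, z) t) ∂μ ∂μ := by
          gcongr
      _ ≤ _ := by
          gcongr
  have e1 : ∫⁻ x in U, ‖φ x‖ₑ ^ 2 ∂μ = ∫⁻ z in U, f z ∂μ :=
    (setLIntegral_congr_fun h.measurableSet hfU).symm
  have e2 : ∫⁻ x in W, ‖φ x‖ₑ ^ 2 ∂μ = ∫⁻ z in W, f z ∂μ :=
    (setLIntegral_congr_fun hWm fun x hx => hfU x (hWU hx)).symm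
  rw [e1, e2]
  set I := ∫⁻ z in W, f z ∂μ
  set J := ∫⁻ x in S, ‖g x‖ₑ ^ 2 ∂μ
  calc ∫⁻ z in U, f z ∂μ = (μ W)⁻¹ * (μ W * ∫⁻ z in U, f z ∂μ) := by
        rw [← mul_assoc, ENNReal.inv_mul_cancel hW.ne' hWfin, one_mul]
    _ ≤ (μ W)⁻¹ * (2 * μ U * I + 2 * c * (Q * G * μ U)) := by gcongr
    _ ≤ (μ W)⁻¹ * (2 * μ U * (I + J) + 2 * c * (Q * (I + J) * μ U)) := by
        gcongr
        · exact le_self_add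
        · exact hGle.trans le_add_self
    _ = _ := by ring

end LocalPoincare

/-! ### Poincaré inequality on a patch with a face in the boundary. -/

section BoundaryPoincare

variable {d r : ℕ} {S U D : Set (Euc d)} {κ ψ : Euc d → Euc d} {L : ℝ≥0}

/-- Decreasing a nonnegative coordinate towards `0` stays in the corner ball centered at a point of
the corresponding face. -/
theorem sub_smul_single_mem_ball_inter_cornerModel {z₀ a : Euc d} {ε : ℝ} {i : Fin d}
    (hi : (i : ℕ) < r) (hz₀ : z₀ i = 0) (ha : a ∈ Metric.ball z₀ ε ∩ cornerModel d r) {τ : ℝ}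
    (hτ : τ ∈ Icc 0 (a i)) :
    a - τ • EuclideanSpace.single i (1 : ℝ) ∈ Metric.ball z₀ ε ∩ cornerModel d r := by
  have hcoord : ∀ j, (a - τ • EuclideanSpace.single i (1 : ℝ)) j = if j = i then a i - τ else a j := by
    intro j
    by_cases h : j = i
    · subst h; simp
    · simp [h]
  refine ⟨?_, fun j => ?_⟩
  · refine lt_of_le_of_lt ?_ (Metric.mem_ball.1 ha.1)
    rw [EuclideanSpace.dist_eq, EuclideanSpace.dist_eq]
    refine Real.sqrt_le_sqrt (Finset.sum_le_sum fun j _ => ?_)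
    rw [hcoord]
    split_ifs with h
    · subst h
      rw [Real.dist_eq, Real.dist_eq, sq_abs, sq_abs, hz₀]
      nlinarith [hτ.1, hτ.2]
    · exact le_rfl
  · rw [hcoord]
    split_ifs with h
    · subst h
      exact ⟨fun _ => sub_nonneg.2 hτ.2, fun h => absurd hi (not_lt.2 h)⟩
    · exact ha.2 j

/-- Pointwise bound of a function vanishing on a face of a patch by its gradient. -/
theorem IsPatch.enorm_sq_le_of_face {z₀ : Euc d} {ε : ℝ}
    (h : IsPatch S U (Metric.ball z₀ ε ∩ cornerModel d r) κ ψ L) {i : Fin d} (hi : (i : ℕ) < r)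
    (hz₀ : z₀ i = 0) {φ : Euc d → ℝ} {g : Euc d → Euc d} (hφ : IsC1WithGradient S φ g)
    (hφ0 : ∀ z ∈ Metric.ball z₀ ε ∩ cornerModel d r, z i = 0 → φ (ψ z) = 0) {z : Euc d}
    (hz : z ∈ U) :
    ‖φ z‖ₑ ^ 2 ≤ ENNReal.ofReal ε * ((L : ℝ≥0∞) ^ 2 * ∫⁻ τ in Icc (0 : ℝ) ε,
      {τ | τ ≤ κ z i}.indicator (fun τ => S.indicator (fun x => ‖g x‖ₑ ^ 2)
        (ψ (κ z - τ • EuclideanSpace.single i (1 : ℝ)))) τ) := by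
  set e : Euc d := EuclideanSpace.single i (1 : ℝ) with he
  have hen : ‖e‖ = 1 := by simp [he]
  have hκ := h.mapsTo_coord hz
  have hs0 : 0 ≤ κ z i := (hκ.2 i).1 hi
  -- The distance to the face is at most the radius of the ball, so all paths fit in the fixed
  -- interval `Icc 0 ε`, with an indicator cutting each at its length.
  have hsε : κ z i ≤ ε := by
    have h1 : ‖(κ z - z₀) i‖ ≤ ‖κ z - z₀‖ := PiLp.norm_apply_le _ i
    have h2 : ‖κ z - z₀‖ < ε := by rw [← dist_eq_norm]; exact hκ.1
    have h3 : (κ z - z₀) i = κ z i := by rw [PiLp.sub_apply, hz₀, sub_zero]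
    rw [h3] at h1
    exact (le_abs_self _).trans (h1.trans h2.le)
  have hmem : ∀ τ ∈ Icc 0 (κ z i), κ z - τ • e ∈ Metric.ball z₀ ε ∩ cornerModel d r :=
    fun τ hτ => sub_smul_single_mem_ball_inter_cornerModel hi hz₀ hκ hτ
  -- The path starts at `z` and reaches the face, where `φ` vanishes, at time `κ z i`.
  set γ : ℝ → Euc d := fun τ => ψ (κ z - τ • e) with hγ
  have hγS : MapsTo γ (Icc 0 (κ z i)) S := fun τ hτ => h.subset (h.mapsTo_param (hmem τ hτ))
  have hder : ∀ τ ∈ Icc 0 (κ z i), ∃ v, HasDerivAt γ v τ ∧ ‖v‖ ≤ L := by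
    intro τ hτ
    obtain ⟨ψ', hψ', hn⟩ := h.exists_fderiv _ (hmem τ hτ)
    have h1 : HasDerivAt (fun τ : ℝ => κ z - τ • e) (-((1 : ℝ) • e)) τ :=
      ((hasDerivAt_id τ).smul_const e).const_sub _
    refine ⟨_, hψ'.comp_hasDerivAt τ h1, ?_⟩
    refine (ψ'.le_opNorm _).trans ?_
    rw [one_smul, norm_neg, hen, mul_one]
    exact hn
  choose! v hv hvn using hder
  have hγc : ContinuousOn γ (Icc 0 (κ z i)) := fun t ht => (hv t ht).continuousAt.continuousWithinAt
  have h1 := enorm_sub_sq_le_lintegral hs0 (u := fun t => φ (γ t))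
    (u' := fun t => inner ℝ (g (γ t)) (v t)) (h := fun t => L * ‖g (γ t)‖)
    (fun t ht => (hφ.1 _ (hγS ht)).comp_hasDerivWithinAt (hv t ht).hasDerivWithinAt hγS)
    (continuousOn_const.mul (hφ.2.comp hγc hγS).norm)
    (fun t ht => by
      refine (abs_real_inner_le_norm _ _).trans ?_
      rw [mul_comm]
      gcongr
      exact hvn t ht)
  have e0 : γ 0 = z := by simp [hγ, h.left_inv z hz]
  have e1 : φ (γ (κ z i)) = 0 := hφ0 _ (hmem _ ⟨hs0, le_rfl⟩) (by simp [he])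
  rw [e1, e0, zero_sub, enorm_neg, sub_zero] at h1
  refine h1.trans ?_
  gcongr
  rw [← lintegral_const_mul' _ _ (ENNReal.pow_ne_top ENNReal.coe_ne_top)]
  calc ∫⁻ t in Icc 0 (κ z i), ‖(L : ℝ) * ‖g (γ t)‖‖ₑ ^ 2
      = ∫⁻ t in Icc 0 (κ z i), (L : ℝ≥0∞) ^ 2 * {τ | τ ≤ κ z i}.indicator
          (fun τ => S.indicator (fun x => ‖g x‖ₑ ^ 2) (γ τ)) t := by
        refine setLIntegral_congr_fun measurableSet_Icc fun t ht => ?_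
        have ht' : t ∈ {τ | τ ≤ κ z i} := ht.2
        rw [indicator_of_mem ht', indicator_of_mem (hγS ht), enorm_mul, mul_pow, enorm_norm]
        congr 2
        exact Real.enorm_eq_ofReal L.2 |>.trans ENNReal.ofReal_coe_nnreal
    _ ≤ _ := lintegral_mono_set (Icc_subset_Icc_right hsε)

/-- The map decreasing a coordinate in a patch does not contract distances too much. -/
theorem IsPatch.setLIntegral_shift_le {z₀ : Euc d} {ε : ℝ}
    (h : IsPatch S U (Metric.ball z₀ ε ∩ cornerModel d r) κ ψ L) {i : Fin d} (hi : (i : ℕ) < r)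
    (hz₀ : z₀ i = 0) {F : Euc d → ℝ≥0∞} (hF : Measurable F) {τ : ℝ} (hτ : 0 ≤ τ) :
    ∫⁻ z in U ∩ {z | τ ≤ κ z i}, F (ψ (κ z - τ • EuclideanSpace.single i (1 : ℝ)))
        ∂(μHE[r] : Measure (Euc d)) ≤
      ((L * L : ℝ≥0) : ℝ≥0∞) ^ r * ∫⁻ z in U, F z ∂(μHE[r] : Measure (Euc d)) := by
  have hmem : ∀ z ∈ U ∩ {z | τ ≤ κ z i}, κ z - τ • EuclideanSpace.single i (1 : ℝ) ∈
      Metric.ball z₀ ε ∩ cornerModel d r := fun z hz =>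
    sub_smul_single_mem_ball_inter_cornerModel hi hz₀ (h.mapsTo_coord hz.1) ⟨hτ, hz.2⟩
  refine setLIntegral_comp_le_of_antilipschitzOn
    (h := fun z => ψ (κ z - τ • EuclideanSpace.single i (1 : ℝ))) ?_ ?_ ?_ hF
  · exact h.measurable_param.comp (h.measurable_coord.sub_const _)
  · exact fun z hz => h.mapsTo_param (hmem z hz)
  · intro z hz z' hz'
    have h1 := h.lipschitz_param.dist_le_mul _ (h.mapsTo_coord hz.1) _ (h.mapsTo_coord hz'.1)
    rw [h.left_inv z hz.1, h.left_inv z' hz'.1] at h1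
    have h2 := h.lipschitz_coord.dist_le_mul _ (h.mapsTo_param (hmem z hz)) _
      (h.mapsTo_param (hmem z' hz'))
    rw [h.right_inv _ (hmem z hz), h.right_inv _ (hmem z' hz'), dist_sub_right] at h2
    rw [NNReal.coe_mul, mul_assoc]
    exact h1.trans (by gcongr)

/-- Poincaré inequality on a patch around a boundary point, for functions vanishing on the
boundary. -/
theorem IsPatch.poincare_of_face {z₀ : Euc d} {ε : ℝ} (hr : r ≤ d)
    (h : IsPatch S U (Metric.ball z₀ ε ∩ cornerModel d r) κ ψ L) (hS : MeasurableSet S)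
    {i : Fin d} (hi : (i : ℕ) < r) (hz₀ : z₀ i = 0) {φ : Euc d → ℝ} {g : Euc d → Euc d}
    (hφ : IsC1WithGradient S φ g)
    (hφ0 : ∀ z ∈ Metric.ball z₀ ε ∩ cornerModel d r, z i = 0 → φ (ψ z) = 0) :
    ∫⁻ x in U, ‖φ x‖ₑ ^ 2 ∂(μHE[r] : Measure (Euc d)) ≤
      ENNReal.ofReal ε * ((L : ℝ≥0∞) ^ 2 * (((L * L : ℝ≥0) : ℝ≥0∞) ^ r * ENNReal.ofReal ε)) *
        ∫⁻ x in S, ‖g x‖ₑ ^ 2 ∂(μHE[r] : Measure (Euc d)) := by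
  set F : Euc d → ℝ≥0∞ := S.indicator fun x => ‖g x‖ₑ ^ 2 with hFdef
  have hFm : Measurable F := hφ.2.measurable_indicator_enorm_sq hS
  have hGle : ∫⁻ x in U, F x ∂(μHE[r] : Measure (Euc d)) ≤
      ∫⁻ x in S, ‖g x‖ₑ ^ 2 ∂(μHE[r] : Measure (Euc d)) := by
    rw [hFdef, setLIntegral_indicator hS]
    exact lintegral_mono_set inter_subset_left
  have hfin : IsFiniteMeasure ((μHE[r] : Measure (Euc d)).restrict U) :=
    ⟨by rw [Measure.restrict_apply_univ]; exact h.measure_lt_top hr⟩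
  set e : Euc d := EuclideanSpace.single i (1 : ℝ) with he
  have hκi : Measurable fun z => κ z i :=
    (EuclideanSpace.proj (𝕜 := ℝ) i).continuous.measurable.comp h.measurable_coord
  let N : Euc d → ℝ → ℝ≥0∞ := fun z τ =>
    {τ | τ ≤ κ z i}.indicator (fun τ => F (ψ (κ z - τ • e))) τ
  have hNm : Measurable (Function.uncurry N) := by
    have h1 : MeasurableSet {q : Euc d × ℝ | q.2 ≤ κ q.1 i} :=
      measurableSet_le measurable_snd (hκi.comp measurable_fst)
    have h3 : Measurable fun q : Euc d × ℝ => κ q.1 - q.2 • e :=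
      (h.measurable_coord.comp measurable_fst).sub (measurable_snd.smul_const e)
    have h2 : Measurable fun q : Euc d × ℝ => F (ψ (κ q.1 - q.2 • e)) :=
      hFm.comp (h.measurable_param.comp h3)
    have h4 := h2.indicator h1
    exact h4
  -- For fixed `τ` the shift is a translation in the chart, so it distorts measure by at most `(L *
  -- L) ^ r`; Tonelli then integrates over `τ`.
  have hInt : ∀ τ ∈ Icc 0 ε, ∫⁻ z in U, N z τ ∂(μHE[r] : Measure (Euc d)) ≤
      ((L * L : ℝ≥0) : ℝ≥0∞) ^ r * ∫⁻ x in S, ‖g x‖ₑ ^ 2 ∂(μHE[r] : Measure (Euc d)) := by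
    intro τ hτ
    have hset : MeasurableSet {z | τ ≤ κ z i} := measurableSet_le measurable_const hκi
    have h1 : ∀ z, N z τ = {z | τ ≤ κ z i}.indicator (fun z => F (ψ (κ z - τ • e))) z :=
      fun z => rfl
    simp_rw [h1]
    rw [setLIntegral_indicator hset, inter_comm]
    exact (h.setLIntegral_shift_le hi hz₀ hFm hτ.1).trans (by gcongr)
  calc ∫⁻ x in U, ‖φ x‖ₑ ^ 2 ∂(μHE[r] : Measure (Euc d))
      ≤ ∫⁻ z in U, ENNReal.ofReal ε * ((L : ℝ≥0∞) ^ 2 * ∫⁻ τ in Icc (0 : ℝ) ε, N z τ)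
          ∂(μHE[r] : Measure (Euc d)) :=
        setLIntegral_mono' h.measurableSet fun z hz => h.enorm_sq_le_of_face hi hz₀ hφ hφ0 hz
    _ = ENNReal.ofReal ε * ((L : ℝ≥0∞) ^ 2 * ∫⁻ τ in Icc (0 : ℝ) ε, ∫⁻ z in U, N z τ
          ∂(μHE[r] : Measure (Euc d))) := by
        rw [lintegral_const_mul' _ _ ENNReal.ofReal_ne_top,
          lintegral_const_mul' _ _ (ENNReal.pow_ne_top ENNReal.coe_ne_top),
          lintegral_lintegral_swap hNm.aemeasurable]
    _ ≤ ENNReal.ofReal ε * ((L : ℝ≥0∞) ^ 2 * ∫⁻ _ in Icc (0 : ℝ) ε,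
          ((L * L : ℝ≥0) : ℝ≥0∞) ^ r * ∫⁻ x in S, ‖g x‖ₑ ^ 2 ∂(μHE[r] : Measure (Euc d))) := by
        gcongr ENNReal.ofReal ε * ((L : ℝ≥0∞) ^ 2 * ?_)
        exact setLIntegral_mono measurable_const hInt
    _ = _ := by
        rw [lintegral_const, Measure.restrict_apply_univ, Real.volume_Icc, sub_zero]
        ring

end BoundaryPoincare

/-! ### Global Poincaré inequality by connectedness. -/

section GlobalPoincare

variable {d r : ℕ} {S : Set (Euc d)}

/-- The set `O` satisfies a Poincaré inequality for the test functions on `S`. -/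
def PoincareOn (r : ℕ) (S O : Set (Euc d)) : Prop :=
  ∃ C : ℝ≥0∞, C ≠ ∞ ∧ ∀ φ g, IsTestFunction r S φ g →
    ∫⁻ x in S ∩ O, ‖φ x‖ₑ ^ 2 ∂(μHE[r] : Measure (Euc d)) ≤
      C * ∫⁻ x in S, ‖g x‖ₑ ^ 2 ∂(μHE[r] : Measure (Euc d))

theorem PoincareOn.mono {O O' : Set (Euc d)} (h : PoincareOn r S O') (hO : O ⊆ O') :
    PoincareOn r S O := by
  obtain ⟨C, hC, hφ⟩ := h
  exact ⟨C, hC, fun φ g hg =>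
    (lintegral_mono_set (inter_subset_inter_right _ hO)).trans (hφ φ g hg)⟩

theorem PoincareOn.union {O O' : Set (Euc d)} (h : PoincareOn r S O) (h' : PoincareOn r S O') :
    PoincareOn r S (O ∪ O') := by
  obtain ⟨C, hC, hφ⟩ := h
  obtain ⟨C', hC', hφ'⟩ := h'
  refine ⟨C + C', ENNReal.add_ne_top.2 ⟨hC, hC'⟩, fun φ g hg => ?_⟩
  rw [inter_union_distrib_left, add_mul]
  exact (lintegral_union_le _ _ _).trans (add_le_add (hφ φ g hg) (hφ' φ g hg))

/-- The closedness half of the connectedness argument: a patch at `x` meets a good open set in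
positive measure, and the patch inequality spreads the bound from there to the whole patch. -/
theorem PoincareOn.of_mem_closure (hS : IsCompactEmbeddedManifold r S) {x : Euc d} (hx : x ∈ S)
    (hcl : x ∈ closure (S ∩ {y | ∃ O, IsOpen O ∧ y ∈ O ∧ PoincareOn r S O})) :
    ∃ O, IsOpen O ∧ x ∈ O ∧ PoincareOn r S O := by
  obtain ⟨ε, L, κ, ψ, O, hε, hO, hxO, hκx, h⟩ := hS.exists_isPatch hx
  obtain ⟨y, hyO, hyS, O', hO', hyO', C', hC', hP⟩ := mem_closure_iff.1 hcl O hO hxO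
  have hSm := hS.isCompact.isClosed.measurableSet
  have hpos := hS.measure_inter_pos hyS (hO.inter hO') ⟨hyO, hyO'⟩
  obtain ⟨C, hC, hle⟩ := h.poincare (r := r) hSm (Metric.isBounded_ball.subset inter_subset_left)
    (h.measure_lt_top hS.dim_le) (W := S ∩ (O ∩ O'))
    (inter_subset_inter_right _ inter_subset_left)
    (hSm.inter (hO.inter hO').measurableSet) hpos
  refine ⟨O, hO, hxO, C * (C' + 1), ENNReal.mul_ne_top hC (by finiteness), fun φ g hg => ?_⟩
  refine (hle φ g hg.1).trans ?_
  rw [mul_assoc, add_mul, one_mul]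
  gcongr
  exact (lintegral_mono_set (inter_subset_inter_right _ inter_subset_right)).trans (hP φ g hg)

/-- The chart exhibiting `x` as a boundary point exhibits every point of the face through `x` as
one, so test functions vanish on that face. -/
theorem PoincareOn.of_mem_manifoldBoundary (hS : IsCompactEmbeddedManifold r S) {x : Euc d}
    (hx : x ∈ manifoldBoundary r S) : ∃ O, IsOpen O ∧ x ∈ O ∧ PoincareOn r S O := by
  obtain ⟨hxS, Φ, hΦ, hxΦ, i, hi, hxi⟩ := hx
  obtain ⟨ε, L, κ, ψ, O, hε, hO, hxO, -, -, hbt, hψ, h⟩ :=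
    hΦ.exists_isPatch hS.isCompact.isClosed hxΦ
  refine ⟨O, hO, hxO, _, ?_, fun φ g hg => h.poincare_of_face hS.dim_le
    hS.isCompact.isClosed.measurableSet hi hxi hg.1 fun z hz hzi => ?_⟩
  · finiteness
  · obtain ⟨-, K, -, hKS, hK⟩ := hg
    have hzS : ψ z ∈ S := h.subset (h.mapsTo_param hz)
    refine hK _ ⟨hzS, fun hzK => (hKS hzK).2 ⟨hzS, Φ, hΦ, ?_, i, hi, ?_⟩⟩
    · rw [hψ z hz.1]; exact Φ.map_target (hbt hz.1)
    · rw [hψ z hz.1, Φ.right_inv (hbt hz.1)]; exact hzi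

/-- **Poincaré inequality** for the test functions on a compact manifold with boundary, every
component of which meets the boundary. -/
theorem IsCompactEmbeddedManifold.poincareOn (hS : IsCompactEmbeddedManifold r S)
    (hbd : ∀ x ∈ S, (connectedComponentIn S x ∩ manifoldBoundary r S).Nonempty) :
    PoincareOn r S S := by
  set Z : Set (Euc d) := {y | ∃ O, IsOpen O ∧ y ∈ O ∧ PoincareOn r S O} with hZ
  have hZo : IsOpen Z := by
    refine isOpen_iff_mem_nhds.2 ?_
    rintro y ⟨O, hO, hyO, hP⟩
    exact mem_of_superset (hO.mem_nhds hyO) fun y' hy' => ⟨O, hO, hy', hP⟩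
  have hSZ : S ⊆ Z := by
    intro x hx
    have hsub : ∀ y ∈ connectedComponentIn S x, y ∈ S := connectedComponentIn_subset S x
    have hcl : ∀ y ∈ S, y ∈ closure (S ∩ Z) → y ∈ Z := fun y hy hyc =>
      PoincareOn.of_mem_closure hS hy hyc
    have hcomp : connectedComponentIn S x ⊆ Z := by
      intro y hy
      refine hcl y (hsub y hy) (by_contra fun hyc => ?_)
      obtain ⟨z, hz, hzb⟩ := hbd x hx
      -- These two open sets cover the component and have no common point in `S`; the boundary point
      -- lies in the first, and `y` would lie in the second.
      obtain ⟨w, hw, hwZ, hwc⟩ := isPreconnected_connectedComponentIn Z (closure (S ∩ Z))ᶜ hZo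
        isClosed_closure.isOpen_compl
        (fun w hw => or_iff_not_imp_right.2 fun h => hcl w (hsub w hw) (notMem_compl_iff.1 h))
        ⟨z, hz, PoincareOn.of_mem_manifoldBoundary hS hzb⟩ ⟨y, hy, hyc⟩
      exact hwc (subset_closure ⟨hsub w hw, hwZ⟩)
    exact hcomp (mem_connectedComponentIn hx)
  have := hS.isCompact.induction_on (p := fun s => PoincareOn r S s)
    ⟨0, by simp, fun φ g _ => by simp⟩ (fun s t hst ht => ht.mono hst)
    (fun s t hs ht => hs.union ht) fun x hx => by
      obtain ⟨O, hO, hxO, hP⟩ := hSZ hx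
      exact ⟨O, mem_nhdsWithin_of_mem_nhds (hO.mem_nhds hxO), hP⟩
  exact this

end GlobalPoincare

/-! ### The Hilbert space structure of `H10` given by gradients. -/

section GradientSpace

variable {d r : ℕ} {S : Set (Euc d)}

theorem enorm_Lp_two_sq {α E : Type*} [MeasurableSpace α] {μ : Measure α} [NormedAddCommGroup E]
    (f : Lp E 2 μ) : ‖f‖ₑ ^ 2 = ∫⁻ x, ‖f x‖ₑ ^ 2 ∂μ := by
  have h := eLpNorm_nnreal_pow_eq_lintegral (f := (f : α → E)) (μ := μ) (p := 2) two_ne_zero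
  rw [Lp.enorm_def]
  simpa using h

/-- **Poincaré inequality** on `H¹₀`. -/
theorem IsCompactEmbeddedManifold.exists_norm_fst_le (hS : IsCompactEmbeddedManifold r S)
    (hbd : ∀ x ∈ S, (connectedComponentIn S x ∩ manifoldBoundary r S).Nonempty) :
    ∃ C : ℝ, ∀ u : H10 r S, ‖(u : L2Pair r S).fst‖ ≤ C * ‖(u : L2Pair r S).snd‖ := by
  obtain ⟨C, hC, hP⟩ := hS.poincareOn hbd
  refine ⟨√C.toReal, fun u => ?_⟩
  -- The condition is closed in the `H¹` norm, so test functions suffice.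
  have hcl : IsClosed {z : L2Pair r S | ‖z.fst‖ ≤ √C.toReal * ‖z.snd‖} :=
    isClosed_le (WithLp.fstL 2 ℝ _ _).continuous.norm
      ((WithLp.sndL 2 ℝ _ _).continuous.norm.const_mul _)
  refine closure_minimal ?_ hcl u.2
  rintro z ⟨φ, g, hφ, h1, h2⟩
  have h3 := hP φ g hφ
  rw [inter_self] at h3
  have e1 : ‖z.fst‖ₑ ^ 2 = ∫⁻ x in S, ‖φ x‖ₑ ^ 2 ∂(μHE[r] : Measure (Euc d)) := by
    rw [enorm_Lp_two_sq]
    exact lintegral_congr_ae (h1.mono fun x hx => by simp only [hx])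
  have e2 : ‖z.snd‖ₑ ^ 2 = ∫⁻ x in S, ‖g x‖ₑ ^ 2 ∂(μHE[r] : Measure (Euc d)) := by
    rw [enorm_Lp_two_sq]
    exact lintegral_congr_ae (h2.mono fun x hx => by simp only [hx])
  rw [← e1, ← e2] at h3
  have h4 := ENNReal.toReal_mono (ENNReal.mul_ne_top hC (by finiteness)) h3
  rw [ENNReal.toReal_mul, ENNReal.toReal_pow, ENNReal.toReal_pow, toReal_enorm, toReal_enorm] at h4
  change ‖z.fst‖ ≤ √C.toReal * ‖z.snd‖
  rw [← Real.sqrt_sq (norm_nonneg z.snd), ← Real.sqrt_mul ENNReal.toReal_nonneg]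
  exact Real.le_sqrt_of_sq_le h4

/-- The gradient, as an operator on `H¹₀`. -/
def gradL (r : ℕ) (S : Set (Euc d)) : H10 r S →L[ℝ] Lp (Euc d) 2 (surfaceMeasure r S) :=
  (WithLp.sndL 2 ℝ (Lp ℝ 2 (surfaceMeasure r S)) (Lp (Euc d) 2 (surfaceMeasure r S))) ∘L
    (H10 r S).subtypeL

instance (r : ℕ) (S : Set (Euc d)) : CompleteSpace (H10 r S) :=
  (Submodule.isClosed_topologicalClosure (testGraph r S)).completeSpace_coe

/-- `H¹₀`, with the inner product `∫ ∇u · ∇v`, is a Hilbert space. -/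
theorem IsCompactEmbeddedManifold.exists_gradEquiv (hS : IsCompactEmbeddedManifold r S)
    (hbd : ∀ x ∈ S, (connectedComponentIn S x ∩ manifoldBoundary r S).Nonempty) :
    ∃ (X : Submodule ℝ (Lp (Euc d) 2 (surfaceMeasure r S))) (e : H10 r S ≃L[ℝ] X),
      CompleteSpace X ∧ ∀ u v, inner ℝ (e u) (e v) = gradInner u v := by
  obtain ⟨C, hC⟩ := hS.exists_norm_fst_le hbd
  have hanti : AntilipschitzWith (Real.toNNReal √(C ^ 2 + 1)) (gradL r S) := by
    refine ContinuousLinearMap.antilipschitz_of_bound _ fun u => ?_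
    rw [Real.coe_toNNReal _ (Real.sqrt_nonneg _)]
    change ‖(u : L2Pair r S)‖ ≤ _ * ‖(u : L2Pair r S).snd‖
    rw [← Real.sqrt_sq (norm_nonneg (u : L2Pair r S).snd), ← Real.sqrt_mul (by positivity)]
    refine Real.le_sqrt_of_sq_le ?_
    rw [WithLp.prod_norm_sq_eq_of_L2, add_mul, one_mul, ← mul_pow]
    gcongr
    exact hC u
  -- By Poincaré the gradient is bounded below. Its closed range in `L²` serves as the Hilbert
  -- space, and `gradInner` is by definition the inner product of the images.
  have hcl : IsClosed (range (gradL r S)) :=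
    hanti.isClosed_range (gradL r S).uniformContinuous
  exact ⟨_, (gradL r S).equivRange hanti.injective hcl, hcl.completeSpace_coe, fun u v => rfl⟩

end GradientSpace

/-! ### Compactness criterion and uniform bounds on compact sets. -/

section CompactOperators

/-- Up to a small error, `T x` is controlled by finitely many coordinates `F x`, so a finite net for
the image of the ball under `F` yields one for its image under `T`. -/
theorem isCompactOperator_of_forall_exists_finiteDimensional {X Y : Type*} [NormedAddCommGroup X]
    [NormedSpace ℝ X] [NormedAddCommGroup Y] [NormedSpace ℝ Y] [CompleteSpace Y] (T : X →L[ℝ] Y)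
    {C : ℝ} (hC : 0 ≤ C)
    (h : ∀ ε > 0, ∃ (ι : Type) (_ : Fintype ι) (F : X →L[ℝ] (ι → ℝ)),
      ∀ x, ‖T x‖ ≤ C * ‖F x‖ + ε * ‖x‖) : IsCompactOperator T := by
  refine (isCompactOperator_iff_isCompact_closure_image_closedBall (T : X →ₗ[ℝ] Y) one_pos).2 ?_
  refine TotallyBounded.isCompact_of_isClosed ?_ isClosed_closure
  refine TotallyBounded.closure (Metric.totallyBounded_iff.2 fun ε hε => ?_)
  obtain ⟨ι, _, F, hF⟩ := h (ε / 4) (by positivity)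
  have hδ : 0 < ε / (4 * (C + 1)) := by positivity
  have htb : TotallyBounded (F '' Metric.closedBall 0 1) := by
    refine (Bornology.IsBounded.isCompact_closure ?_).totallyBounded.subset subset_closure
    exact F.lipschitz.isBounded_image Metric.isBounded_closedBall
  obtain ⟨t, hts, htf, hcov⟩ := Metric.finite_approx_of_totallyBounded htb _ hδ
  have hts' : ∀ a ∈ t, ∃ x ∈ Metric.closedBall (0 : X) 1, F x = a := fun a ha => hts ha
  choose! g hg hgF using hts'
  refine ⟨(fun z => T (g z)) '' t, htf.image _, ?_⟩
  rintro _ ⟨x, hx, rfl⟩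
  obtain ⟨z, hz, hxz⟩ := mem_iUnion₂.1 (hcov (mem_image_of_mem F hx))
  refine mem_iUnion₂.2 ⟨T (g z), mem_image_of_mem _ hz, ?_⟩
  rw [Metric.mem_ball, dist_eq_norm] at hxz ⊢
  have hgz := hg z hz
  rw [mem_closedBall_zero_iff] at hgz hx
  have h1 : ‖x - g z‖ ≤ 2 := (norm_sub_le _ _).trans (by linarith)
  have h2 : ‖F (x - g z)‖ ≤ ε / (4 * (C + 1)) := by
    rw [map_sub, hgF z hz]; exact hxz.le
  calc ‖T x - T (g z)‖ = ‖T (x - g z)‖ := by rw [map_sub]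
    _ ≤ C * ‖F (x - g z)‖ + ε / 4 * ‖x - g z‖ := hF _
    _ ≤ C * (ε / (4 * (C + 1))) + ε / 4 * 2 := by gcongr
    _ < ε := by
      have : C * (ε / (4 * (C + 1))) ≤ ε / 4 := by
        rw [mul_div_assoc', div_le_div_iff₀ (by positivity) (by positivity)]
        nlinarith
      linarith

theorem IsCompact.exists_forall_norm_sub_lt {α β W : Type*} [PseudoMetricSpace α]
    [PseudoMetricSpace β] [NormedAddCommGroup W] {A : Set α} {R : Set β} (hA : IsCompact A)
    (hR : IsCompact R) {k : α → β → W}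
    (hk : ContinuousOn (fun z : α × β => k z.1 z.2) (A ×ˢ R)) {ε : ℝ} (hε : 0 < ε) :
    ∃ δ > 0, ∀ a ∈ A, ∀ a' ∈ A, dist a a' < δ → ∀ y ∈ R, ‖k a y - k a' y‖ < ε := by
  obtain ⟨δ, hδ, h⟩ := Metric.uniformContinuousOn_iff.1
    ((hA.prod hR).uniformContinuousOn_of_continuous hk) ε hε
  refine ⟨δ, hδ, fun a ha a' ha' hd y hy => ?_⟩
  rw [← dist_eq_norm]
  exact h (a, y) ⟨ha, hy⟩ (a', y) ⟨ha', hy⟩ (by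
    rw [Prod.dist_eq]; exact max_lt hd (by rwa [dist_self]))

theorem IsCompact.exists_forall_norm_le {α β W : Type*} [TopologicalSpace α] [TopologicalSpace β]
    [NormedAddCommGroup W] {A : Set α} {R : Set β} (hA : IsCompact A) (hR : IsCompact R)
    {k : α → β → W} (hk : ContinuousOn (fun z : α × β => k z.1 z.2) (A ×ˢ R)) :
    ∃ M, 0 ≤ M ∧ ∀ a ∈ A, ∀ y ∈ R, ‖k a y‖ ≤ M := by
  obtain ⟨M, hM⟩ := (hA.prod hR).exists_bound_of_continuousOn hk
  exact ⟨max M 0, le_max_right _ _, fun a ha y hy => (hM (a, y) ⟨ha, hy⟩).trans (le_max_left _ _)⟩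

end CompactOperators

/-! ### Integral operators: bounds, continuity, compactness. -/

section KernelOperators

variable {d r s : ℕ} {R V : Set (Euc d)} {W : Type*} [NormedAddCommGroup W] [NormedSpace ℝ W]
  [SecondCountableTopology W]

/-- Integral operator with a vector valued kernel. -/
def vecIntOp (k : Euc d → Euc d → W) (u : H10 r R) (x : Euc d) : W :=
  ∫ y, h10Fn u y • k x y ∂(surfaceMeasure r R)

theorem intOp_eq_vecIntOp (h : Euc d → Euc d → ℝ) (u : H10 r R) : intOp h u = vecIntOp h u := by
  ext x
  simp only [intOp, vecIntOp, smul_eq_mul, mul_comm]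

theorem integrable_h10Fn [IsFiniteMeasure (surfaceMeasure r R)] (u : H10 r R) :
    Integrable (h10Fn u) (surfaceMeasure r R) :=
  (Lp.memLp (u : L2Pair r R).fst).integrable one_le_two

/-- On a finite measure space the `L²` norm dominates the `L¹` norm. Operator bounds then reduce to
sup bounds on kernels. -/
theorem exists_integral_norm_h10Fn_le (r : ℕ) (R : Set (Euc d))
    [IsFiniteMeasure (surfaceMeasure r R)] :
    ∃ C : ℝ, 0 ≤ C ∧ ∀ u : H10 r R, ∫ y, ‖h10Fn u y‖ ∂(surfaceMeasure r R) ≤ C * ‖u‖ := by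
  set σ := surfaceMeasure r R
  refine ⟨(σ univ ^ (1 / (1 : ℝ≥0∞).toReal - 1 / (2 : ℝ≥0∞).toReal)).toReal,
    ENNReal.toReal_nonneg, fun u => ?_⟩
  have h1 : ∫ y, ‖h10Fn u y‖ ∂σ = (eLpNorm (h10Fn u) 1 σ).toReal := by
    rw [eLpNorm_one_eq_lintegral_enorm, integral_norm_eq_lintegral_enorm
      (integrable_h10Fn u).aestronglyMeasurable]
  have h2 := eLpNorm_le_eLpNorm_mul_rpow_measure_univ (μ := σ) (f := h10Fn u) (one_le_two (α := ℝ≥0∞))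
    (integrable_h10Fn u).aestronglyMeasurable
  have h3 : eLpNorm (h10Fn u) 2 σ ≠ ∞ := (Lp.memLp (u : L2Pair r R).fst).eLpNorm_ne_top
  have h4 : (eLpNorm (h10Fn u) 2 σ).toReal ≤ ‖u‖ := by
    change ‖(u : L2Pair r R).fst‖ ≤ ‖(u : L2Pair r R)‖
    rw [WithLp.prod_norm_eq_of_L2]
    exact Real.le_sqrt_of_sq_le (by linarith [sq_nonneg ‖(u : L2Pair r R).snd‖])
  have h5 : σ univ ^ (1 / (1 : ℝ≥0∞).toReal - 1 / (2 : ℝ≥0∞).toReal) ≠ ∞ := by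
    refine ENNReal.rpow_ne_top_of_nonneg ?_ (measure_ne_top _ _)
    norm_num
  rw [h1]
  refine (ENNReal.toReal_mono (ENNReal.mul_ne_top h3 h5) h2).trans ?_
  rw [ENNReal.toReal_mul, mul_comm]
  gcongr

theorem integrable_h10Fn_smul [IsFiniteMeasure (surfaceMeasure r R)] (hR : IsCompact R)
    (u : H10 r R) {f : Euc d → W} (hf : ContinuousOn f R) :
    Integrable (fun y => h10Fn u y • f y) (surfaceMeasure r R) := by
  obtain ⟨M, hM⟩ := hR.exists_bound_of_continuousOn hf
  refine (integrable_h10Fn u).smul_bdd M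
    (hf.aestronglyMeasurable hR.isClosed.measurableSet) ?_
  exact (ae_restrict_mem hR.isClosed.measurableSet).mono hM

omit [SecondCountableTopology W] in
theorem norm_vecIntOp_le [IsFiniteMeasure (surfaceMeasure r R)] (hR : IsCompact R) {C : ℝ}
    (hC : ∀ u : H10 r R, ∫ y, ‖h10Fn u y‖ ∂(surfaceMeasure r R) ≤ C * ‖u‖) {k : Euc d → Euc d → W}
    {x : Euc d} {M : ℝ} (hM0 : 0 ≤ M) (hM : ∀ y ∈ R, ‖k x y‖ ≤ M) (u : H10 r R) :
    ‖vecIntOp k u x‖ ≤ M * (C * ‖u‖) := by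
  refine (norm_integral_le_of_norm_le ((integrable_h10Fn u).norm.const_mul M)
    ((ae_restrict_mem hR.isClosed.measurableSet).mono fun y hy => ?_)).trans ?_
  · rw [norm_smul, mul_comm]
    gcongr
    exact hM y hy
  · rw [integral_const_mul]
    gcongr
    exact hC u

/-- The two base points may differ and are frozen into the kernel, so one identity serves for
increments in `x` and in the parameter. -/
theorem vecIntOp_sub_kernel [IsFiniteMeasure (surfaceMeasure r R)] (hR : IsCompact R)
    {k k' : Euc d → Euc d → W} {x x' : Euc d} (hk : ContinuousOn (k x) R)
    (hk' : ContinuousOn (k' x') R) (u : H10 r R) :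
    vecIntOp k u x - vecIntOp k' u x' = vecIntOp (fun _ y => k x y - k' x' y) u x := by
  simp only [vecIntOp, smul_sub]
  rw [integral_sub (integrable_h10Fn_smul hR u hk) (integrable_h10Fn_smul hR u hk')]

theorem vecIntOp_add [IsFiniteMeasure (surfaceMeasure r R)] (hR : IsCompact R)
    {k : Euc d → Euc d → W} {x : Euc d} (hk : ContinuousOn (k x) R) (u v : H10 r R) :
    vecIntOp k (u + v) x = vecIntOp k u x + vecIntOp k v x := by
  simp only [vecIntOp]
  rw [← integral_add (integrable_h10Fn_smul hR u hk) (integrable_h10Fn_smul hR v hk)]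
  refine integral_congr_ae ?_
  have h : h10Fn (u + v) =ᵐ[surfaceMeasure r R] h10Fn u + h10Fn v :=
    Lp.coeFn_add (u : L2Pair r R).fst (v : L2Pair r R).fst
  exact h.mono fun y hy => by simp only [hy, Pi.add_apply, add_smul]

omit [SecondCountableTopology W] in
theorem vecIntOp_smul (k : Euc d → Euc d → W) (x : Euc d) (c : ℝ) (u : H10 r R) :
    vecIntOp k (c • u) x = c • vecIntOp k u x := by
  simp only [vecIntOp]
  rw [← integral_smul]
  refine integral_congr_ae ?_
  have h : h10Fn (c • u) =ᵐ[surfaceMeasure r R] c • h10Fn u :=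
    Lp.coeFn_smul c (u : L2Pair r R).fst
  exact h.mono fun y hy => by simp only [hy, Pi.smul_apply, smul_assoc]

theorem vecIntOp_sub [IsFiniteMeasure (surfaceMeasure r R)] (hR : IsCompact R)
    {k : Euc d → Euc d → W} {x : Euc d} (hk : ContinuousOn (k x) R) (u v : H10 r R) :
    vecIntOp k (u - v) x = vecIntOp k u x - vecIntOp k v x := by
  rw [sub_eq_add_neg, vecIntOp_add hR hk, ← neg_one_smul ℝ v, vecIntOp_smul, neg_one_smul,
    sub_eq_add_neg]

omit [NormedSpace ℝ W] [SecondCountableTopology W] in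
theorem ContinuousOn.kernel_section {k : Euc d → Euc d → W}
    (hk : ContinuousOn (fun z : Euc d × Euc d => k z.1 z.2) (V ×ˢ R)) {x : Euc d} (hx : x ∈ V) :
    ContinuousOn (k x) R :=
  hk.comp (f := fun y => (x, y)) (by fun_prop) fun _ hy => ⟨hx, hy⟩

theorem continuousOn_vecIntOp [IsFiniteMeasure (surfaceMeasure r R)] (hR : IsCompact R)
    (hV : IsCompact V) {k : Euc d → Euc d → W}
    (hk : ContinuousOn (fun z : Euc d × Euc d => k z.1 z.2) (V ×ˢ R)) (u : H10 r R) :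
    ContinuousOn (vecIntOp k u) V := by
  obtain ⟨C, hC0, hC⟩ := exists_integral_norm_h10Fn_le r R
  refine Metric.continuousOn_iff.2 fun x hx ε hε => ?_
  obtain ⟨δ, hδ, h⟩ := hV.exists_forall_norm_sub_lt hR hk
    (ε := ε / (C * ‖u‖ + 1)) (by positivity)
  refine ⟨δ, hδ, fun x' hx' hd => ?_⟩
  rw [dist_eq_norm, vecIntOp_sub_kernel hR (hk.kernel_section hx') (hk.kernel_section hx)]
  refine (norm_vecIntOp_le hR hC (M := ε / (C * ‖u‖ + 1)) (by positivity)
    (fun y hy => (h x' hx' x hx hd y hy).le) u).trans_lt ?_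
  rw [div_mul_eq_mul_div, div_lt_iff₀ (by positivity)]
  nlinarith

/-- `A` is the operator from `H¹₀(R)` to `L²(V)` with kernel `h`. -/
def HasKernel (s : ℕ) (V : Set (Euc d)) (A : H10 r R →L[ℝ] Lp ℝ 2 (surfaceMeasure s V))
    (h : Euc d → Euc d → ℝ) : Prop :=
  ∀ u, A u =ᵐ[surfaceMeasure s V] intOp h u

theorem memLp_intOp [IsFiniteMeasure (surfaceMeasure r R)] [IsFiniteMeasure (surfaceMeasure s V)]
    (hR : IsCompact R) (hV : IsCompact V) {h : Euc d → Euc d → ℝ}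
    (hh : ContinuousOn (fun z : Euc d × Euc d => h z.1 z.2) (V ×ˢ R)) (u : H10 r R) :
    MemLp (intOp h u) 2 (surfaceMeasure s V) := by
  have hc := continuousOn_vecIntOp hR hV hh u
  rw [← intOp_eq_vecIntOp] at hc
  obtain ⟨M, hM⟩ := hV.exists_bound_of_continuousOn hc
  exact MemLp.of_bound (hc.aestronglyMeasurable hV.isClosed.measurableSet) M
    ((ae_restrict_mem hV.isClosed.measurableSet).mono hM)

theorem norm_Lp_le_of_forall_abs_le [IsFiniteMeasure (surfaceMeasure s V)] (hV : IsCompact V)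
    {f : Lp ℝ 2 (surfaceMeasure s V)} {g : Euc d → ℝ} (hfg : f =ᵐ[surfaceMeasure s V] g) {M : ℝ}
    (hM0 : 0 ≤ M) (hM : ∀ x ∈ V, |g x| ≤ M) :
    ‖f‖ ≤ (measureUnivNNReal (surfaceMeasure s V) : ℝ) ^ (2 : ℝ≥0∞).toReal⁻¹ * M := by
  refine Lp.norm_le_of_ae_bound hM0 ?_
  filter_upwards [hfg, ae_restrict_mem hV.isClosed.measurableSet] with x hx hxV
  rw [hx]
  exact hM x hxV

theorem exists_hasKernel [IsFiniteMeasure (surfaceMeasure r R)]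
    [IsFiniteMeasure (surfaceMeasure s V)] (hR : IsCompact R) (hV : IsCompact V)
    {h : Euc d → Euc d → ℝ} (hh : ContinuousOn (fun z : Euc d × Euc d => h z.1 z.2) (V ×ˢ R)) :
    ∃ A : H10 r R →L[ℝ] Lp ℝ 2 (surfaceMeasure s V), HasKernel s V A h ∧ IsCompactOperator A := by
  obtain ⟨C, hC0, hC⟩ := exists_integral_norm_h10Fn_le r R
  obtain ⟨M, hM0, hM⟩ := hV.exists_forall_norm_le hR hh
  set m : ℝ := (measureUnivNNReal (surfaceMeasure s V) : ℝ) ^ (2 : ℝ≥0∞).toReal⁻¹ with hm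
  have hm0 : 0 ≤ m := by positivity
  have hmem : ∀ u : H10 r R, MemLp (intOp h u) 2 (surfaceMeasure s V) :=
    memLp_intOp hR hV hh
  have hadd : ∀ u v : H10 r R, ∀ x ∈ V, intOp h (u + v) x = intOp h u x + intOp h v x := by
    intro u v x hx
    simp only [intOp_eq_vecIntOp]
    exact vecIntOp_add hR (hh.kernel_section hx) u v
  have hsmul : ∀ (c : ℝ) (u : H10 r R) x, intOp h (c • u) x = c • intOp h u x := by
    intro c u x
    simp only [intOp_eq_vecIntOp]
    exact vecIntOp_smul h x c u
  have hVae : ∀ᵐ x ∂(surfaceMeasure s V), x ∈ V := ae_restrict_mem hV.isClosed.measurableSet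
  let A₀ : H10 r R →ₗ[ℝ] Lp ℝ 2 (surfaceMeasure s V) :=
    { toFun := fun u => (hmem u).toLp _
      map_add' := fun u v => by
        rw [← MemLp.toLp_add]
        exact MemLp.toLp_congr _ _ (hVae.mono fun x hx => hadd u v x hx)
      map_smul' := fun c u => by
        rw [RingHom.id_apply, ← MemLp.toLp_const_smul]
        exact MemLp.toLp_congr _ _ (Eventually.of_forall fun x => hsmul c u x) }
  have hA₀ : ∀ u, A₀ u =ᵐ[surfaceMeasure s V] intOp h u := fun u => (hmem u).coeFn_toLp
  have hpt : ∀ u : H10 r R, ∀ x ∈ V, |intOp h u x| ≤ M * (C * ‖u‖) := by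
    intro u x hx
    rw [intOp_eq_vecIntOp, ← Real.norm_eq_abs]
    exact norm_vecIntOp_le hR hC hM0 (hM x hx) u
  let A : H10 r R →L[ℝ] Lp ℝ 2 (surfaceMeasure s V) := A₀.mkContinuous (m * (M * C)) fun u => by
    rw [mul_assoc, mul_assoc]
    exact norm_Lp_le_of_forall_abs_le hV (hA₀ u) (by positivity) (hpt u)
  refine ⟨A, hA₀, ?_⟩
  refine isCompactOperator_of_forall_exists_finiteDimensional A hm0 fun ε hε => ?_
  obtain ⟨δ, hδ, hδV⟩ := hV.exists_forall_norm_sub_lt hR hh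
    (ε := ε / (m * C + 1)) (by positivity)
  obtain ⟨t, htV, htf, hcov⟩ := hV.finite_cover_balls hδ
  have := htf.fintype
  -- The finitely many coordinates are evaluations of `intOp h u` at a `δ`-net of `V`; uniform
  -- continuity of the kernel controls the other points.
  let ev : t → H10 r R →L[ℝ] ℝ := fun x =>
    LinearMap.mkContinuous
      { toFun := fun u => intOp h u x
        map_add' := fun u v => hadd u v x (htV x.2)
        map_smul' := fun c u => hsmul c u x } (M * C) fun u => by
      rw [mul_assoc]; exact hpt u x (htV x.2)
  have hfin : Finite t := htf
  let n := Nat.card t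
  let eq : t ≃ Fin n := Finite.equivFin t
  refine ⟨Fin n, inferInstance, ContinuousLinearMap.pi fun i => ev (eq.symm i), fun u => ?_⟩
  set F := (ContinuousLinearMap.pi fun i => ev (eq.symm i)) u with hF
  have hbound : ∀ x ∈ V, |intOp h u x| ≤ ‖F‖ + ε / (m * C + 1) * (C * ‖u‖) := by
    intro x hx
    obtain ⟨x₀, hx₀, hd⟩ := mem_iUnion₂.1 (hcov hx)
    have h1 : |intOp h u x₀| ≤ ‖F‖ := by
      have := norm_le_pi_norm F (eq ⟨x₀, hx₀⟩)
      change ‖ev (eq.symm (eq ⟨x₀, hx₀⟩)) u‖ ≤ ‖F‖ at this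
      rw [Equiv.symm_apply_apply] at this
      exact this
    have h2 : |intOp h u x - intOp h u x₀| ≤ ε / (m * C + 1) * (C * ‖u‖) := by
      rw [intOp_eq_vecIntOp, vecIntOp_sub_kernel hR (hh.kernel_section hx)
        (hh.kernel_section (htV hx₀)), ← Real.norm_eq_abs]
      exact norm_vecIntOp_le hR hC (by positivity)
        (fun y hy => (hδV x hx x₀ (htV hx₀) hd y hy).le) u
    have h3 := abs_add_le (intOp h u x₀) (intOp h u x - intOp h u x₀)
    rw [add_sub_cancel] at h3
    linarith
  have h1 := norm_Lp_le_of_forall_abs_le hV (hA₀ u) (by positivity) hbound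
  refine h1.trans ?_
  rw [← hm, mul_add]
  have h2 : m * (ε / (m * C + 1) * (C * ‖u‖)) = ε * ‖u‖ * (m * C / (m * C + 1)) := by ring
  rw [h2]
  refine add_le_add le_rfl (mul_le_of_le_one_right (by positivity) ?_)
  rw [div_le_one (by positivity)]
  linarith

end KernelOperators

/-! ### Tangential gradients of the image functions. -/

section GradientOfOperator

variable {d r s : ℕ} {R V : Set (Euc d)}

theorem IsPatch.dist_lineMap_le {U D : Set (Euc d)} {κ ψ : Euc d → Euc d} {L : ℝ≥0}
    (h : IsPatch V U D κ ψ L) {x x' : Euc d} (hx : x ∈ U) (hx' : x' ∈ U) {t : ℝ}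
    (ht : t ∈ Icc (0 : ℝ) 1) :
    dist (ψ (AffineMap.lineMap (κ x) (κ x') t)) x ≤ L * (L * ‖x' - x‖) := by
  have hκx := h.mapsTo_coord hx
  have hκx' := h.mapsTo_coord hx'
  have h1 := h.lipschitz_param.dist_le_mul _ (h.convex.lineMap_mem hκx hκx' ht) _ hκx
  rw [h.left_inv x hx] at h1
  refine h1.trans ?_
  gcongr
  rw [dist_lineMap_left, Real.norm_eq_abs, abs_of_nonneg ht.1]
  refine (mul_le_of_le_one_left dist_nonneg ht.2).trans ?_
  rw [dist_comm, ← dist_eq_norm]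
  exact h.lipschitz_coord.dist_le_mul _ hx' _ hx

/-- First order Taylor estimate on a patch, by integration along a path. -/
theorem IsPatch.abs_sub_sub_inner_le {U D : Set (Euc d)} {κ ψ : Euc d → Euc d} {L : ℝ≥0}
    (h : IsPatch V U D κ ψ L) {f : Euc d → ℝ} {g : Euc d → Euc d}
    (hf : ∀ x ∈ V, HasTangentialGradientAt V f (g x) x) {x x' : Euc d} (hx : x ∈ U) (hx' : x' ∈ U)
    {ε : ℝ} (hε : ∀ z ∈ V, dist z x ≤ L * (L * ‖x' - x‖) → ‖g z - g x‖ ≤ ε) :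
    |f x' - f x - inner ℝ (g x) (x' - x)| ≤ ε * (L * (L * ‖x' - x‖)) := by
  have hκx := h.mapsTo_coord hx
  have hκx' := h.mapsTo_coord hx'
  set γ : ℝ → Euc d := fun t => ψ (AffineMap.lineMap (κ x) (κ x') t) with hγ
  have hγV : MapsTo γ (Icc 0 1) V := fun t ht =>
    h.subset (h.mapsTo_param (h.convex.lineMap_mem hκx hκx' ht))
  have hγ0 : γ 0 = x := by simp only [hγ, AffineMap.lineMap_apply_zero, h.left_inv x hx]
  have hγ1 : γ 1 = x' := by simp only [hγ, AffineMap.lineMap_apply_one, h.left_inv x' hx']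
  have hd : ∀ t, ∃ v, t ∈ Icc (0 : ℝ) 1 → HasDerivAt γ v t ∧ ‖v‖ ≤ L * (L * ‖x' - x‖) := by
    intro t
    by_cases ht : t ∈ Icc (0 : ℝ) 1
    · obtain ⟨v, hv, hn⟩ := h.exists_hasDerivAt hκx hκx' ht
      refine ⟨v, fun _ => ⟨hv, hn.trans ?_⟩⟩
      gcongr
      rw [← dist_eq_norm, ← dist_eq_norm]
      exact h.lipschitz_coord.dist_le_mul _ hx' _ hx
    · exact ⟨0, fun h' => absurd h' ht⟩
  choose v hv using hd
  have hε0 : 0 ≤ ε := (norm_nonneg _).trans (hε x (h.subset hx) (by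
    rw [dist_self]; positivity))
  -- Mean value inequality for `f` minus its linear part along the path, which stays in `V` although
  -- `V` is not convex.
  have key := norm_image_sub_le_of_norm_deriv_le_segment_01'
    (f := fun t => f (γ t) - inner ℝ (g x) (γ t))
    (f' := fun t => inner ℝ (g (γ t)) (v t) - inner ℝ (g x) (v t))
    (C := ε * (L * (L * ‖x' - x‖))) (fun t ht => ?_) (fun t ht => ?_)
  · simp only [hγ0, hγ1] at key
    rw [Real.norm_eq_abs] at key
    rw [inner_sub_right]
    convert key using 2
    ring
  · have hv' := (hv t ht).1.hasDerivWithinAt (s := Icc 0 1)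
    refine ((hf _ (hγV ht)).comp_hasDerivWithinAt hv' hγV).sub ?_
    have h2 := ((innerSL ℝ (g x)).hasFDerivAt (x := γ t)).comp_hasDerivWithinAt t hv'
    simpa using! h2
  · have ht' := Ico_subset_Icc_self ht
    rw [← inner_sub_left]
    refine (norm_inner_le_norm _ _).trans ?_
    exact mul_le_mul (hε _ (hγV ht') (h.dist_lineMap_le hx hx' ht')) (hv t ht').2
      (norm_nonneg _) hε0

theorem inner_vecIntOp [IsFiniteMeasure (surfaceMeasure r R)] (hR : IsCompact R)
    {G : Euc d → Euc d → Euc d} {x : Euc d} (hG : ContinuousOn (G x) R) (u : H10 r R) (w : Euc d) :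
    inner ℝ (vecIntOp G u x) w = vecIntOp (fun x y => (inner ℝ (G x y) w : ℝ)) u x := by
  rw [real_inner_comm, vecIntOp, ← integral_inner (integrable_h10Fn_smul hR u hG)]
  simp only [vecIntOp, inner_smul_right, real_inner_comm, smul_eq_mul]

/-- Differentiation under the integral sign. -/
theorem hasTangentialGradientAt_intOp [IsFiniteMeasure (surfaceMeasure r R)] (hR : IsCompact R)
    (hV : IsCompactEmbeddedManifold s V) {k : Euc d → Euc d → ℝ} {G : Euc d → Euc d → Euc d}
    (hk : ContinuousOn (fun z : Euc d × Euc d => k z.1 z.2) (V ×ˢ R))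
    (hG : ContinuousOn (fun z : Euc d × Euc d => G z.1 z.2) (V ×ˢ R))
    (h : ∀ x ∈ V, ∀ y ∈ R, HasTangentialGradientAt V (fun x' => k x' y) (G x y) x)
    (u : H10 r R) {x : Euc d} (hx : x ∈ V) :
    HasTangentialGradientAt V (intOp k u) (vecIntOp G u x) x := by
  obtain ⟨C, hC0, hC⟩ := exists_integral_norm_h10Fn_le r R
  have hGx := hG.kernel_section hx
  refine ⟨hasGradientWithinAt_iff_isLittleO.2 (Asymptotics.isLittleO_iff.2 fun c hc => ?_), ?_⟩
  · obtain ⟨ρ, L, κ, ψ, O, -, hO, hxO, -, hp⟩ := hV.exists_isPatch hx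
    -- The patch distortion `L * L` and the `L¹` bound on `u` are compensated here. The remainder
    -- must be small uniformly in `y`, which the path estimate provides.
    set ε := c / (L * L * (C * ‖u‖) + 1) with hε
    have hε0 : 0 < ε := by positivity
    obtain ⟨δ, hδ, hδG⟩ := hV.isCompact.exists_forall_norm_sub_lt hR hG hε0
    have hball : Metric.ball x (δ / (L * L + 1)) ∈ 𝓝 x := Metric.ball_mem_nhds _ (by positivity)
    filter_upwards [self_mem_nhdsWithin, mem_nhdsWithin_of_mem_nhds (hO.mem_nhds hxO),
      mem_nhdsWithin_of_mem_nhds hball] with x' hx'V hx'O hx'b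
    have hk' : ContinuousOn (fun y => k x' y - k x y) R :=
      (hk.kernel_section hx'V).sub (hk.kernel_section hx)
    have hi : ContinuousOn (fun y => (inner ℝ (G x y) (x' - x) : ℝ)) R :=
      hGx.inner continuousOn_const
    have hdist : L * (L * ‖x' - x‖) < δ := by
      rw [mem_ball_iff_norm, lt_div_iff₀ (by positivity)] at hx'b
      nlinarith [norm_nonneg (x' - x)]
    rw [intOp_eq_vecIntOp, inner_vecIntOp hR hGx,
      vecIntOp_sub_kernel hR (hk.kernel_section hx'V) (hk.kernel_section hx)]
    change ‖vecIntOp (fun _ y => k x' y - k x y) u x' - vecIntOp _ u x‖ ≤ _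
    rw [vecIntOp_sub_kernel hR (x := x') (x' := x) (k := fun _ y => k x' y - k x y) hk' hi]
    refine (norm_vecIntOp_le hR hC (M := ε * (L * (L * ‖x' - x‖))) (by positivity)
      (fun y hy => ?_) u).trans ?_
    · exact hp.abs_sub_sub_inner_le (f := fun z => k z y) (g := fun z => G z y)
        (fun z hz => h z hz y hy) ⟨hx, hxO⟩ ⟨hx'V, hx'O⟩
        fun z hz hzx => (hδG z hz x hx (hzx.trans_lt hdist) y hy).le
    · have e : ε * (L * (L * ‖x' - x‖)) * (C * ‖u‖) =
          c * ‖x' - x‖ * (L * L * (C * ‖u‖) / (L * L * (C * ‖u‖) + 1)) := by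
        rw [hε]; ring
      rw [e]
      refine mul_le_of_le_one_right (by positivity) ?_
      rw [div_le_one (by positivity)]
      linarith
  -- The integral stays in the tangent space because its pairing with any normal vector is the
  -- integral of zero.
  · rw [← Submodule.orthogonal_orthogonal (Submodule.span ℝ (tangentConeAt ℝ V x)),
      Submodule.mem_orthogonal']
    intro w hw
    rw [inner_vecIntOp hR hGx]
    refine integral_eq_zero_of_ae ((ae_restrict_mem hR.isClosed.measurableSet).mono fun y hy => ?_)
    have := (Submodule.mem_orthogonal _ _).1 hw _ (h x hx y hy).2
    simp only [this, smul_zero, Pi.zero_apply]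

theorem isC1WithGradient_intOp [IsFiniteMeasure (surfaceMeasure r R)] (hR : IsCompact R)
    (hV : IsCompactEmbeddedManifold s V) {k : Euc d → Euc d → ℝ} {G : Euc d → Euc d → Euc d}
    (hk : ContinuousOn (fun z : Euc d × Euc d => k z.1 z.2) (V ×ˢ R))
    (hG : ContinuousOn (fun z : Euc d × Euc d => G z.1 z.2) (V ×ˢ R))
    (h : ∀ x ∈ V, ∀ y ∈ R, HasTangentialGradientAt V (fun x' => k x' y) (G x y) x)
    (u : H10 r R) : IsC1WithGradient V (intOp k u) (vecIntOp G u) :=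
  ⟨fun _ hx => hasTangentialGradientAt_intOp hR hV hk hG h u hx,
    continuousOn_vecIntOp hR hV.isCompact hG u⟩

theorem IsC1WithGradient.sub {f f' : Euc d → ℝ} {g g' : Euc d → Euc d}
    (h : IsC1WithGradient V f g) (h' : IsC1WithGradient V f' g') :
    IsC1WithGradient V (fun x => f x - f' x) (fun x => g x - g' x) := by
  refine ⟨fun x hx => ⟨?_, Submodule.sub_mem _ (h.1 x hx).2 (h'.1 x hx).2⟩, h.2.sub h'.2⟩
  have h1 := (h.1 x hx).1.hasFDerivWithinAt.sub (h'.1 x hx).1.hasFDerivWithinAt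
  rw [hasGradientWithinAt_iff_hasFDerivWithinAt, map_sub]
  exact h1

theorem IsC1WithGradient.sq {f : Euc d → ℝ} {g : Euc d → Euc d} (h : IsC1WithGradient V f g) :
    IsC1WithGradient V (fun x => f x ^ 2) (fun x => (2 * f x) • g x) := by
  refine ⟨fun x hx => ⟨?_, Submodule.smul_mem _ _ (h.1 x hx).2⟩,
    ContinuousOn.smul (f := fun x => 2 * f x) (continuousOn_const.mul h.continuousOn) h.2⟩
  have h1 := (h.1 x hx).1.hasFDerivWithinAt.pow 2
  rw [hasGradientWithinAt_iff_hasFDerivWithinAt, map_smul]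
  simpa using! h1

/-- The tangential gradient is unique. -/
theorem HasTangentialGradientAt.unique {f : Euc d → ℝ} {g g' x : Euc d}
    (h : HasTangentialGradientAt V f g x) (h' : HasTangentialGradientAt V f g' x) : g = g' := by
  have hsub : g - g' ∈ Submodule.span ℝ (tangentConeAt ℝ V x) := Submodule.sub_mem _ h.2 h'.2
  have horth : ∀ w ∈ Submodule.span ℝ (tangentConeAt ℝ V x), inner ℝ w (g - g') = 0 := by
    intro w hw
    induction hw using Submodule.span_induction with
    | mem w hw =>
      have h1 := h.1.hasFDerivWithinAt.unique_on h'.1.hasFDerivWithinAt hw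
      rw [InnerProductSpace.toDual_apply_apply, InnerProductSpace.toDual_apply_apply] at h1
      rw [real_inner_comm, inner_sub_left, h1, sub_self]
    | zero => exact inner_zero_left _
    | add a b _ _ ha hb => rw [inner_add_left, ha, hb, add_zero]
    | smul c a _ ha => rw [inner_smul_left, ha, mul_zero]
  exact sub_eq_zero.1 (inner_self_eq_zero.1 (horth _ hsub))

end GradientOfOperator

/-! ### Expansion of the kernel in the parameter. -/

section Parameter

theorem EuclideanSpace.norm_le_norm_of_forall_abs_le {p : ℕ} {a b : Euc p}
    (h : ∀ i, |a i| ≤ |b i|) : ‖a‖ ≤ ‖b‖ := by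
  rw [EuclideanSpace.norm_eq, EuclideanSpace.norm_eq]
  exact Real.sqrt_le_sqrt (Finset.sum_le_sum fun i _ => pow_le_pow_left₀ (abs_nonneg _) (h i) 2)

theorem HasLineDerivAt.hasDerivAt_add_smul {E W : Type*} [NormedAddCommGroup E] [NormedSpace ℝ E]
    [NormedAddCommGroup W] [NormedSpace ℝ W] {f : E → W} {f' : W} {a v : E} {t : ℝ}
    (h : HasLineDerivAt ℝ f f' (a + t • v) v) : HasDerivAt (fun t => f (a + t • v)) f' t := by
  unfold HasLineDerivAt at h
  have h0 : HasDerivAt (fun s : ℝ => f (a + t • v + s • v)) f' (t - t) := by rwa [sub_self]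
  refine (h0.comp_sub_const t t).congr_of_eventuallyEq (Eventually.of_forall fun s => ?_)
  change f (a + s • v) = f (a + t • v + (s - t) • v)
  rw [add_assoc, ← add_smul, add_sub_cancel]

/-- First order Taylor estimate from partial derivatives. -/
theorem norm_sub_sub_sum_partial_le {p : ℕ} {W : Type*} [NormedAddCommGroup W] [NormedSpace ℝ W]
    {f : Euc p → W} {D : Fin p → Euc p → W} {m₀ : Euc p} {δ ε : ℝ}
    (hD : ∀ i, ∀ m ∈ Metric.ball m₀ δ, HasLineDerivAt ℝ f (D i m) m (EuclideanSpace.single i 1))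
    (hε : ∀ i, ∀ m ∈ Metric.ball m₀ δ, ‖D i m - D i m₀‖ ≤ ε) {m : Euc p}
    (hm : m ∈ Metric.ball m₀ δ) :
    ‖f m - f m₀ - ∑ i, (m i - m₀ i) • D i m₀‖ ≤ p * (ε * ‖m - m₀‖) := by
  classical
  rw [mem_ball_iff_norm] at hm
  -- Coordinates are switched from `m₀` to `m` one at a time. Intermediate points stay in the ball
  -- since no coordinate moves further from `m₀` than that of `m`.
  let q : Finset (Fin p) → Euc p := fun s => WithLp.toLp 2 fun j => if j ∈ s then m j else m₀ j
  have key : ∀ s : Finset (Fin p),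
      ‖f (q s) - f m₀ - ∑ i ∈ s, (m i - m₀ i) • D i m₀‖ ≤ s.card * (ε * ‖m - m₀‖) := by
    intro s
    induction s using Finset.induction_on with
    | empty =>
      have : q ∅ = m₀ := by ext j; simp [q]
      simp [this]
    | insert i s his ih =>
      set h := m i - m₀ i with hh
      have hq : q (insert i s) = q s + (1 : ℝ) • (h • EuclideanSpace.single i (1 : ℝ)) := by
        ext j
        by_cases hj : j = i
        · subst hj; simp [q, his, hh]
        · simp [q, hj]
      have hpath : ∀ t ∈ Icc (0 : ℝ) 1,
          q s + t • (h • EuclideanSpace.single i (1 : ℝ)) ∈ Metric.ball m₀ δ := by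
        intro t ht
        rw [mem_ball_iff_norm]
        refine (EuclideanSpace.norm_le_norm_of_forall_abs_le fun j => ?_).trans_lt hm
        by_cases hj : j = i
        · subst hj
          simp only [PiLp.sub_apply, PiLp.add_apply, PiLp.smul_apply, q, if_neg his,
            PiLp.single_apply, if_true, smul_eq_mul, mul_one, add_sub_cancel_left,
            abs_mul, abs_of_nonneg ht.1]
          exact mul_le_of_le_one_left (abs_nonneg _) ht.2
        · by_cases hjs : j ∈ s <;> simp [q, hj, hjs]
      have hε0 : 0 ≤ ε := (norm_nonneg _).trans (hε i _ (hpath 0 (left_mem_Icc.2 zero_le_one)))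
      have hhm : |h| ≤ ‖m - m₀‖ := by
        simpa [hh] using PiLp.norm_apply_le (m - m₀) i
      have step := norm_image_sub_le_of_norm_deriv_le_segment_01'
        (f := fun t : ℝ => f (q s + t • (h • EuclideanSpace.single i (1 : ℝ))) - t • (h • D i m₀))
        (f' := fun t => h • D i (q s + t • (h • EuclideanSpace.single i (1 : ℝ))) - h • D i m₀)
        (C := ε * ‖m - m₀‖) (fun t ht => ?_) (fun t ht => ?_)
      · rw [Finset.sum_insert his, Finset.card_insert_of_notMem his, hq]
        simp only [zero_smul, add_zero, sub_zero, one_smul] at step ⊢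
        have e : f (q s + h • EuclideanSpace.single i (1 : ℝ)) - f m₀ -
            (h • D i m₀ + ∑ x ∈ s, (m x - m₀ x) • D x m₀) =
            (f (q s + h • EuclideanSpace.single i (1 : ℝ)) - h • D i m₀ - f (q s)) +
            (f (q s) - f m₀ - ∑ x ∈ s, (m x - m₀ x) • D x m₀) := by abel
        rw [e]
        refine (norm_add_le _ _).trans ?_
        push_cast
        linarith
      · have h1 := ((hD i _ (hpath t ht)).smul h).hasDerivAt_add_smul
        have h2 : HasDerivAt (fun t : ℝ => t • (h • D i m₀)) ((1 : ℝ) • (h • D i m₀)) t :=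
          (hasDerivAt_id t).smul_const _
        rw [one_smul] at h2
        exact (h1.sub h2).hasDerivWithinAt
      · rw [← smul_sub, norm_smul, Real.norm_eq_abs, mul_comm]
        exact mul_le_mul (hε i _ (hpath t (Ico_subset_Icc_self ht))) hhm (abs_nonneg _) hε0
  have hu : q Finset.univ = m := by ext j; simp [q]
  have := key Finset.univ
  rwa [hu, Finset.card_univ, Fintype.card_fin] at this

/-- Expansion in the parameter, uniformly in the space variables. -/
theorem exists_forall_norm_sub_sub_sum_partial_le {d p : ℕ} {W : Type*} [NormedAddCommGroup W]
    [NormedSpace ℝ W] {B' : Set (Euc p)} (hB' : IsOpen B') {V R : Set (Euc d)} (hV : IsCompact V)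
    (hR : IsCompact R) {F : Euc p → Euc d → Euc d → W} {D : Fin p → Euc p → Euc d → Euc d → W}
    (h : ∀ i, IsContPartial B' V R i F (D i)) {m₀ : Euc p} (hm₀ : m₀ ∈ B') {ε : ℝ} (hε : 0 < ε) :
    ∃ δ > 0, ∀ m ∈ Metric.ball m₀ δ, ∀ x ∈ V, ∀ y ∈ R,
      ‖F m x y - F m₀ x y - ∑ i, (m i - m₀ i) • D i m₀ x y‖ ≤ ε * ‖m - m₀‖ := by
  obtain ⟨ρ, hρ, hρB⟩ := Metric.nhds_basis_closedBall.mem_iff.1 (hB'.mem_nhds hm₀)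
  have hi : ∀ i : Fin p, ∃ δ > 0, ∀ m ∈ Metric.closedBall m₀ ρ, dist m m₀ < δ →
      ∀ z ∈ V ×ˢ R, ‖D i m z.1 z.2 - D i m₀ z.1 z.2‖ < ε / (p + 1) := by
    intro i
    obtain ⟨δ, hδ, hd⟩ := (isCompact_closedBall m₀ ρ).exists_forall_norm_sub_lt (hV.prod hR)
      (k := fun m z => D i m z.1 z.2)
      ((h i).2.mono (prod_mono hρB Subset.rfl)) (ε := ε / (p + 1)) (by positivity)
    exact ⟨δ, hδ, fun m hm hdm => hd m hm m₀ (Metric.mem_closedBall_self hρ.le) hdm⟩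
  choose δ hδ hd using hi
  obtain ⟨δ', hδ', hmin⟩ : ∃ δ' > 0, ∀ i, δ' ≤ δ i := by
    rcases isEmpty_or_nonempty (Fin p) with hp | hp
    · exact ⟨1, one_pos, fun i => hp.elim i⟩
    · obtain ⟨i, hi⟩ := Finite.exists_min δ
      exact ⟨δ i, hδ i, hi⟩
  have hsub : Metric.ball m₀ (min ρ δ') ⊆ Metric.closedBall m₀ ρ :=
    (Metric.ball_subset_ball (min_le_left _ _)).trans Metric.ball_subset_closedBall
  refine ⟨min ρ δ', lt_min hρ hδ', fun m hm x hx y hy => ?_⟩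
  refine (norm_sub_sub_sum_partial_le (f := fun m => F m x y) (D := fun i m => D i m x y)
    (δ := min ρ δ') (ε := ε / (p + 1)) (fun i m' hm' => (h i).1 m' (hρB (hsub hm')) x hx y hy)
    (fun i m' hm' => ?_) hm).trans ?_
  · refine (hd i m' (hsub hm') ?_ (x, y) ⟨hx, hy⟩).le
    exact (Metric.mem_ball.1 hm').trans_le ((min_le_right _ _).trans (hmin i))
  · have e : (p : ℝ) * (ε / (p + 1) * ‖m - m₀‖) = ε * ‖m - m₀‖ * (p / (p + 1)) := by ring
    rw [e]
    refine mul_le_of_le_one_right (by positivity) ?_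
    rw [div_le_one (by positivity)]
    linarith

/-- Continuity of the kernel in `y` propagates from one parameter to nearby ones. -/
theorem exists_forall_continuousOn_section {d p : ℕ} {W : Type*} [NormedAddCommGroup W]
    [NormedSpace ℝ W] {B' : Set (Euc p)} (hB' : IsOpen B') {V R : Set (Euc d)}
    (hR : IsCompact R) {F : Euc p → Euc d → Euc d → W} {D : Fin p → Euc p → Euc d → Euc d → W}
    (h : ∀ i, IsContPartial B' V R i F (D i)) {m₀ : Euc p} (hm₀ : m₀ ∈ B')
    (hF : ∀ x ∈ V, ContinuousOn (F m₀ x) R) :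
    ∃ δ > 0, ∀ m ∈ Metric.ball m₀ δ, ∀ x ∈ V, ContinuousOn (F m x) R := by
  obtain ⟨ρ, hρ, hρB⟩ := Metric.nhds_basis_closedBall.mem_iff.1 (hB'.mem_nhds hm₀)
  refine ⟨ρ, hρ, fun m hm x hx => Metric.continuousOn_iff.2 fun y hy ε hε => ?_⟩
  -- The remainder contributes `2 * p * ρ * η` and the linear term `p * ρ * η`, at most `ε / 2`
  -- together; the other half is for `F m₀`.
  set η := ε / (2 * (3 * p * ρ + 1)) with hη
  have hη0 : 0 < η := by positivity
  have hi : ∀ i : Fin p, ∃ δ > 0, ∀ y' ∈ R, dist y' y < δ → ∀ m ∈ Metric.closedBall m₀ ρ,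
      ‖D i m x y' - D i m x y‖ < η := by
    intro i
    have hc : ContinuousOn (fun z : Euc d × Euc p => D i z.2 x z.1)
        (R ×ˢ Metric.closedBall m₀ ρ) :=
      (h i).2.comp (f := fun z : Euc d × Euc p => (z.2, x, z.1)) (by fun_prop)
        fun z hz => ⟨hρB hz.2, hx, hz.1⟩
    obtain ⟨δ, hδ, hd⟩ := hR.exists_forall_norm_sub_lt (isCompact_closedBall m₀ ρ)
      (k := fun y m => D i m x y) hc hη0
    exact ⟨δ, hδ, fun y' hy' hdy => hd y' hy' y hy hdy⟩
  choose δ hδ hd using hi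
  obtain ⟨δ₀, hδ₀, hd₀⟩ := Metric.continuousOn_iff.1 (hF x hx) y hy (ε / 2) (by positivity)
  obtain ⟨δ', hδ', hmin⟩ : ∃ δ' > 0, ∀ i, δ' ≤ δ i := by
    rcases isEmpty_or_nonempty (Fin p) with hp | hp
    · exact ⟨1, one_pos, fun i => hp.elim i⟩
    · obtain ⟨i, hi⟩ := Finite.exists_min δ
      exact ⟨δ i, hδ i, hi⟩
  refine ⟨min δ₀ δ', lt_min hδ₀ hδ', fun y' hy' hdy => ?_⟩
  have hD : ∀ i, ∀ m ∈ Metric.ball m₀ ρ, ‖D i m x y' - D i m x y‖ ≤ η := fun i m hm =>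
    (hd i y' hy' (hdy.trans_le ((min_le_right _ _).trans (hmin i))) m
      (Metric.ball_subset_closedBall hm)).le
  have hm₀ρ : m₀ ∈ Metric.ball m₀ ρ := Metric.mem_ball_self hρ
  have h1 := norm_sub_sub_sum_partial_le (f := fun m => F m x y' - F m x y)
    (D := fun i m => D i m x y' - D i m x y) (ε := η + η) (fun i m' hm' => ?_)
    (fun i m' hm' => (norm_sub_le _ _).trans (add_le_add (hD i m' hm') (hD i m₀ hm₀ρ))) hm
  · have h2 : ‖∑ i, (m i - m₀ i) • (D i m₀ x y' - D i m₀ x y)‖ ≤ p * (‖m - m₀‖ * η) := by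
      refine (norm_sum_le_of_le _ fun i _ => ?_).trans_eq (b := ∑ _i : Fin p, ‖m - m₀‖ * η) ?_
      · rw [norm_smul]
        exact mul_le_mul (by simpa using PiLp.norm_apply_le (m - m₀) i) (hD i m₀ hm₀ρ)
          (norm_nonneg _) (norm_nonneg _)
      · rw [Finset.sum_const, Finset.card_univ, Fintype.card_fin, nsmul_eq_mul]
    have h3 := hd₀ y' hy' (hdy.trans_le (min_le_left _ _))
    rw [dist_eq_norm] at h3 ⊢
    have h4 : F m x y' - F m x y = (F m x y' - F m x y - (F m₀ x y' - F m₀ x y) -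
        ∑ i, (m i - m₀ i) • (D i m₀ x y' - D i m₀ x y)) +
        ∑ i, (m i - m₀ i) • (D i m₀ x y' - D i m₀ x y) + (F m₀ x y' - F m₀ x y) := by abel
    have h5 : ‖m - m₀‖ ≤ ρ := (mem_ball_iff_norm.1 hm).le
    have h6 : 3 * p * ρ * η ≤ ε / 2 := by
      have e : 3 * p * ρ * η = ε / 2 * (3 * p * ρ / (3 * p * ρ + 1)) := by
        rw [hη]; field_simp
      rw [e]
      refine mul_le_of_le_one_right (by positivity) ?_
      rw [div_le_one (by positivity)]
      linarith
    have h7 : p * (η * ‖m - m₀‖) ≤ p * (η * ρ) := by gcongr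
    rw [h4]
    refine (norm_add_le _ _).trans_lt ?_
    have h8 := norm_add_le (F m x y' - F m x y - (F m₀ x y' - F m₀ x y) -
        ∑ i, (m i - m₀ i) • (D i m₀ x y' - D i m₀ x y))
        (∑ i, (m i - m₀ i) • (D i m₀ x y' - D i m₀ x y))
    linarith
  · have hm'' := hρB (Metric.ball_subset_closedBall hm')
    exact ((h i).1 m' hm'' x hx y' hy').sub ((h i).1 m' hm'' x hx y hy)

/-- The kernel is Lipschitz in the parameter at `m₀`, uniformly in the space variables. -/
theorem exists_forall_norm_sub_le_mul {d p : ℕ} {W : Type*} [NormedAddCommGroup W]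
    [NormedSpace ℝ W] {B B' : Set (Euc p)} (hB : IsCompact B) (hB' : IsOpen B') (hBB' : B ⊆ B')
    {V R : Set (Euc d)} (hV : IsCompact V) (hR : IsCompact R) {F : Euc p → Euc d → Euc d → W}
    {D : Fin p → Euc p → Euc d → Euc d → W} (h : ∀ i, IsContPartial B' V R i F (D i))
    (hF : ContinuousOn (fun z : Euc p × Euc d × Euc d => F z.1 z.2.1 z.2.2) (B ×ˢ V ×ˢ R))
    {m₀ : Euc p} (hm₀ : m₀ ∈ B) :
    ∃ L, 0 ≤ L ∧ ∀ m ∈ B, ∀ x ∈ V, ∀ y ∈ R, ‖F m x y - F m₀ x y‖ ≤ L * ‖m - m₀‖ := by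
  obtain ⟨M, hM0, hM⟩ := hB.exists_forall_norm_le (hV.prod hR) (k := fun m z => F m z.1 z.2) hF
  have hDi : ∀ i, ∃ K, 0 ≤ K ∧ ∀ x ∈ V, ∀ y ∈ R, ‖D i m₀ x y‖ ≤ K := fun i =>
    hV.exists_forall_norm_le hR (k := D i m₀)
      ((h i).2.comp (f := fun z : Euc d × Euc d => (m₀, z.1, z.2)) (by fun_prop)
        fun z hz => ⟨hBB' hm₀, hz.1, hz.2⟩)
  choose K hK0 hK using hDi
  obtain ⟨δ, hδ, hd⟩ := exists_forall_norm_sub_sub_sum_partial_le hB' hV hR h (hBB' hm₀) one_pos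
  have hS : 0 ≤ ∑ i, K i := Finset.sum_nonneg fun i _ => hK0 i
  refine ⟨1 + ∑ i, K i + 2 * M / δ, by positivity, fun m hm x hx y hy => ?_⟩
  -- `B` need not be convex: near `m₀` the expansion gives the bound, and away from it boundedness
  -- does, through `2 * M / δ`.
  by_cases hmδ : m ∈ Metric.ball m₀ δ
  · have h1 := hd m hmδ x hx y hy
    have h2 : ‖∑ i, (m i - m₀ i) • D i m₀ x y‖ ≤ (∑ i, K i) * ‖m - m₀‖ := by
      rw [Finset.sum_mul]
      refine norm_sum_le_of_le _ fun i _ => ?_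
      rw [norm_smul, mul_comm]
      exact mul_le_mul (hK i x hx y hy) (by simpa using PiLp.norm_apply_le (m - m₀) i)
          (norm_nonneg _) (hK0 i)
    have h3 := norm_add_le (F m x y - F m₀ x y - ∑ i, (m i - m₀ i) • D i m₀ x y)
      (∑ i, (m i - m₀ i) • D i m₀ x y)
    rw [sub_add_cancel] at h3
    have h4 : 0 ≤ 2 * M / δ * ‖m - m₀‖ := by positivity
    linarith
  · rw [mem_ball_iff_norm, not_lt] at hmδ
    have h1 : ‖F m x y - F m₀ x y‖ ≤ M + M := (norm_sub_le _ _).trans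
      (add_le_add (hM m hm (x, y) ⟨hx, hy⟩) (hM m₀ hm₀ (x, y) ⟨hx, hy⟩))
    have h2 : M + M ≤ 2 * M / δ * ‖m - m₀‖ := by
      rw [div_mul_eq_mul_div, le_div_iff₀ hδ]
      nlinarith
    have h3 : 0 ≤ (1 + ∑ i, K i) * ‖m - m₀‖ := by positivity
    linarith

end Parameter

/-! ### Transport of the stability estimate to an equivalent norm. -/

section OperatorNormCalculus

variable {E X X' Y : Type*} [NormedAddCommGroup E] [NormedSpace ℝ E] [NormedAddCommGroup X]
  [NormedSpace ℝ X] [NormedAddCommGroup X'] [NormedSpace ℝ X'] [NormedAddCommGroup Y]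
  [NormedSpace ℝ Y]

theorem continuousOn_of_forall_norm_sub_lt {α : Type*} [PseudoMetricSpace α] {A : α → X →L[ℝ] Y}
    {B : Set α}
    (h : ∀ m ∈ B, ∀ ε > 0, ∃ δ > 0, ∀ m' ∈ B, dist m' m < δ → ‖A m' - A m‖ < ε) :
    ContinuousOn A B :=
  Metric.continuousOn_iff.2 fun m hm ε hε => by simpa only [dist_eq_norm (A _)] using h m hm ε hε

theorem hasFDerivWithinAt_of_forall_norm_le {A : E → X →L[ℝ] Y} {DA : E →L[ℝ] X →L[ℝ] Y}
    {B : Set E} {m₀ : E}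
    (h : ∀ ε > 0, ∀ᶠ m in 𝓝[B] m₀, ‖A m - A m₀ - DA (m - m₀)‖ ≤ ε * ‖m - m₀‖) :
    HasFDerivWithinAt A DA B m₀ :=
  hasFDerivWithinAt_iff_isLittleO.2 (Asymptotics.isLittleO_iff.2 fun ε hε => h ε hε)

/-- Composition on the right with a fixed operator. -/
def precompL (Y : Type*) [NormedAddCommGroup Y] [NormedSpace ℝ Y] (e : X' →L[ℝ] X) :
    (X →L[ℝ] Y) →L[ℝ] (X' →L[ℝ] Y) :=
  (ContinuousLinearMap.compL ℝ X' X Y).flip e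

theorem precompL_apply (e : X' →L[ℝ] X) (T : X →L[ℝ] Y) : precompL Y e T = T ∘L e := rfl

theorem HasFDerivWithinAt.precompL (e : X' →L[ℝ] X) {A : E → X →L[ℝ] Y} {DA : E →L[ℝ] X →L[ℝ] Y}
    {B : Set E} {m₀ : E} (h : HasFDerivWithinAt A DA B m₀) :
    HasFDerivWithinAt (fun m => _root_.precompL Y e (A m)) (_root_.precompL Y e ∘L DA) B m₀ :=
  (_root_.precompL Y e).hasFDerivAt.comp_hasFDerivWithinAt m₀ h

/-- `exists_pos_mul_le_norm_apply_sub` for a space which is only isomorphic to a Hilbert space. -/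
theorem exists_pos_mul_le_norm_apply_sub_of_equiv {E X Z Y : Type*} [NormedAddCommGroup E]
    [NormedSpace ℝ E] [FiniteDimensional ℝ E] [NormedAddCommGroup X] [NormedSpace ℝ X]
    [NormedAddCommGroup Z] [InnerProductSpace ℝ Z] [CompleteSpace Z] [NormedAddCommGroup Y]
    [InnerProductSpace ℝ Y] [CompleteSpace Y] (e : X ≃L[ℝ] Z) {B : Set E} (hB : IsCompact B)
    {A : E → X →L[ℝ] Y} (hcont : ContinuousOn A B) (hcomp : ∀ m ∈ B, IsCompactOperator (A m))
    {m₀ : E} (hm₀ : m₀ ∈ B) {DA : E →L[ℝ] X →L[ℝ] Y} (hDA : HasFDerivWithinAt A DA B m₀) {v₀ : X}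
    (hU1 : ∀ m ∈ B, ∀ u, A m u = A m₀ v₀ → m = m₀ ∧ u = v₀)
    (hU2 : ∀ q, ‖q‖ = 1 → ∀ w, DA q v₀ ≠ A m₀ w) {β : ℝ} (hβ : 0 < β) :
    ∃ c > 0, ∀ m ∈ B, ∀ u, e u ∈ upperEigenspan
        ((A m ∘L (e.symm : Z →L[ℝ] X)).adjoint ∘L (A m ∘L (e.symm : Z →L[ℝ] X))) (β ^ 2) →
      c * (‖u - v₀‖ + ‖m - m₀‖) ≤ ‖A m u - A m₀ v₀‖ := by
  let e' : Z →L[ℝ] X := e.symm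
  have hΦe : ∀ (T : X →L[ℝ] Y) u, precompL Y e' T (e u) = T u := fun T u => by
    rw [precompL_apply]; simp [e']
  obtain ⟨c, hc, hmain⟩ := exists_pos_mul_le_norm_apply_sub (A := fun m => precompL Y e' (A m))
    (v₀ := e v₀) hB ((precompL Y e').continuous.comp_continuousOn hcont)
    (fun m hm => (hcomp m hm).comp_clm e') hm₀ (hDA.precompL e') (fun m hm z hz => by
      obtain ⟨u, rfl⟩ := e.surjective z
      rw [hΦe, hΦe] at hz
      exact (hU1 m hm u hz).imp_right fun h => by rw [h])
    (fun q hq z hz => by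
      obtain ⟨w, rfl⟩ := e.surjective z
      change precompL Y e' (DA q) (e v₀) = precompL Y e' (A m₀) (e w) at hz
      rw [hΦe, hΦe] at hz
      exact hU2 q hq w hz) hβ
  refine ⟨c / (‖e'‖ + 1), by positivity, fun m hm u hu => ?_⟩
  have h1 := hmain m hm (e u) hu
  rw [hΦe, hΦe, ← map_sub] at h1
  refine le_trans ?_ h1
  have h3 : ‖u - v₀‖ ≤ ‖e'‖ * ‖e (u - v₀)‖ := by
    simpa [e'] using e'.le_opNorm (e (u - v₀))
  rw [div_mul_eq_mul_div, div_le_iff₀ (by positivity), mul_assoc]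
  gcongr
  nlinarith [norm_nonneg (e (u - v₀)), mul_nonneg (norm_nonneg e') (norm_nonneg (m - m₀))]

end OperatorNormCalculus

/-! ### The family of integral operators and estimate (1). -/

section OperatorFamily

variable {d p r s : ℕ} {R V : Set (Euc d)}

theorem HasKernel.sub [IsFiniteMeasure (surfaceMeasure r R)] (hR : IsCompact R) (hV : IsCompact V)
    {A A' : H10 r R →L[ℝ] Lp ℝ 2 (surfaceMeasure s V)} {h h' : Euc d → Euc d → ℝ}
    (hA : HasKernel s V A h) (hA' : HasKernel s V A' h') (hh : ∀ x ∈ V, ContinuousOn (h x) R)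
    (hh' : ∀ x ∈ V, ContinuousOn (h' x) R) :
    HasKernel s V (A - A') (fun x y => h x y - h' x y) := by
  intro u
  rw [_root_.sub_apply]
  filter_upwards [Lp.coeFn_sub (A u) (A' u), hA u, hA' u, ae_restrict_mem hV.isClosed.measurableSet]
    with x h1 h2 h3 hx
  rw [h1, Pi.sub_apply, h2, h3, intOp_eq_vecIntOp, intOp_eq_vecIntOp, intOp_eq_vecIntOp,
    vecIntOp_sub_kernel hR (hh x hx) (hh' x hx)]
  rfl

theorem intOp_sum_mul [IsFiniteMeasure (surfaceMeasure r R)] (hR : IsCompact R) {ι : Type*}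
    (t : Finset ι) (a : ι → ℝ) {k : ι → Euc d → Euc d → ℝ} {x : Euc d}
    (hk : ∀ i, ContinuousOn (k i x) R) (u : H10 r R) :
    intOp (fun x y => ∑ i ∈ t, a i * k i x y) u x = ∑ i ∈ t, a i * intOp (k i) u x := by
  simp only [intOp_eq_vecIntOp, vecIntOp, smul_eq_mul, Finset.mul_sum]
  rw [integral_finsetSum]
  · refine Finset.sum_congr rfl fun i _ => ?_
    rw [← integral_const_mul]
    exact integral_congr_ae (Eventually.of_forall fun y => by simp only [mul_left_comm])
  · intro i _
    exact integrable_h10Fn_smul hR u (continuousOn_const.mul (hk i))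

theorem HasKernel.sum_smul [IsFiniteMeasure (surfaceMeasure r R)] (hR : IsCompact R)
    (hV : IsCompact V) {ι : Type*} (t : Finset ι) (a : ι → ℝ)
    {A : ι → H10 r R →L[ℝ] Lp ℝ 2 (surfaceMeasure s V)} {k : ι → Euc d → Euc d → ℝ}
    (hA : ∀ i, HasKernel s V (A i) (k i)) (hk : ∀ i, ∀ x ∈ V, ContinuousOn (k i x) R) :
    HasKernel s V (∑ i ∈ t, a i • A i) (fun x y => ∑ i ∈ t, a i * k i x y) := by
  classical
  intro u
  have hV' : ∀ᵐ x ∂(surfaceMeasure s V), x ∈ V := ae_restrict_mem hV.isClosed.measurableSet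
  have h : (∑ i ∈ t, a i • A i) u =ᵐ[surfaceMeasure s V] fun x => ∑ i ∈ t, a i * intOp (k i) u x := by
    induction t using Finset.induction_on with
    | empty =>
      simp only [Finset.sum_empty]
      exact Lp.coeFn_zero _ _ _
    | insert i t hi ih =>
      simp only [Finset.sum_insert hi]
      rw [_root_.add_apply, _root_.smul_apply]
      filter_upwards [Lp.coeFn_add (a i • A i u) ((∑ i ∈ t, a i • A i) u),
        Lp.coeFn_smul (a i) (A i u), hA i u, ih] with x h1 h2 h3 h4
      rw [h1, Pi.add_apply, h2, Pi.smul_apply, h3, h4, smul_eq_mul]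
  filter_upwards [h, hV'] with x h1 hx
  rw [h1, intOp_sum_mul hR t a (fun i => hk i x hx)]

/-- The constant does not depend on the kernel, so uniform kernel estimates become operator norm
estimates. -/
theorem exists_norm_le_of_hasKernel [IsFiniteMeasure (surfaceMeasure r R)]
    [IsFiniteMeasure (surfaceMeasure s V)] (hR : IsCompact R) (hV : IsCompact V) :
    ∃ K : ℝ, 0 ≤ K ∧ ∀ (A : H10 r R →L[ℝ] Lp ℝ 2 (surfaceMeasure s V)) (h : Euc d → Euc d → ℝ)
      (M : ℝ), HasKernel s V A h → 0 ≤ M → (∀ x ∈ V, ∀ y ∈ R, ‖h x y‖ ≤ M) → ‖A‖ ≤ K * M := by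
  obtain ⟨C, hC0, hC⟩ := exists_integral_norm_h10Fn_le r R
  refine ⟨(measureUnivNNReal (surfaceMeasure s V) : ℝ) ^ (2 : ℝ≥0∞).toReal⁻¹ * C, by positivity,
    fun A h M hA hM0 hM => A.opNorm_le_bound (by positivity) fun u => ?_⟩
  refine (norm_Lp_le_of_forall_abs_le hV (hA u) (M := M * (C * ‖u‖)) (by positivity)
    fun x hx => ?_).trans_eq (by ring)
  rw [intOp_eq_vecIntOp]
  exact norm_vecIntOp_le hR hC hM0 (hM x hx) u

theorem exists_operatorFamily [IsFiniteMeasure (surfaceMeasure r R)]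
    [IsFiniteMeasure (surfaceMeasure s V)] (hR : IsCompact R) (hV : IsCompact V) {B : Set (Euc p)}
    (hB : IsCompact B) {H : Euc p → Euc d → Euc d → ℝ}
    (hH : ContinuousOn (fun z : Euc p × Euc d × Euc d => H z.1 z.2.1 z.2.2) (B ×ˢ V ×ˢ R)) :
    ∃ A : Euc p → H10 r R →L[ℝ] Lp ℝ 2 (surfaceMeasure s V),
      (∀ m ∈ B, HasKernel s V (A m) (H m) ∧ IsCompactOperator (A m)) ∧ ContinuousOn A B := by
  have hHm : ∀ m ∈ B, ContinuousOn (fun z : Euc d × Euc d => H m z.1 z.2) (V ×ˢ R) :=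
    fun m hm => hH.comp (f := fun z : Euc d × Euc d => (m, z)) (by fun_prop)
      fun z hz => ⟨hm, hz⟩
  have hex : ∀ m, ∃ A : H10 r R →L[ℝ] Lp ℝ 2 (surfaceMeasure s V), m ∈ B →
      HasKernel s V A (H m) ∧ IsCompactOperator A := by
    intro m
    by_cases hm : m ∈ B
    · obtain ⟨A, hA⟩ := exists_hasKernel (r := r) (s := s) hR hV (hHm m hm)
      exact ⟨A, fun _ => hA⟩
    · exact ⟨0, fun h => absurd h hm⟩
  choose A hA using hex
  refine ⟨A, hA, continuousOn_of_forall_norm_sub_lt fun m hm ε hε => ?_⟩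
  obtain ⟨K, hK0, hK⟩ := exists_norm_le_of_hasKernel (r := r) (s := s) hR hV
  obtain ⟨δ, hδ, hd⟩ := hB.exists_forall_norm_sub_lt (hV.prod hR) (k := fun m z => H m z.1 z.2) hH
    (ε := ε / (K + 1)) (by positivity)
  refine ⟨δ, hδ, fun m' hm' hdm => ?_⟩
  refine (hK _ _ (ε / (K + 1)) ((hA m' hm').1.sub hR hV (hA m hm).1
    (fun x hx => (hHm m' hm').kernel_section hx) (fun x hx => (hHm m hm).kernel_section hx))
    (by positivity) fun x hx y hy => (hd m' hm' m hm hdm (x, y) ⟨hx, hy⟩).le).trans_lt ?_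
  rw [mul_div_assoc', div_lt_iff₀ (by positivity)]
  nlinarith

/-- Differentiability in the parameter of the family of integral operators. -/
theorem exists_hasFDerivWithinAt_operatorFamily [IsFiniteMeasure (surfaceMeasure r R)]
    [IsFiniteMeasure (surfaceMeasure s V)] (hR : IsCompact R) (hV : IsCompact V)
    {B B' : Set (Euc p)} (hB' : IsOpen B') (hBB' : B ⊆ B') {H : Euc p → Euc d → Euc d → ℝ}
    (hH : ContinuousOn (fun z : Euc p × Euc d × Euc d => H z.1 z.2.1 z.2.2) (B ×ˢ V ×ˢ R))
    {D : Fin p → Euc p → Euc d → Euc d → ℝ} (hD : ∀ i, IsContPartial B' V R i H (D i))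
    {A : Euc p → H10 r R →L[ℝ] Lp ℝ 2 (surfaceMeasure s V)}
    (hA : ∀ m ∈ B, HasKernel s V (A m) (H m)) {m₀ : Euc p} (hm₀ : m₀ ∈ B) :
    ∃ DA : Euc p →L[ℝ] H10 r R →L[ℝ] Lp ℝ 2 (surfaceMeasure s V),
      HasFDerivWithinAt A DA B m₀ ∧
      ∀ q u, DA q u =ᵐ[surfaceMeasure s V]
        fun x => lineDeriv ℝ (fun m => intOp (H m) u x) m₀ q := by
  have hHm : ∀ m ∈ B, ∀ x ∈ V, ContinuousOn (H m x) R := fun m hm x hx =>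
    hH.comp (f := fun y : Euc d => (m, x, y)) (by fun_prop) fun y hy => ⟨hm, hx, hy⟩
  have hDm : ∀ i, ContinuousOn (fun z : Euc d × Euc d => D i m₀ z.1 z.2) (V ×ˢ R) := fun i =>
    (hD i).2.comp (f := fun z : Euc d × Euc d => (m₀, z)) (by fun_prop)
      fun z hz => ⟨hBB' hm₀, hz⟩
  have hDx : ∀ i, ∀ x ∈ V, ContinuousOn (D i m₀ x) R := fun i x hx => (hDm i).kernel_section hx
  have hex : ∀ i, ∃ A : H10 r R →L[ℝ] Lp ℝ 2 (surfaceMeasure s V), HasKernel s V A (D i m₀) :=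
    fun i => (exists_hasKernel (r := r) (s := s) hR hV (hDm i)).imp fun A h => h.1
  choose T hT using hex
  let DA : Euc p →L[ℝ] H10 r R →L[ℝ] Lp ℝ 2 (surfaceMeasure s V) :=
    ∑ i, (EuclideanSpace.proj i : Euc p →L[ℝ] ℝ).smulRight (T i)
  have hDA : ∀ q, DA q = ∑ i, q i • T i := by
    intro q
    simp [DA]
  have hDAk : ∀ q, HasKernel s V (DA q) (fun x y => ∑ i, q i * D i m₀ x y) := fun q => by
    rw [hDA]
    exact HasKernel.sum_smul hR hV _ _ hT hDx
  refine ⟨DA, hasFDerivWithinAt_of_forall_norm_le fun ε hε => ?_,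
    fun q u => ?_⟩
  · obtain ⟨K, hK0, hK⟩ := exists_norm_le_of_hasKernel (r := r) (s := s) hR hV
    obtain ⟨δ, hδ, hd⟩ := exists_forall_norm_sub_sub_sum_partial_le hB' hV hR hD (hBB' hm₀)
      (ε := ε / (K + 1)) (by positivity)
    filter_upwards [self_mem_nhdsWithin,
      mem_nhdsWithin_of_mem_nhds (Metric.ball_mem_nhds m₀ hδ)] with m hm hmδ
    have h1 := ((hA m hm).sub hR hV (hA m₀ hm₀) (hHm m hm) (hHm m₀ hm₀)).sub hR hV (hDAk (m - m₀))
      (fun x hx => (hHm m hm x hx).sub (hHm m₀ hm₀ x hx))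
      (fun x hx => continuousOn_finsetSum _ fun i _ => continuousOn_const.mul (hDx i x hx))
    refine (hK _ _ (ε / (K + 1) * ‖m - m₀‖) h1 (by positivity) (hd m hmδ)).trans ?_
    have e : K * (ε / (K + 1) * ‖m - m₀‖) = ε * ‖m - m₀‖ * (K / (K + 1)) := by ring
    rw [e]
    refine mul_le_of_le_one_right (by positivity) ?_
    rw [div_le_one (by positivity)]
    linarith
  · filter_upwards [hDAk q u, ae_restrict_mem hV.isClosed.measurableSet] with x hx hxV
    rw [hx, intOp_sum_mul hR _ _ (fun i => hDx i x hxV)]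
    obtain ⟨C, hC0, hC⟩ := exists_integral_norm_h10Fn_le r R
    let ℓ : Euc p →L[ℝ] ℝ :=
      ∑ i, (EuclideanSpace.proj i : Euc p →L[ℝ] ℝ).smulRight (intOp (D i m₀) u x)
    have hℓ : ∀ q, ℓ q = ∑ i, q i * intOp (D i m₀) u x := by
      intro q
      simp [ℓ]
    -- A pointwise derivative, at fixed `x`, is needed to identify `DA q u` with the `lineDeriv` of
    -- (U2).
    have hderiv : HasFDerivAt (fun m => intOp (H m) u x) ℓ m₀ := by
      refine hasFDerivAt_iff_isLittleO.2 (Asymptotics.isLittleO_iff.2 fun ε hε => ?_)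
      obtain ⟨δ, hδ, hd⟩ := exists_forall_norm_sub_sub_sum_partial_le hB' hV hR hD (hBB' hm₀)
        (ε := ε / (C * ‖u‖ + 1)) (by positivity)
      -- This derivative involves all `m` near `m₀`, also outside `B`, where continuity in `y` must
      -- be deduced from the partial derivatives.
      obtain ⟨δ', hδ', hd'⟩ := exists_forall_continuousOn_section hB' hR hD (hBB' hm₀) (hHm m₀ hm₀)
      filter_upwards [Metric.ball_mem_nhds m₀ hδ, Metric.ball_mem_nhds m₀ hδ'] with m hmδ hmδ'
      have hc : ContinuousOn (fun y => ∑ i, (m - m₀) i * D i m₀ x y) R :=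
        continuousOn_finsetSum _ fun i _ => continuousOn_const.mul (hDx i x hxV)
      have hc' : ContinuousOn (fun y => H m x y - H m₀ x y) R :=
        (hd' m hmδ' x hxV).sub (hHm m₀ hm₀ x hxV)
      rw [hℓ, ← intOp_sum_mul hR _ _ (fun i => hDx i x hxV), intOp_eq_vecIntOp, intOp_eq_vecIntOp,
        intOp_eq_vecIntOp, vecIntOp_sub_kernel hR (hd' m hmδ' x hxV) (hHm m₀ hm₀ x hxV),
        vecIntOp_sub_kernel hR (k := fun _ y => H m x y - H m₀ x y)
          (k' := fun x y => ∑ i, (m - m₀) i * D i m₀ x y) hc' hc]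
      refine (norm_vecIntOp_le hR hC (M := ε / (C * ‖u‖ + 1) * ‖m - m₀‖) (by positivity)
        (fun y hy => hd m hmδ x hxV y hy) u).trans ?_
      have e : ε / (C * ‖u‖ + 1) * ‖m - m₀‖ * (C * ‖u‖) =
        ε * ‖m - m₀‖ * (C * ‖u‖ / (C * ‖u‖ + 1)) := by ring
      rw [e]
      refine mul_le_of_le_one_right (by positivity) ?_
      rw [div_le_one (by positivity)]
      linarith
    rw [← hℓ, (hderiv.hasLineDerivAt q).lineDeriv]

/-- Pointwise bound for the difference of two integrals with nearby parameters. -/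
theorem exists_norm_vecIntOp_sub_le [IsFiniteMeasure (surfaceMeasure r R)] {W : Type*}
    [NormedAddCommGroup W] [NormedSpace ℝ W] [SecondCountableTopology W] (hR : IsCompact R)
    (hV : IsCompact V) {B B' : Set (Euc p)} (hB : IsCompact B) (hB' : IsOpen B') (hBB' : B ⊆ B')
    {F : Euc p → Euc d → Euc d → W} {D : Fin p → Euc p → Euc d → Euc d → W}
    (h : ∀ i, IsContPartial B' V R i F (D i))
    (hF : ContinuousOn (fun z : Euc p × Euc d × Euc d => F z.1 z.2.1 z.2.2) (B ×ˢ V ×ˢ R))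
    {m₀ : Euc p} (hm₀ : m₀ ∈ B) (v₀ : H10 r R) :
    ∃ C, 0 ≤ C ∧ ∀ m ∈ B, ∀ u : H10 r R, ∀ x ∈ V,
      ‖vecIntOp (F m) u x - vecIntOp (F m₀) v₀ x‖ ≤ C * (‖u - v₀‖ + ‖m - m₀‖) := by
  obtain ⟨C, hC0, hC⟩ := exists_integral_norm_h10Fn_le r R
  obtain ⟨M, hM0, hM⟩ := hB.exists_forall_norm_le (hV.prod hR) (k := fun m z => F m z.1 z.2) hF
  obtain ⟨L, hL0, hL⟩ := exists_forall_norm_sub_le_mul hB hB' hBB' hV hR h hF hm₀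
  refine ⟨M * C + L * (C * ‖v₀‖), by positivity, fun m hm u x hx => ?_⟩
  have hFm : ∀ m ∈ B, ContinuousOn (F m x) R := fun m hm =>
    hF.comp (f := fun y : Euc d => (m, x, y)) (by fun_prop) fun y hy => ⟨hm, hx, hy⟩
  have e : vecIntOp (F m) u x - vecIntOp (F m₀) v₀ x =
      vecIntOp (F m) (u - v₀) x + vecIntOp (fun _ y => F m x y - F m₀ x y) v₀ x := by
    rw [vecIntOp_sub hR (hFm m hm), ← vecIntOp_sub_kernel hR (hFm m hm) (hFm m₀ hm₀)]
    abel
  have h1 := norm_vecIntOp_le hR hC hM0 (k := F m) (x := x)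
    (fun y hy => hM m hm (x, y) ⟨hx, hy⟩) (u - v₀)
  have h2 := norm_vecIntOp_le hR hC (k := fun _ y => F m x y - F m₀ x y) (x := x)
    (M := L * ‖m - m₀‖) (by positivity) (hL m hm x hx) v₀
  rw [e]
  refine (norm_add_le _ _).trans ((add_le_add h1 h2).trans ?_)
  have h3 : 0 ≤ M * C * ‖m - m₀‖ := by positivity
  have h4 : 0 ≤ L * (C * ‖v₀‖) * ‖u - v₀‖ := by positivity
  nlinarith

theorem L2Norm_eq_norm {f : Euc d → ℝ} {F : Lp ℝ 2 (surfaceMeasure s V)}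
    (h : F =ᵐ[surfaceMeasure s V] f) : L2Norm (surfaceMeasure s V) f = ‖F‖ := by
  rw [L2Norm, ← Real.sqrt_sq (norm_nonneg F), ← real_inner_self_eq_norm_sq, L2.inner_def]
  congr 1
  refine integral_congr_ae (h.mono fun x hx => ?_)
  simp only [hx, real_inner_self_eq_norm_sq, Real.norm_eq_abs, sq_abs]

theorem L2Inner_eq_inner {f g : Euc d → ℝ} {F G : Lp ℝ 2 (surfaceMeasure s V)}
    (hf : F =ᵐ[surfaceMeasure s V] f) (hg : G =ᵐ[surfaceMeasure s V] g) :
    L2Inner (surfaceMeasure s V) f g = inner ℝ F G := by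
  rw [L2Inner, L2.inner_def]
  refine integral_congr_ae ?_
  filter_upwards [hf, hg] with x h1 h2
  simp [h1, h2, mul_comm]

/-- Tested against all vectors, the relation `IsAdjointImage` is the eigenvalue equation for the
adjoint of the transported operator. -/
theorem map_mem_upperEigenspan_of_mem_eigenSpan {X : Type*} [NormedAddCommGroup X]
    [InnerProductSpace ℝ X] [CompleteSpace X] (e : H10 r R ≃L[ℝ] X)
    (he : ∀ u v, inner ℝ (e u) (e v) = gradInner u v)
    {A : H10 r R →L[ℝ] Lp ℝ 2 (surfaceMeasure s V)} {h : Euc d → Euc d → ℝ}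
    (hA : HasKernel s V A h) {β : ℝ} {u : H10 r R} (hu : u ∈ eigenSpan r s R V h β) :
    e u ∈ upperEigenspan
      ((A ∘L (e.symm : X →L[ℝ] H10 r R)).adjoint ∘L (A ∘L (e.symm : X →L[ℝ] H10 r R))) (β ^ 2) := by
  induction hu using Submodule.span_induction with
  | mem v hv =>
    obtain ⟨-, μ, hμ, hv⟩ := hv
    refine Submodule.subset_span ⟨μ, hμ, ext_inner_right ℝ fun z => ?_⟩
    obtain ⟨φ, rfl⟩ := e.surjective z
    rw [inner_adjoint_comp_self, ← map_smul, he, hv φ, L2Inner_eq_inner (hA v) (hA φ)]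
    simp
  | zero => rw [map_zero]; exact Submodule.zero_mem _
  | add a b _ _ ha hb => rw [map_add]; exact Submodule.add_mem _ ha hb
  | smul c a _ ha => rw [map_smul]; exact Submodule.smul_mem _ _ ha

/-- The term `‖u - v₀‖` is kept because the quadrature step uses it to bound the residual and its
gradient in sup norm. -/
theorem exists_pos_mul_le_L2Norm (hR : IsCompactEmbeddedManifold r R)
    (hV : IsCompactEmbeddedManifold s V)
    (hbd : ∀ x ∈ R, (connectedComponentIn R x ∩ manifoldBoundary r R).Nonempty)
    {B B' : Set (Euc p)} (hB : IsCompact B) (hB' : IsOpen B') (hBB' : B ⊆ B')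
    {H : Euc p → Euc d → Euc d → ℝ}
    (hH : ContinuousOn (fun z : Euc p × Euc d × Euc d => H z.1 z.2.1 z.2.2) (B ×ˢ V ×ˢ R))
    {D : Fin p → Euc p → Euc d → Euc d → ℝ} (hD : ∀ i, IsContPartial B' V R i H (D i))
    (hU1 : UniqueIdentification r s B V R H) (hU2 : InfinitesimalUniqueness r s B V R H)
    {β : ℝ} (hβ : 0 < β) {m₀ : Euc p} (hm₀ : m₀ ∈ B) {v₀ : H10 r R} (hv₀ : v₀ ≠ 0) :
    ∃ c > 0, ∀ m ∈ B, ∀ u ∈ eigenSpan r s R V (H m) β, c * (‖u - v₀‖ + ‖m - m₀‖) ≤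
      L2Norm (surfaceMeasure s V) (fun x => intOp (H m) u x - intOp (H m₀) v₀ x) := by
  have := hR.isFiniteMeasure_surfaceMeasure
  have := hV.isFiniteMeasure_surfaceMeasure
  obtain ⟨X, e, hX, he⟩ := hR.exists_gradEquiv hbd
  obtain ⟨A, hA, hcont⟩ := exists_operatorFamily (r := r) (s := s) hR.isCompact hV.isCompact hB hH
  obtain ⟨DA, hDA, hDA'⟩ := exists_hasFDerivWithinAt_operatorFamily hR.isCompact hV.isCompact hB'
    hBB' hH hD (fun m hm => (hA m hm).1) hm₀
  have key := exists_pos_mul_le_norm_apply_sub_of_equiv e hB hcont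
    (fun m hm => (hA m hm).2) hm₀ hDA (v₀ := v₀) (fun m hm u hu => ?_) (fun q hq w hw => ?_) hβ
  · obtain ⟨c, hc, hmain⟩ := key
    refine ⟨c, hc, fun m hm u hu => ?_⟩
    have h2 : L2Norm (surfaceMeasure s V) (fun x => intOp (H m) u x - intOp (H m₀) v₀ x) =
        ‖A m u - A m₀ v₀‖ := by
      refine L2Norm_eq_norm ?_
      filter_upwards [Lp.coeFn_sub (A m u) (A m₀ v₀), (hA m hm).1 u, (hA m₀ hm₀).1 v₀]
        with x h1 h2 h3
      rw [h1, Pi.sub_apply, h2, h3]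
    rw [h2]
    exact hmain m hm u (map_mem_upperEigenspan_of_mem_eigenSpan e he (hA m hm).1 hu)
  · exact hU1 m hm m₀ hm₀ u v₀
      (((hA m hm).1 u).symm.trans (by rw [hu]; exact (hA m₀ hm₀).1 v₀)) (Or.inr hv₀)
  · exact hv₀ (hU2 q hq m₀ hm₀ v₀ w
      ((hDA' q v₀).symm.trans (by rw [hw]; exact (hA m₀ hm₀).1 w))).1

end OperatorFamily

/-! ### Quadrature of squares and the main theorem. -/

section Quadrature

/-- A quadrature rule of order one integrates the square of a `C¹` function up to a factor, if the
function and its gradient are bounded in terms of its `L²` norm. -/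
theorem QuadratureOrderOne.exists_forall_le_sum {d s : ℕ} {V : Set (Euc d)} {M : ℕ → ℕ}
    (hM : StrictMono M) {P : (n : ℕ) → Fin (M n) → Euc d} {c : (n : ℕ) → Fin (M n) → ℝ}
    (hQ : QuadratureOrderOne s V M P c) {a : ℝ} (ha : 0 ≤ a) :
    ∃ N : ℕ, ∀ k > N, ∀ (w : Euc d → ℝ) (g : Euc d → Euc d), IsC1WithGradient V w g →
      (∀ x ∈ V, |w x| ≤ a * L2Norm (surfaceMeasure s V) w) →
      (∀ x ∈ V, ‖g x‖ ≤ a * L2Norm (surfaceMeasure s V) w) →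
      (L2Norm (surfaceMeasure s V) w / 2) ^ 2 ≤ ∑ j, c k j * |w (P k j)| ^ 2 := by
  obtain ⟨K, hK⟩ := hQ
  obtain ⟨N₁, hN₁⟩ := eventually_atTop.1 hK
  -- The gradient of `w ^ 2` is at most `2 * a * a * I ^ 2`. Past this threshold, as `k ≤ M k`, the
  -- error is at most `3 / 4 * I ^ 2`, which leaves `(I / 2) ^ 2`.
  obtain ⟨N₂, hN₂⟩ := exists_nat_ge (4 / 3 * (|K| * (2 * a * a)))
  refine ⟨max N₁ N₂, fun k hk w g hw hwa hga => ?_⟩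
  set I := L2Norm (surfaceMeasure s V) w with hI
  have hI0 : 0 ≤ I := Real.sqrt_nonneg _
  have hI2 : ∫ x, w x ^ 2 ∂(surfaceMeasure s V) = I ^ 2 :=
    (Real.sq_sqrt (integral_nonneg fun x => sq_nonneg (w x))).symm
  have hk₁ : N₁ ≤ k := (le_max_left _ _).trans hk.le
  have hk₂ : N₂ < k := (le_max_right _ _).trans_lt hk
  have hMk : (k : ℝ) ≤ M k := by exact_mod_cast hM.le_apply
  have hk0 : (0 : ℝ) < M k := by
    have : (0 : ℝ) < k := by exact_mod_cast (Nat.zero_le _).trans_lt hk₂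
    linarith
  have hsup0 : 0 ≤ ⨆ x : V, ‖(2 * w x) • g x‖ := Real.iSup_nonneg fun _ => norm_nonneg _
  have hsup : ⨆ x : V, ‖(2 * w x) • g x‖ ≤ 2 * a * a * I ^ 2 := by
    refine Real.iSup_le (fun x => ?_) (by positivity)
    rw [norm_smul, norm_mul, Real.norm_two, Real.norm_eq_abs]
    have := mul_le_mul (hwa x x.2) (hga x x.2) (norm_nonneg _) (by positivity)
    nlinarith
  have herr := hN₁ k hk₁ _ _ hw.sq
  rw [hI2] at herr
  have hb : K / M k * ⨆ x : V, ‖(2 * w x) • g x‖ ≤ 3 / 4 * I ^ 2 := by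
    calc K / M k * ⨆ x : V, ‖(2 * w x) • g x‖
        ≤ |K| / M k * (2 * a * a * I ^ 2) := by
          gcongr
          exact le_abs_self K
      _ = |K| * (2 * a * a) / M k * I ^ 2 := by ring
      _ ≤ 3 / 4 * I ^ 2 := by
          refine mul_le_mul_of_nonneg_right ?_ (sq_nonneg I)
          rw [div_le_iff₀ hk0]
          have : (N₂ : ℝ) < k := by exact_mod_cast hk₂
          linarith
  have h1 := (abs_le.1 (herr.trans hb)).1
  simp only [sq_abs]
  nlinarith

end Quadrature

theorem mainTheorem3 {d p r s : ℕ}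
    (R V : Set (Euc d)) (hR : IsCompactEmbeddedManifold r R) (hV : IsCompactEmbeddedManifold s V)
    (hbd : ∀ x ∈ R, (connectedComponentIn R x ∩ manifoldBoundary r R).Nonempty)
    (B : Set (Euc p)) (hB : IsCompact B)
    (H : Euc p → Euc d → Euc d → ℝ)
    (hR1 : KernelC1 B V R H) (hR2 : KernelParamRegular B V R H)
    (hU1 : UniqueIdentification r s B V R H) (hU2 : InfinitesimalUniqueness r s B V R H)
    (M : ℕ → ℕ) (hM : StrictMono M)
    (P : (n : ℕ) → Fin (M n) → Euc d) (hP : ∀ n j, P n j ∈ V)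
    (c : (n : ℕ) → Fin (M n) → ℝ) (hQ : QuadratureOrderOne s V M P c)
    (β : ℝ) (hβ : 0 < β) (m₀ : Euc p) (hm₀ : m₀ ∈ B) (v₀ : H10 r R) (hv₀ : v₀ ≠ 0) :
    (∃ C : ℝ, 0 < C ∧ ∀ m ∈ B, ∀ u ∈ eigenSpan r s R V (H m) β,
      C * ‖m - m₀‖ ≤
        L2Norm (surfaceMeasure s V) (fun x => intOp (H m) u x - intOp (H m₀) v₀ x)) ∧
    ∀ C : ℝ, 0 < C →
      (∀ m ∈ B, ∀ u ∈ eigenSpan r s R V (H m) β,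
        C * ‖m - m₀‖ ≤
          L2Norm (surfaceMeasure s V) (fun x => intOp (H m) u x - intOp (H m₀) v₀ x)) →
      ∃ N : ℕ, ∀ k > N, ∀ m ∈ B, ∀ u ∈ eigenSpan r s R V (H m) β,
        0 ≤ ∑ j, c k j * |intOp (H m) u (P k j) - intOp (H m₀) v₀ (P k j)| ^ 2 ∧
        C / 2 * ‖m - m₀‖ ≤
          √(∑ j, c k j * |intOp (H m) u (P k j) - intOp (H m₀) v₀ (P k j)| ^ 2) := by
  have := hR.isFiniteMeasure_surfaceMeasure
  have := hV.isFiniteMeasure_surfaceMeasure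
  obtain ⟨hH, G₁, hG₁, hG₁c⟩ := hR1
  obtain ⟨B', hB', hBB', G, D, DG, -, hG, hD, hDG, -⟩ := hR2
  -- (R1) and (R2) each come with a gradient field. Uniqueness of the tangential gradient transfers
  -- continuity from the first to the second.
  have hGc : ContinuousOn (fun z : Euc p × Euc d × Euc d => G z.1 z.2.1 z.2.2) (B ×ˢ V ×ˢ R) :=
    hG₁c.congr fun z hz => (hG z.1 (hBB' hz.1) z.2.1 hz.2.1 z.2.2 hz.2.2).unique
      (hG₁ z.1 hz.1 z.2.1 hz.2.1 z.2.2 hz.2.2)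
  obtain ⟨b, hb, hmain⟩ := exists_pos_mul_le_L2Norm hR hV hbd hB hB' hBB' hH hD hU1 hU2 hβ hm₀ hv₀
  obtain ⟨a₁, ha₁, h₁⟩ := exists_norm_vecIntOp_sub_le hR.isCompact hV.isCompact hB hB' hBB' hD hH
    hm₀ v₀
  obtain ⟨a₂, ha₂, h₂⟩ := exists_norm_vecIntOp_sub_le hR.isCompact hV.isCompact hB hB' hBB' hDG hGc
    hm₀ v₀
  refine ⟨⟨b, hb, fun m hm u hu => le_trans ?_ (hmain m hm u hu)⟩, fun C hC hmC => ?_⟩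
  · gcongr
    exact le_add_of_nonneg_left (norm_nonneg _)
  -- The sup bounds `a₁`, `a₂` are combined with the stability constant `b`, so `N` depends neither
  -- on `C` nor on `m` and `u`.
  obtain ⟨N, hN⟩ := hQ.exists_forall_le_sum hM (a := (a₁ + a₂) / b) (by positivity)
  refine ⟨N, fun k hk m hm u hu => ?_⟩
  have hC1 : ∀ m ∈ B, ∀ u : H10 r R, IsC1WithGradient V (intOp (H m) u) (vecIntOp (G m) u) :=
    fun m hm u => isC1WithGradient_intOp hR.isCompact hV
      (hH.comp (f := fun z : Euc d × Euc d => (m, z)) (by fun_prop) fun z hz => ⟨hm, hz⟩)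
      (hGc.comp (f := fun z : Euc d × Euc d => (m, z)) (by fun_prop) fun z hz => ⟨hm, hz⟩)
      (hG m (hBB' hm)) u
  have hmain' := hmain m hm u hu
  set I := L2Norm (surfaceMeasure s V) (fun x => intOp (H m) u x - intOp (H m₀) v₀ x) with hI
  have hI0 : 0 ≤ I := Real.sqrt_nonneg _
  have hle : ∀ a, 0 ≤ a → a ≤ a₁ + a₂ → a * (‖u - v₀‖ + ‖m - m₀‖) ≤ (a₁ + a₂) / b * I := by
    intro a ha haa
    rw [div_mul_eq_mul_div, le_div_iff₀ hb, mul_assoc, mul_comm _ b]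
    gcongr
  have hsum := hN k hk _ _ ((hC1 m hm u).sub (hC1 m₀ hm₀ v₀))
    (fun x hx => by
      have := h₁ m hm u x hx
      rw [← intOp_eq_vecIntOp, ← intOp_eq_vecIntOp] at this
      exact this.trans (hle a₁ ha₁ (by linarith)))
    (fun x hx => (h₂ m hm u x hx).trans (hle a₂ ha₂ (by linarith)))
  rw [← hI] at hsum
  refine ⟨(sq_nonneg _).trans hsum, le_trans ?_ (Real.le_sqrt_of_sq_le hsum)⟩
  have := hmC m hm u hu
  linarith

end
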